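/- Let $\mathsf G$ be a solvable Lie group, $\Gamma\le\mathsf G$ a discrete subgroup, and $M$ the solvmanifold obtained as the quotient of $\mathsf G$ by the action of $\Gamma$ by left translations (usually written $\mathsf G/\Gamma$; it need not be compact), with projection $\pi\colon\mathsf G\to M$. Let $H$ be a smooth closed $3$-form on $M$. A smooth family $(g_t,b_t)_{t\in I}$ of Riemannian metrics $g_t$ and $2$-forms $b_t$ on $M$, where $I\subseteq[0,\infty)$ is an interval containing $0$, is a solution of the generalized Ricci flow on the exact Courant algebroid $(TM\oplus T^*M)_H$ if $$\frac{\partial}{\partial t}g_t=-2\operatorname{Ric}(g_t)+\tfrac12\,(H+\mathrm d b_t)^2_{g_t},\qquad \frac{\partial}{\partial t}b_t=-\mathrm d^*_{g_t}(H+\mathrm d b_t),\qquad t\in I,$$ with one-sided derivatives at end points of $I$. Here, for a $3$-form $\eta$ and a local $g$-orthonormal frame $(e_i)$, $\eta^2_g(X,Y)=\sum_{i,j}\eta(X,e_i,e_j)\,\eta(Y,e_i,e_j)$ and $(\mathrm d^*_g\eta)(X,Y)=-\sum_i(\nabla_{e_i}\eta)(e_i,X,Y)$, with $\nabla$ the Levi-Civita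 connection of $g$. The solution is invariant if the pullbacks by $\pi$ of $g_t$ and $b_t-b_0$ ($t\in I$) and of $H+\mathrm d b_0$ are left-invariant on $\mathsf G$ (for instance, if the pullbacks of $H$, $g_t$ and $b_t$ are left-invariant). Then every invariant solution of the generalized Ricci flow on $M$ exists for all positive times: for every $T\in(0,\infty)$, each invariant solution $(g_t,b_t)_{t\in[0,T)}$ extends to an invariant solution $(g_t,b_t)_{t\in[0,\infty)}$. Moreover, for every smooth Riemannian metric $g_0$ and smooth $2$-form $b_0$ on $M$ such that the pullbacks by $\pi$ of $g_0$ and $H+\mathrm d b_0$ are left-invariant, there is an invariant solution on $[0,\infty)$ with the initial value $(g_0,b_0)$. -/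

import Mathlib

open Set
open scoped Manifold ContDiff Topology

noncomputable section

/-! ## Local tensor calculus on a finite-dimensional real vector space

`γ` is a metric on (an open subset of) `E`, written `γ y u v`; `η` is a `3`-form.  Vectors
`u v w : E` are regarded as constant vector fields.  Contractions are taken in a basis `bᵢ` of `E`
with dual basis `bⁱ`; `♯` is the isomorphism `E* → E` given by the metric. -/

namespace LocalGeom

variable {E : Type*} [NormedAddCommGroup E] [NormedSpace ℝ E]

/-- The Christoffel symbols `Γ_y(u, v) ∈ E` of the Levi-Civita connection of `γ`, defined by
`γ(Γ(u,v), w) = ½ (∂_u γ(v,w) + ∂_v γ(u,w) - ∂_w γ(u,v))`. -/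
def christoffel (γ : E → E →L[ℝ] E →L[ℝ] ℝ) (y u v : E) : E :=
  (γ y).inverse ((1 / 2 : ℝ) •
    (fderiv ℝ γ y u v + fderiv ℝ γ y v u - ((fderiv ℝ γ y).flip u).flip v))

/-- The curvature tensor `R(u,v)w = ∇_u ∇_v w - ∇_v ∇_u w` for constant `u`, `v`, `w`. -/
def riemann (γ : E → E →L[ℝ] E →L[ℝ] ℝ) (y u v w : E) : E :=
  fderiv ℝ (fun z ↦ christoffel γ z v w) y u - fderiv ℝ (fun z ↦ christoffel γ z u w) y v
    + christoffel γ y u (christoffel γ y v w) - christoffel γ y v (christoffel γ y u w)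

/-- The covariant derivative `(∇_u η)(p, v, w)` of a `3`-form with respect to the Levi-Civita
connection of `γ`. -/
def covDeriv (γ : E → E →L[ℝ] E →L[ℝ] ℝ) (η : E → E [⋀^Fin 3]→L[ℝ] ℝ) (y u p v w : E) : ℝ :=
  fderiv ℝ η y u ![p, v, w] - η y ![christoffel γ y u p, v, w]
    - η y ![p, christoffel γ y u v, w] - η y ![p, v, christoffel γ y u w]

variable [FiniteDimensional ℝ E]

/-- The vectors `♯bⁱ`, where `bⁱ` is the dual basis of the chosen basis of `E`. -/
def sharpDual (γ : E →L[ℝ] E →L[ℝ] ℝ) (i : Fin (Module.finrank ℝ E)) : E :=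
  γ.inverse (LinearMap.toContinuousLinearMap ((Module.finBasis ℝ E).coord i))

/-- The Ricci tensor `Ric(v, w) = tr (u ↦ R(u, v) w)`. -/
def ricci (γ : E → E →L[ℝ] E →L[ℝ] ℝ) (y v w : E) : ℝ :=
  ∑ i, (Module.finBasis ℝ E).coord i (riemann γ y (Module.finBasis ℝ E i) v w)

/-- The symmetric tensor `η²(u, v) = ⟨ι_u η, ι_v η⟩ = γ^{ik} γ^{jl} η(u, bᵢ, bⱼ) η(v, b_k, b_l)`. -/
def formSq (γ : E →L[ℝ] E →L[ℝ] ℝ) (η : E [⋀^Fin 3]→L[ℝ] ℝ) (u v : E) : ℝ :=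
  ∑ i, ∑ j, η ![u, Module.finBasis ℝ E i, Module.finBasis ℝ E j] *
    η ![v, sharpDual γ i, sharpDual γ j]

/-- The codifferential `(d*η)(v, w) = - γ^{ij} (∇_{bᵢ} η)(bⱼ, v, w)`. -/
def codiff (γ : E → E →L[ℝ] E →L[ℝ] ℝ) (η : E → E [⋀^Fin 3]→L[ℝ] ℝ) (y v w : E) : ℝ :=
  -∑ i, covDeriv γ η y (Module.finBasis ℝ E i) (sharpDual (γ y) i) v w

end LocalGeom

/-! ## Tensor fields on manifolds

Manifolds are modelled on `𝓘(ℝ, E)`.  A tensor field is expressed in the chart at `x₀` by pulling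
it back along the inverse of this chart, and the value at `x` of a tensor that is built from
derivatives is computed in the chart at `x` and carried back by the differential of the chart. -/

namespace GRF

variable {E : Type*} [NormedAddCommGroup E] [NormedSpace ℝ E]

/-- Fields of `k`-forms (of no regularity). -/
abbrev FormField (E : Type*) [NormedAddCommGroup E] [NormedSpace ℝ E]
    (M : Type*) [TopologicalSpace M] [ChartedSpace E M] (k : ℕ) : Type _ :=
  (x : M) → TangentSpace 𝓘(ℝ, E) x [⋀^Fin k]→L[ℝ] ℝ

/-- Fields of bilinear forms on the tangent spaces (of no regularity). -/
abbrev BilinField (E : Type*) [NormedAddCommGroup E] [NormedSpace ℝ E]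
    (M : Type*) [TopologicalSpace M] [ChartedSpace E M] : Type _ :=
  (x : M) → TangentSpace 𝓘(ℝ, E) x →L[ℝ] TangentSpace 𝓘(ℝ, E) x →L[ℝ] ℝ

/-- Riemannian metrics (fields of inner products, of no regularity). -/
abbrev Metric (E : Type*) [NormedAddCommGroup E] [NormedSpace ℝ E]
    (M : Type*) [TopologicalSpace M] [ChartedSpace E M] : Type _ :=
  Bundle.RiemannianMetric (fun x : M ↦ TangentSpace 𝓘(ℝ, E) x)

section Pullback

variable {M : Type*} [TopologicalSpace M] [ChartedSpace E M]
  {N : Type*} [TopologicalSpace N] [ChartedSpace E N]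

/-- The pullback `f^* θ` of a form. -/
def pullForm {k : ℕ} (f : N → M) (θ : FormField E M k) : FormField E N k :=
  fun x ↦ (θ (f x)).compContinuousLinearMap (mfderiv 𝓘(ℝ, E) 𝓘(ℝ, E) f x)

/-- The pullback `f^* h` of a field of bilinear forms. -/
def pullBilin (f : N → M) (h : BilinField E M) : BilinField E N :=
  fun x ↦
    let D := mfderiv 𝓘(ℝ, E) 𝓘(ℝ, E) f x
    (D.precomp ℝ).comp ((h (f x)).comp D)

end Pullback

variable {M : Type*} [TopologicalSpace M] [ChartedSpace E M]

/-- The form `θ` in the chart at `x₀`. -/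
def formInChart {k : ℕ} (θ : FormField E M k) (x₀ : M) : E → E [⋀^Fin k]→L[ℝ] ℝ :=
  pullForm (extChartAt 𝓘(ℝ, E) x₀).symm θ

/-- The field of bilinear forms `h` in the chart at `x₀`. -/
def bilinInChart (h : BilinField E M) (x₀ : M) : E → E →L[ℝ] E →L[ℝ] ℝ :=
  pullBilin (extChartAt 𝓘(ℝ, E) x₀).symm h

/-- The differential at `x` of the chart at `x`. -/
def dChart (x : M) : TangentSpace 𝓘(ℝ, E) x →L[ℝ] E :=
  mfderiv 𝓘(ℝ, E) 𝓘(ℝ, E) (extChartAt 𝓘(ℝ, E) x) x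

/-- Smoothness of a form: it is smooth in every chart. -/
def SmoothForm {k : ℕ} (θ : FormField E M k) : Prop :=
  ∀ x₀ : M, ContDiffOn ℝ ∞ (formInChart θ x₀) (extChartAt 𝓘(ℝ, E) x₀).target

/-- Smoothness of a Riemannian metric: it is smooth in every chart. -/
def SmoothMetric (g : Metric E M) : Prop :=
  ∀ x₀ : M, ContDiffOn ℝ ∞ (bilinInChart g.inner x₀) (extChartAt 𝓘(ℝ, E) x₀).target

/-- The exterior derivative of a form. -/
def extD {k : ℕ} (θ : FormField E M k) : FormField E M (k + 1) :=
  fun x ↦ (extDeriv (formInChart θ x) (extChartAt 𝓘(ℝ, E) x x)).compContinuousLinearMap (dChart x)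

variable [FiniteDimensional ℝ E]

/-- The Ricci tensor `Ric(g)`. -/
def ricci (g : Metric E M) (x : M) (u v : TangentSpace 𝓘(ℝ, E) x) : ℝ :=
  LocalGeom.ricci (bilinInChart g.inner x) (extChartAt 𝓘(ℝ, E) x x) (dChart x u) (dChart x v)

/-- The codifferential `d*_g η` of a `3`-form `η`. -/
def codiff (g : Metric E M) (η : FormField E M 3) (x : M) (u v : TangentSpace 𝓘(ℝ, E) x) : ℝ :=
  LocalGeom.codiff (bilinInChart g.inner x) (formInChart η x) (extChartAt 𝓘(ℝ, E) x x)
    (dChart x u) (dChart x v)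

/-- The symmetric tensor `η²_g(u, v) = g(ι_u η, ι_v η)` of a `3`-form `η`. -/
def formSq (g : Metric E M) (η : FormField E M 3) (x : M) (u v : TangentSpace 𝓘(ℝ, E) x) : ℝ :=
  LocalGeom.formSq (bilinInChart g.inner x (extChartAt 𝓘(ℝ, E) x x))
    (formInChart η x (extChartAt 𝓘(ℝ, E) x x)) (dChart x u) (dChart x v)

/-- `(g_t, b_t)`, `t ∈ S`, is a smooth family of generalized metrics on the exact Courant algebroid
`(TM ⊕ T*M)_H` that solves the generalized Ricci flow
`∂g/∂t = -2 Ric(g) + ½ (H + db)²`, `∂b/∂t = -d*(H + db)`.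
Values of the family at times outside `S` play no role. -/
structure IsSolution (H : FormField E M 3) (S : Set ℝ) (g : ℝ → Metric E M)
    (b : ℝ → FormField E M 2) : Prop where
  smooth_metric : ∀ x₀ : M, ContDiffOn ℝ ∞ (fun p : ℝ × E ↦ bilinInChart (g p.1).inner x₀ p.2)
    (S ×ˢ (extChartAt 𝓘(ℝ, E) x₀).target)
  smooth_form : ∀ x₀ : M, ContDiffOn ℝ ∞ (fun p : ℝ × E ↦ formInChart (b p.1) x₀ p.2)
    (S ×ˢ (extChartAt 𝓘(ℝ, E) x₀).target)
  metric_eq : ∀ t ∈ S, ∀ (x : M) (u v : TangentSpace 𝓘(ℝ, E) x),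
    HasDerivWithinAt (fun s ↦ (g s).inner x u v)
      (-2 * ricci (g t) x u v + 1 / 2 * formSq (g t) (H + extD (b t)) x u v) S t
  form_eq : ∀ t ∈ S, ∀ (x : M) (u v : TangentSpace 𝓘(ℝ, E) x),
    HasDerivWithinAt (fun s ↦ b s x ![u, v]) (-codiff (g t) (H + extD (b t)) x u v) S t

end GRF

/-! ## Quotients of Lie groups and invariance -/

namespace GRF

variable {E : Type*} [NormedAddCommGroup E] [NormedSpace ℝ E]
  {G : Type*} [Group G] [TopologicalSpace G] [ChartedSpace E G]
  {M : Type*} [TopologicalSpace M] [ChartedSpace E M]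

/-- The smooth manifold `M`, with the projection `π : G → M`, is the quotient of the Lie group `G`
by the action of the subgroup `Γ` by left translations (so that left-invariant tensors on `G`
descend to `M`). -/
structure IsQuotient (Γ : Subgroup G) (π : G → M) : Prop where
  isLocalDiffeomorph : IsLocalDiffeomorph 𝓘(ℝ, E) 𝓘(ℝ, E) ∞ π
  surjective : Function.Surjective π
  eq_iff : ∀ x y : G, π x = π y ↔ ∃ a ∈ Γ, a * x = y

/-- The form `θ` on `M` lifts along `π` to a left-invariant form on `G`. -/
def InvariantForm {k : ℕ} (π : G → M) (θ : FormField E M k) : Prop :=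
  ∀ a : G, pullForm (fun x : G ↦ a * x) (pullForm π θ) = pullForm π θ

/-- The metric `g` on `M` lifts along `π` to a left-invariant metric on `G`. -/
def InvariantMetric (π : G → M) (g : Metric E M) : Prop :=
  ∀ a : G, pullBilin (fun x : G ↦ a * x) (pullBilin π g.inner) = pullBilin π g.inner

/-- The family `(g_t, b_t)`, `t ∈ S`, of generalized metrics on `(TM ⊕ T*M)_H` is invariant.  The
generalized metric at time `0` identifies the algebroid with `(TM ⊕ T*M)_{H₀}`, `H₀ = H + db₀`, and
the family with `(g_t, b_t - b₀)`; the lifts to `G` of `H₀`, `g_t` and `b_t - b₀` have to be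
left-invariant.  This includes all the families with left-invariant lifts of `H`, `g_t`, `b_t`. -/
structure IsInvariant (π : G → M) (H : FormField E M 3) (S : Set ℝ) (g : ℝ → Metric E M)
    (b : ℝ → FormField E M 2) : Prop where
  torsion : InvariantForm π (H + extD (b 0))
  metric : ∀ t ∈ S, InvariantMetric π (g t)
  form : ∀ t ∈ S, InvariantForm π (b t - b 0)

end GRF

end

/-! An invariant metric, 2-form and torsion are determined by their values on the Lie algebra, so
the flow is an ordinary differential equation there, and it is enough to keep its solutions bounded
on bounded time intervals. Write P = Ric − ¼H² for the torsion H + db, so that ∂g/∂t = −2P. As in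
Uhlenbeck's trick the frame moves instead of the metric: if eᵢ' = Σⱼ Pᵢⱼ eⱼ, the frame stays
orthonormal, and the geometry sits in its structure constants c and in the components h of the
torsion.

The bounds come from the generalized scalar curvature `scal`, which is R − |H|²/12. First, `scal` ≤
0 on a solvable algebra, since in an orthonormal basis adapted to the derived series the negative
Killing contribution is absorbed by |c|² (`structureForm_nonneg`, `State.IsDual.scal_nonpos`).
Second, along the flow the derivative of `scal` is at least |P|² + ¼|d*H|² (`scal_variation`).
Without the mean curvature vector Z this is a gradient computation. In general the terms with Z are
controlled by `IsLie.ad_ricStar` (derivations are orthogonal to the moment map),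
`IsLie.speedStar_tau` and `IsClosedForm.iotaZ_codiffStar` (Cartan's formula for the closed form h).
Hence the integral of |P|² + ¼|d*H|² over the whole lifetime is at most −scal(0).

Since |P| ≤ ½(1 + |P|²), Gronwall's inequality bounds the frame and its dual on [0,T], and then the
2-form as well (`sum_sq_le`, `abs_form_le`). These bounds survive a slowing down x' = θ(t)F(x) with
0 ≤ θ ≤ 1, in particular the multiplication of F by a cutoff function, so the solution of the
cut-off equation never sees the cutoff (`ODE.exists_global_solution`).

The passage to M uses the right action of G on M. In a chart, its infinitesimal generators form a
`MovingFrame` with constant structure constants, in which Koszul's formula evaluates the Ricci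
tensor and the codifferential. Solvability of the abstract group gives a flag of ideals: the
velocities at 1 of curves inside the derived subgroups (`lieBr_mem_velocities`). Finally, the
components of any invariant solution solve an equation with a C¹ right-hand side, so a given
solution agrees with the global one having the same initial value (`solution_unique`). -/

noncomputable section

/-! ## Structure constants in an orthonormal frame -/

namespace GRF.Frame

variable {ι : Type*} [Fintype ι]

/-- The mean curvature covector `tr (ad eᵢ)`. -/
def tau (c : ι → ι → ι → ℝ) (i : ι) : ℝ := ∑ j, c i j j

/-- The part of the Ricci tensor that does not involve the mean curvature vector. -/
def ricStar (c : ι → ι → ι → ℝ) (i j : ι) : ℝ :=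
  -(1 / 2) * (∑ k, ∑ l, c i k l * c j k l) + 1 / 4 * (∑ k, ∑ l, c k l i * c k l j)
    - 1 / 2 * (∑ k, ∑ l, c i k l * c j l k)

/-- The symmetric part of `ad Z`, where `Z` is the mean curvature vector. -/
def symAd (c : ι → ι → ι → ℝ) (i j : ι) : ℝ :=
  1 / 2 * ∑ k, tau c k * (c k i j + c k j i)

/-- The square of a `3`-form. -/
def hSq (h : ι → ι → ι → ℝ) (i j : ι) : ℝ := ∑ k, ∑ l, h i k l * h j k l

/-- `Ric - ¼ h²` without the terms of the mean curvature vector. -/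
def speedStar (c h : ι → ι → ι → ℝ) (i j : ι) : ℝ := ricStar c i j - 1 / 4 * hSq h i j

/-- `Ric - ¼ h²`. -/
def speed (c h : ι → ι → ι → ℝ) (i j : ι) : ℝ := speedStar c h i j - symAd c i j

/-- The contraction of a `3`-form with the mean curvature vector. -/
def iotaZ (c h : ι → ι → ι → ℝ) (i j : ι) : ℝ := ∑ l, tau c l * h l i j

/-- The codifferential of a `3`-form without the terms of the mean curvature vector. -/
def codiffStar (c h : ι → ι → ι → ℝ) (i j : ι) : ℝ :=
  -(1 / 2) * ∑ k, ∑ l, (c k l i * h k l j - c k l j * h k l i)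

/-- The codifferential of a `3`-form. -/
def codiff (c h : ι → ι → ι → ℝ) (i j : ι) : ℝ := codiffStar c h i j + iotaZ c h i j

/-- The differential of a `2`-form. -/
def dTwo (c : ι → ι → ι → ℝ) (D : ι → ι → ℝ) (i j k : ι) : ℝ :=
  ∑ l, (-(c i j l * D l k) + c i k l * D l j - c j k l * D l i)

/-- The generalized scalar curvature. -/
def scal (c h : ι → ι → ι → ℝ) : ℝ :=
  -(1 / 4) * (∑ i, ∑ j, ∑ k, c i j k ^ 2) - 1 / 2 * (∑ i, ∑ j, ∑ k, c i j k * c i k j)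
    - (∑ i, tau c i ^ 2) - 1 / 12 * (∑ i, ∑ j, ∑ k, h i j k ^ 2)

/-- The variation of structure constants under the variation `Q` of the frame. -/
def actC (Q : ι → ι → ℝ) (c : ι → ι → ι → ℝ) (i j k : ι) : ℝ :=
  (∑ l, Q i l * c l j k) + (∑ l, Q j l * c i l k) - ∑ l, Q k l * c i j l

/-- The variation of a `3`-form under the variation `Q` of the frame. -/
def actH (Q : ι → ι → ℝ) (h : ι → ι → ι → ℝ) (i j k : ι) : ℝ :=
  (∑ l, Q i l * h l j k) + (∑ l, Q j l * h i l k) + ∑ l, Q k l * h i j l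

/-- Structure constants of a Lie algebra. -/
structure IsLie (c : ι → ι → ι → ℝ) : Prop where
  anti : ∀ i j k, c i j k = -c j i k
  jacobi : ∀ i j k l, ∑ m, (c i j m * c m k l + c j k m * c m i l + c k i m * c m j l) = 0

/-- Components of a closed `3`-form. -/
structure IsClosedForm (c h : ι → ι → ι → ℝ) : Prop where
  anti₁ : ∀ i j k, h i j k = -h j i k
  anti₂ : ∀ i j k, h i j k = -h i k j
  closed : ∀ i j k l, ∑ m, (c i j m * h m k l - c i k m * h m j l + c i l m * h m j k
    + c j k m * h m i l - c j l m * h m i k + c k l m * h m i j) = 0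

section
variable {c h : ι → ι → ι → ℝ} {Q : ι → ι → ℝ}

lemma sum_perm_213 {α β : Type*} [Fintype α] [Fintype β] (f : α → α → β → ℝ) :
    ∑ i, ∑ j, ∑ k, f i j k = ∑ i, ∑ j, ∑ k, f j i k := Finset.sum_comm

lemma sum_perm_132 {α β : Type*} [Fintype α] [Fintype β] (f : β → α → α → ℝ) :
    ∑ i, ∑ j, ∑ k, f i j k = ∑ i, ∑ j, ∑ k, f i k j :=
  Finset.sum_congr rfl fun _ _ ↦ Finset.sum_comm

/-- Quadruple sums. -/
def S4 (f : ι → ι → ι → ι → ℝ) : ℝ := ∑ i, ∑ j, ∑ k, ∑ l, f i j k l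

lemma S4_swap12 (f : ι → ι → ι → ι → ℝ) : S4 f = S4 fun i j k l ↦ f j i k l := Finset.sum_comm

lemma S4_swap23 (f : ι → ι → ι → ι → ℝ) : S4 f = S4 fun i j k l ↦ f i k j l :=
  Finset.sum_congr rfl fun _ _ ↦ Finset.sum_comm

lemma S4_swap34 (f : ι → ι → ι → ι → ℝ) : S4 f = S4 fun i j k l ↦ f i j l k :=
  Finset.sum_congr rfl fun _ _ ↦ Finset.sum_congr rfl fun _ _ ↦ Finset.sum_comm

lemma S4_swap13 (f : ι → ι → ι → ι → ℝ) : S4 f = S4 fun i j k l ↦ f k j i l := by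
  rw [S4_swap12, S4_swap23, S4_swap12]

lemma S4_swap24 (f : ι → ι → ι → ι → ℝ) : S4 f = S4 fun i j k l ↦ f i l k j := by
  rw [S4_swap23, S4_swap34, S4_swap23]

lemma S4_congr {f g : ι → ι → ι → ι → ℝ} (H : ∀ i j k l, f i j k l = g i j k l) : S4 f = S4 g := by
  simp only [S4, H]

lemma S4_add (f g : ι → ι → ι → ι → ℝ) :
    S4 (fun i j k l ↦ f i j k l + g i j k l) = S4 f + S4 g := by
  simp only [S4, Finset.sum_add_distrib]

lemma S4_sub (f g : ι → ι → ι → ι → ℝ) :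
    S4 (fun i j k l ↦ f i j k l - g i j k l) = S4 f - S4 g := by
  simp only [S4, Finset.sum_sub_distrib]

lemma S4_neg (f : ι → ι → ι → ι → ℝ) : S4 (fun i j k l ↦ -f i j k l) = -S4 f := by
  simp only [S4, Finset.sum_neg_distrib]

lemma S4_smul (a : ℝ) (f : ι → ι → ι → ι → ℝ) :
    S4 (fun i j k l ↦ a * f i j k l) = a * S4 f := by
  simp only [S4, Finset.mul_sum]

lemma ricStar_symm (i j : ι) : ricStar c i j = ricStar c j i := by
  have h1 : ∑ k, ∑ l, c i k l * c j l k = ∑ k, ∑ l, c j k l * c i l k := by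
    rw [Finset.sum_comm]; simp only [mul_comm]
  simp only [ricStar, h1]
  simp only [mul_comm (c i _ _) (c j _ _), mul_comm (c _ _ i) (c _ _ j)]

lemma symAd_symm (i j : ι) : symAd c i j = symAd c j i := by
  simp only [symAd, add_comm (c _ i j)]

lemma speed_symm (i j : ι) : speed c h i j = speed c h j i := by
  have : hSq h i j = hSq h j i := by simp only [hSq, mul_comm]
  simp only [speed, speedStar, ricStar_symm i j, symAd_symm i j, this]

lemma pairing_ricStar : ∑ i, ∑ j, Q i j * ricStar c i j =
    S4 (fun i j k l ↦ Q i j * (-(1 / 2) * (c i k l * c j k l) + 1 / 4 * (c k l i * c k l j)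
      - 1 / 2 * (c i k l * c j l k))) := by
  simp only [S4, ricStar, Finset.mul_sum, ← Finset.sum_add_distrib, ← Finset.sum_sub_distrib]

lemma pairing_hSq : ∑ i, ∑ j, Q i j * hSq h i j = S4 (fun i j k l ↦ Q i j * (h i k l * h j k l)) := by
  simp only [S4, hSq, Finset.mul_sum]

/-- `ricStar` is a moment map: half the gradient of −¼|c|² − ½ tr(Killing form) under changes of
frame. After renaming indices the norm term gives the first two contractions of `ricStar`. In the
Killing term two of the three slots cancel, as the trace of (ad eᵢ)² does not see a conjugation. -/
lemma variation_star (hc : ∀ i j k, c i j k = -c j i k) (hQ : ∀ i j, Q i j = Q j i) :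
    -(1 / 4) * (∑ i, ∑ j, ∑ k, 2 * c i j k * actC Q c i j k)
      - 1 / 2 * (∑ i, ∑ j, ∑ k, (actC Q c i j k * c i k j + c i j k * actC Q c i k j))
      = 2 * ∑ i, ∑ j, Q i j * ricStar c i j := by
  have e1 : ∑ i, ∑ j, ∑ k, 2 * c i j k * actC Q c i j k =
      S4 (fun i j k l ↦ 2 * (Q i l * (c i j k * c l j k)) + 2 * (Q j l * (c i j k * c i l k))
        - 2 * (Q k l * (c i j k * c i j l))) := by
    simp only [S4, actC, ← Finset.sum_add_distrib, ← Finset.sum_sub_distrib, Finset.mul_sum]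
    refine Finset.sum_congr rfl fun i _ ↦ Finset.sum_congr rfl fun j _ ↦
      Finset.sum_congr rfl fun k _ ↦ Finset.sum_congr rfl fun l _ ↦ by ring
  have e2 : ∑ i, ∑ j, ∑ k, (actC Q c i j k * c i k j + c i j k * actC Q c i k j) =
      2 * ∑ i, ∑ j, ∑ k, actC Q c i j k * c i k j := by
    simp only [Finset.sum_add_distrib]
    have : ∑ i, ∑ j, ∑ k, c i j k * actC Q c i k j = ∑ i, ∑ j, ∑ k, actC Q c i j k * c i k j := by
      rw [sum_perm_132]; simp only [mul_comm]
    rw [this]; ring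
  have e3 : ∑ i, ∑ j, ∑ k, actC Q c i j k * c i k j =
      S4 (fun i j k l ↦ Q i l * (c l j k * c i k j) + Q j l * (c i l k * c i k j)
        - Q k l * (c i j l * c i k j)) := by
    simp only [S4, actC, ← Finset.sum_add_distrib, ← Finset.sum_sub_distrib, Finset.sum_mul]
    refine Finset.sum_congr rfl fun i _ ↦ Finset.sum_congr rfl fun j _ ↦
      Finset.sum_congr rfl fun k _ ↦ Finset.sum_congr rfl fun l _ ↦ by ring
  rw [e2, e3, e1, pairing_ricStar]
  simp only [mul_add, mul_sub, S4_add, S4_sub, S4_smul, mul_left_comm (Q _ _) (-(1 / 2 : ℝ)),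
    mul_left_comm (Q _ _) (1 / 4 : ℝ), mul_left_comm (Q _ _) (1 / 2 : ℝ)]
  have a1 : S4 (fun i j k l ↦ Q i l * (c i j k * c l j k)) =
      S4 (fun i j k l ↦ Q i j * (c i k l * c j k l)) := by
    rw [S4_swap24, S4_swap34]
  have a2 : S4 (fun i j k l ↦ Q j l * (c i j k * c i l k)) =
      S4 (fun i j k l ↦ Q i j * (c i k l * c j k l)) := by
    rw [S4_swap12, S4_swap24, S4_swap34]
    exact S4_congr fun i j k l ↦ by rw [hc k i, hc k j]; ring
  have a3 : S4 (fun i j k l ↦ Q k l * (c i j k * c i j l)) =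
      S4 (fun i j k l ↦ Q i j * (c k l i * c k l j)) := by
    rw [S4_swap13, S4_swap24]
  have b1 : S4 (fun i j k l ↦ Q i l * (c l j k * c i k j)) =
      S4 (fun i j k l ↦ Q i j * (c i k l * c j l k)) := by
    rw [S4_swap24]
    exact S4_congr fun i j k l ↦ by ring
  have b2 : S4 (fun i j k l ↦ Q j l * (c i l k * c i k j)) =
      S4 (fun i j k l ↦ Q k l * (c i j l * c i k j)) := by
    rw [S4_swap23, S4_swap34]
    exact S4_congr fun i j k l ↦ by rw [hQ]; ring
  rw [a1, a2, a3, b1, b2]; ring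

/-- A trace is invariant under conjugation, so only the change of the argument eᵢ of tr ad eᵢ
survives. -/
lemma variation_tau (hQ : ∀ i j, Q i j = Q j i) (i : ι) :
    ∑ j, actC Q c i j j = ∑ l, Q i l * tau c l := by
  simp only [actC, Finset.sum_add_distrib, Finset.sum_sub_distrib, tau, Finset.mul_sum]
  have h1 : ∑ j, ∑ l, Q i l * c l j j = ∑ l, ∑ j, Q i l * c l j j := Finset.sum_comm
  have h2 : ∑ j, ∑ l, Q j l * c i l j = ∑ j, ∑ l, Q j l * c i j l := by
    rw [Finset.sum_comm]
    exact Finset.sum_congr rfl fun j _ ↦ Finset.sum_congr rfl fun l _ ↦ by rw [hQ]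
  rw [h1, h2]; ring

/-- By antisymmetry the three slots contribute equally. -/
lemma variation_form (h₁ : ∀ i j k, h i j k = -h j i k) (h₂ : ∀ i j k, h i j k = -h i k j) :
    ∑ i, ∑ j, ∑ k, h i j k * actH Q h i j k = 3 * ∑ i, ∑ j, Q i j * hSq h i j := by
  have e1 : ∑ i, ∑ j, ∑ k, h i j k * actH Q h i j k =
      S4 (fun i j k l ↦ Q i l * (h i j k * h l j k) + Q j l * (h i j k * h i l k)
        + Q k l * (h i j k * h i j l)) := by
    simp only [S4, actH, ← Finset.sum_add_distrib, Finset.mul_sum]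
    refine Finset.sum_congr rfl fun i _ ↦ Finset.sum_congr rfl fun j _ ↦
      Finset.sum_congr rfl fun k _ ↦ Finset.sum_congr rfl fun l _ ↦ by ring
  have a1 : S4 (fun i j k l ↦ Q i l * (h i j k * h l j k)) =
      S4 (fun i j k l ↦ Q i j * (h i k l * h j k l)) := by
    rw [S4_swap24, S4_swap34]
  have a2 : S4 (fun i j k l ↦ Q j l * (h i j k * h i l k)) =
      S4 (fun i j k l ↦ Q i j * (h i k l * h j k l)) := by
    rw [S4_swap12, S4_swap24, S4_swap34]
    exact S4_congr fun i j k l ↦ by rw [h₁ k i, h₁ k j]; ring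
  have a3 : S4 (fun i j k l ↦ Q k l * (h i j k * h i j l)) =
      S4 (fun i j k l ↦ Q i j * (h i k l * h j k l)) := by
    rw [S4_swap13, S4_swap24]
    exact S4_congr fun i j k l ↦ by
      rw [h₂ k l i, h₂ k l j, h₁ k i l, h₁ k j l]; ring
  rw [e1, pairing_hSq, S4_add, S4_add, a1, a2, a3]; ring

/-- This is the adjointness of `codiffStar` and d on the Lie algebra. The factor 3 = 3!/2! appears
because the sums run over all index tuples instead of increasing ones. -/
lemma pairing_dTwo (h₁ : ∀ i j k, h i j k = -h j i k) (h₂ : ∀ i j k, h i j k = -h i k j)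
    {D : ι → ι → ℝ} (hD : ∀ i j, D i j = -D j i) :
    ∑ i, ∑ j, ∑ k, h i j k * dTwo c D i j k = 3 * ∑ i, ∑ j, D i j * codiffStar c h i j := by
  have e1 : ∑ i, ∑ j, ∑ k, h i j k * dTwo c D i j k =
      S4 (fun i j k l ↦ -(h i j k * c i j l * D l k) + h i j k * c i k l * D l j
        - h i j k * c j k l * D l i) := by
    simp only [S4, dTwo, Finset.mul_sum]
    refine Finset.sum_congr rfl fun i _ ↦ Finset.sum_congr rfl fun j _ ↦
      Finset.sum_congr rfl fun k _ ↦ Finset.sum_congr rfl fun l _ ↦ by ring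
  have e2 : ∑ i, ∑ j, D i j * codiffStar c h i j =
      S4 (fun i j k l ↦ (1 / 2) * (D i j * c k l j * h k l i)
        - (1 / 2) * (D i j * c k l i * h k l j)) := by
    simp only [S4, codiffStar, Finset.mul_sum]
    refine Finset.sum_congr rfl fun i _ ↦ Finset.sum_congr rfl fun j _ ↦
      Finset.sum_congr rfl fun k _ ↦ Finset.sum_congr rfl fun l _ ↦ by ring
  have a2 : S4 (fun i j k l ↦ h i j k * c i k l * D l j) =
      -S4 (fun i j k l ↦ h i j k * c i j l * D l k) := by
    rw [S4_swap23, ← S4_neg]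
    exact S4_congr fun i j k l ↦ by rw [h₂ i j k]; ring
  have a3 : S4 (fun i j k l ↦ h i j k * c j k l * D l i) =
      S4 (fun i j k l ↦ h i j k * c i j l * D l k) := by
    rw [S4_swap13, S4_swap12]
    exact S4_congr fun i j k l ↦ by rw [h₂ k i j, h₁ k j i, h₂ j k i, h₁ j i k]; ring
  have b1 : S4 (fun i j k l ↦ D i j * c k l j * h k l i) =
      -S4 (fun i j k l ↦ h i j k * c i j l * D l k) := by
    rw [S4_swap13, S4_swap24, ← S4_neg]
    exact S4_congr fun i j k l ↦ by rw [hD k l]; ring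
  have b2 : S4 (fun i j k l ↦ D i j * c k l i * h k l j) =
      S4 (fun i j k l ↦ h i j k * c i j l * D l k) := by
    rw [S4_swap12, S4_swap13, S4_swap24]
    exact S4_congr fun i j k l ↦ by ring
  rw [e1, e2]
  simp only [S4_add, S4_sub, S4_smul, S4_neg]
  rw [a2, a3, b1, b2]; ring

/-- A symmetric tensor pairs with ad Z only through its symmetric part, so pairings with S(ad Z)
reduce to pairings with each ad eₘ. -/
lemma pairing_symAd {R : ι → ι → ℝ} (hR : ∀ i j, R i j = R j i) :
    ∑ i, ∑ j, symAd c i j * R i j = ∑ m, tau c m * ∑ i, ∑ j, c m i j * R i j := by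
  have h1 : ∑ i, ∑ j, symAd c i j * R i j = 1 / 2 * (∑ i, ∑ j, ∑ m, tau c m * (c m i j * R i j))
      + 1 / 2 * (∑ i, ∑ j, ∑ m, tau c m * (c m j i * R i j)) := by
    simp only [symAd, Finset.mul_sum, Finset.sum_mul, ← Finset.sum_add_distrib]
    refine Finset.sum_congr rfl fun i _ ↦ Finset.sum_congr rfl fun j _ ↦
      Finset.sum_congr rfl fun k _ ↦ by ring
  have h2 : ∑ i, ∑ j, ∑ m, tau c m * (c m j i * R i j) =
      ∑ i, ∑ j, ∑ m, tau c m * (c m i j * R i j) := by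
    rw [sum_perm_213]
    refine Finset.sum_congr rfl fun i _ ↦ Finset.sum_congr rfl fun j _ ↦
      Finset.sum_congr rfl fun k _ ↦ by rw [hR]
  have h3 : ∑ i, ∑ j, ∑ m, tau c m * (c m i j * R i j) =
      ∑ m, tau c m * ∑ i, ∑ j, c m i j * R i j := by
    rw [sum_perm_132, sum_perm_213]
    simp only [Finset.mul_sum]
  rw [h1, h2, h3]; ring

/-- The Jacobi identity in the form ad [x,y] = [ad x, ad y]. -/
lemma IsLie.jacobi' (hc : IsLie c) (i j k l : ι) :
    ∑ m, c i j m * c m k l = ∑ m, (c j k m * c i m l - c i k m * c j m l) := by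
  rw [← sub_eq_zero, ← Finset.sum_sub_distrib, ← hc.jacobi i j k l]
  refine Finset.sum_congr rfl fun m _ ↦ ?_
  rw [hc.anti k i m, hc.anti m i l, hc.anti m j l]; ring

/-- The derivation ad eₘ leaves the bracket unchanged, and `ricStar` is the gradient of a function
of the bracket. Concretely, Jacobi turns ⟨[eₘ,[x,y]],[x,y]⟩ into twice ⟨[[eₘ,x],y],[x,y]⟩, which
cancels the two norm contractions, and the Killing contraction is a sum of traces tr(A[B,A]) = 0. -/
lemma IsLie.ad_ricStar (hc : IsLie c) (m : ι) : ∑ i, ∑ j, c m i j * ricStar c i j = 0 := by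
  rw [pairing_ricStar]
  simp only [mul_add, mul_sub, S4_add, S4_sub, S4_smul, mul_left_comm (c m _ _) (-(1 / 2 : ℝ)),
    mul_left_comm (c m _ _) (1 / 4 : ℝ), mul_left_comm (c m _ _) (1 / 2 : ℝ)]
  have h1 : S4 (fun i j k l ↦ c m i j * (c k l i * c k l j)) =
      2 * S4 (fun i j k l ↦ c m i j * (c i k l * c j k l)) := by
    have e1 : S4 (fun i j k l ↦ c m i j * (c k l i * c k l j)) =
        S4 (fun k l j i ↦ c k l j * (c m k i * c i l j + c m l i * c k i j)) := by
      rw [S4_swap13, S4_swap24, S4_swap34]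
      refine Finset.sum_congr rfl fun k _ ↦ Finset.sum_congr rfl fun l _ ↦
        Finset.sum_congr rfl fun j _ ↦ ?_
      have := hc.jacobi k l m j
      simp only [Finset.sum_add_distrib] at this
      simp only [mul_add, Finset.sum_add_distrib]
      have r1 : ∑ i, c m i j * (c k l i * c k l j) = -(c k l j * ∑ i, c k l i * c i m j) := by
        rw [Finset.mul_sum, ← Finset.sum_neg_distrib]
        exact Finset.sum_congr rfl fun i _ ↦ by rw [hc.anti m i j]; ring
      have r2 : ∑ i, c k l j * (c m k i * c i l j) = c k l j * ∑ i, c m k i * c i l j := by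
        rw [Finset.mul_sum]
      have r3 : ∑ i, c k l j * (c m l i * c k i j) = c k l j * ∑ i, c l m i * c i k j := by
        rw [Finset.mul_sum]
        exact Finset.sum_congr rfl fun i _ ↦ by rw [hc.anti m l, hc.anti k i]; ring
      rw [r1, r2, r3]
      linear_combination (-c k l j) * this
    have e2 : S4 (fun k l j i ↦ c k l j * (c m k i * c i l j)) =
        S4 (fun i j k l ↦ c m i j * (c i k l * c j k l)) := by
      rw [S4_swap24, S4_swap34]
      exact S4_congr fun i j k l ↦ by ring
    have e3 : S4 (fun k l j i ↦ c k l j * (c m l i * c k i j)) =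
        S4 (fun k l j i ↦ c k l j * (c m k i * c i l j)) := by
      rw [S4_swap12]
      exact S4_congr fun i j k l ↦ by rw [hc.anti j i, hc.anti j l]; ring
    rw [e1]
    simp only [mul_add, S4_add]
    rw [e3, e2]; ring
  have h2 : S4 (fun i j k l ↦ c m i j * (c i k l * c j l k)) = 0 := by
    have e1 : S4 (fun i j k l ↦ c m i j * (c i k l * c j l k)) =
        S4 (fun i k l p ↦ c i k l * (c i l p * c m p k) - c i k l * (c m l p * c i p k)) := by
      rw [S4_swap23, S4_swap34]
      refine Finset.sum_congr rfl fun i _ ↦ Finset.sum_congr rfl fun k _ ↦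
        Finset.sum_congr rfl fun l _ ↦ ?_
      have := hc.jacobi' m i l k
      simp only [← mul_sub, ← Finset.mul_sum]
      rw [← this, Finset.mul_sum]
      exact Finset.sum_congr rfl fun _ _ ↦ by ring
    rw [e1, S4_sub, sub_eq_zero, S4_swap23, S4_swap34]
    exact S4_congr fun i j k l ↦ by ring
  rw [h1, h2]; ring

/-- The trace of the commutator ad [x,y] = [ad x, ad y] vanishes. -/
lemma IsLie.tau_bracket (hc : IsLie c) (k l : ι) : ∑ i, c k l i * tau c i = 0 := by
  have : ∑ i, c k l i * tau c i = ∑ j, ∑ i, c k l i * c i j j := by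
    simp only [tau, Finset.mul_sum]; exact Finset.sum_comm
  rw [this, Finset.sum_congr rfl fun j _ ↦ hc.jacobi' k l j j]
  simp only [Finset.sum_sub_distrib]
  rw [sub_eq_zero, Finset.sum_comm]
  exact Finset.sum_congr rfl fun j _ ↦ Finset.sum_congr rfl fun l _ ↦ by ring

/-- Up to notation this is ⟨[Z,Z],Z⟩ = 0. -/
lemma IsLie.symAd_tau (hc : IsLie c) : ∑ i, ∑ j, tau c i * tau c j * symAd c i j = 0 := by
  have h1 : ∀ k i, ∑ j, tau c j * c k i j = 0 := fun k i ↦ by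
    simpa only [mul_comm] using hc.tau_bracket k i
  have h2 : ∀ i, ∑ j, tau c j * symAd c i j = 1 / 2 * ∑ k, tau c k * ∑ j, tau c j * c k j i := by
    intro i
    have : ∑ j, tau c j * symAd c i j = 1 / 2 * ∑ k, tau c k *
        (∑ j, tau c j * c k i j + ∑ j, tau c j * c k j i) := by
      simp only [symAd, ← Finset.sum_add_distrib, Finset.mul_sum]
      rw [Finset.sum_comm]
      exact Finset.sum_congr rfl fun j _ ↦ Finset.sum_congr rfl fun l _ ↦ by ring
    rw [this]; simp only [h1, zero_add]
  have h3 : ∀ i, ∑ k, tau c k * ∑ j, tau c j * c k j i = 0 := by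
    intro i
    simp only [Finset.mul_sum]
    have : ∑ k, ∑ j, tau c k * (tau c j * c k j i) = -∑ k, ∑ j, tau c k * (tau c j * c k j i) := by
      conv_lhs => rw [Finset.sum_comm]
      simp only [← Finset.sum_neg_distrib]
      exact Finset.sum_congr rfl fun j _ ↦ Finset.sum_congr rfl fun l _ ↦ by
        rw [hc.anti l j]; ring
    linarith
  have h4 : ∑ i, ∑ j, tau c i * tau c j * symAd c i j =
      ∑ i, tau c i * ∑ j, tau c j * symAd c i j := by
    simp only [Finset.mul_sum, mul_assoc]
  rw [h4]; simp only [h2, h3, mul_zero, Finset.sum_const_zero]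

/-- With A = ad Z and S its symmetric part, |S|² = ½|A|² + ½ tr A². These are the first and third
contractions of `ricStar` at (Z,Z). The middle one vanishes because `tau` is zero on brackets. -/
lemma IsLie.speedStar_tau (hc : IsLie c) : ∑ i, ∑ j, tau c i * tau c j * speedStar c h i j =
    -(∑ i, ∑ j, symAd c i j ^ 2) - 1 / 4 * ∑ i, ∑ j, iotaZ c h i j ^ 2 := by
  let a : ι → ι → ℝ := fun i j ↦ ∑ k, tau c k * c k i j
  have e1 : ∑ i, ∑ j, tau c i * tau c j * speedStar c h i j =
      -(1 / 2) * (∑ k, ∑ l, a k l ^ 2) + 1 / 4 * (∑ k, ∑ l, (∑ i, c k l i * tau c i) ^ 2)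
      - 1 / 2 * (∑ k, ∑ l, a k l * a l k) - 1 / 4 * ∑ i, ∑ j, iotaZ c h i j ^ 2 := by
    have l1 : ∑ k, ∑ l, a k l ^ 2 = S4 (fun i j k l ↦ tau c i * c i k l * (tau c j * c j k l)) := by
      rw [S4_swap13, S4_swap24]
      simp only [a, sq, Finset.sum_mul_sum, S4]
    have l2 : ∑ k, ∑ l, a k l * a l k =
        S4 (fun i j k l ↦ tau c i * c i k l * (tau c j * c j l k)) := by
      rw [S4_swap13, S4_swap24]
      simp only [a, Finset.sum_mul_sum, S4]
    have l3 : ∑ k, ∑ l, (∑ i, c k l i * tau c i) ^ 2 =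
        S4 (fun i j k l ↦ c k l i * tau c i * (c k l j * tau c j)) := by
      rw [S4_swap13, S4_swap24]
      simp only [sq, Finset.sum_mul_sum, S4]
    have l4 : ∑ k, ∑ l, iotaZ c h k l ^ 2 =
        S4 (fun i j k l ↦ tau c i * h i k l * (tau c j * h j k l)) := by
      rw [S4_swap13, S4_swap24]
      simp only [iotaZ, sq, Finset.sum_mul_sum, S4]
    rw [l1, l2, l3, l4]
    simp only [← S4_smul, ← S4_sub, ← S4_add]
    simp only [S4, speedStar, ricStar, hSq, Finset.mul_sum, ← Finset.sum_add_distrib,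
      ← Finset.sum_sub_distrib]
    refine Finset.sum_congr rfl fun i _ ↦ Finset.sum_congr rfl fun j _ ↦
      Finset.sum_congr rfl fun k _ ↦ Finset.sum_congr rfl fun l _ ↦ by ring
  have e2 : ∑ i, ∑ j, symAd c i j ^ 2 =
      1 / 2 * (∑ k, ∑ l, a k l ^ 2) + 1 / 2 * (∑ k, ∑ l, a k l * a l k) := by
    have s : ∀ i j, symAd c i j = 1 / 2 * (a i j + a j i) := fun i j ↦ by
      simp only [symAd, a, mul_add, Finset.sum_add_distrib]
    have : ∑ i, ∑ j, a j i ^ 2 = ∑ i, ∑ j, a i j ^ 2 := Finset.sum_comm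
    have h2 : ∑ i, ∑ j, symAd c i j ^ 2 = 1 / 4 * (∑ k, ∑ l, a k l ^ 2)
      + 1 / 4 * (∑ k, ∑ l, a l k ^ 2) + 1 / 2 * (∑ k, ∑ l, a k l * a l k) := by
      simp only [s, Finset.mul_sum, ← Finset.sum_add_distrib]
      refine Finset.sum_congr rfl fun i _ ↦ Finset.sum_congr rfl fun j _ ↦ by ring
    rw [h2, this]; ring
  have e3 : ∑ k, ∑ l, (∑ i, c k l i * tau c i) ^ 2 = 0 := by
    simp [hc.tau_bracket]
  rw [e1, e2, e3]; ring

/-- By adjointness the left side is ⅓⟨h, d ι_Z h⟩. Since h is closed, d ι_Z h is the Lie derivative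
along Z, that is −`actH` of ad Z, and `variation_form` evaluates its pairing with h. -/
lemma IsClosedForm.iotaZ_codiffStar (hh : IsClosedForm c h) :
    ∑ i, ∑ j, iotaZ c h i j * codiffStar c h i j = -∑ i, ∑ j, symAd c i j * hSq h i j := by
  have hι : ∀ i j, iotaZ c h i j = -iotaZ c h j i := fun i j ↦ by
    simp only [iotaZ, ← Finset.sum_neg_distrib]
    exact Finset.sum_congr rfl fun l _ ↦ by rw [hh.anti₂ l i j]; ring
  have h1 := pairing_dTwo (c := c) hh.anti₁ hh.anti₂ hι
  -- Cartan's formula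
  have h2 : ∀ i j k, dTwo c (iotaZ c h) i j k =
      -∑ p, tau c p * actH (fun i l ↦ c p i l) h i j k := by
    intro i j k
    have e1 : dTwo c (iotaZ c h) i j k = ∑ p, tau c p *
        ∑ m, (-(c i j m * h p m k) + c i k m * h p m j - c j k m * h p m i) := by
      simp only [dTwo, iotaZ, Finset.mul_sum]
      rw [Finset.sum_comm]
      simp only [← Finset.sum_neg_distrib, ← Finset.sum_add_distrib, ← Finset.sum_sub_distrib]
      exact Finset.sum_congr rfl fun j _ ↦ Finset.sum_congr rfl fun l _ ↦ by ring
    rw [e1, ← Finset.sum_neg_distrib]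
    refine Finset.sum_congr rfl fun p _ ↦ ?_
    rw [← mul_neg]
    congr 1
    simp only [actH, ← Finset.sum_neg_distrib, ← Finset.sum_add_distrib]
    rw [← sub_eq_zero, ← Finset.sum_sub_distrib, ← hh.closed p i j k]
    refine Finset.sum_congr rfl fun m _ ↦ ?_
    rw [hh.anti₁ p m k, hh.anti₁ p m j, hh.anti₁ p m i, hh.anti₁ i m k, hh.anti₂ i j m,
      hh.anti₁ i m j]
    ring
  have h3 : ∑ i, ∑ j, ∑ k, h i j k * dTwo c (iotaZ c h) i j k =
      -∑ p, tau c p * ∑ i, ∑ j, ∑ k, h i j k * actH (fun i l ↦ c p i l) h i j k := by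
    simp only [h2, Finset.mul_sum, mul_neg, Finset.sum_neg_distrib]
    congr 1
    rw [show ∀ f : ι → ι → ι → ι → ℝ, ∑ i, ∑ j, ∑ k, ∑ p, f i j k p =
      ∑ p, ∑ i, ∑ j, ∑ k, f i j k p from fun f ↦ by
        change S4 f = _
        rw [S4_swap34, S4_swap23, S4_swap12]; rfl]
    refine Finset.sum_congr rfl fun i _ ↦ Finset.sum_congr rfl fun j _ ↦
      Finset.sum_congr rfl fun k _ ↦ Finset.sum_congr rfl fun l _ ↦ by ring
  have hs : ∀ i j, hSq h i j = hSq h j i := fun i j ↦ by simp only [hSq, mul_comm]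
  rw [h3] at h1
  simp only [variation_form hh.anti₁ hh.anti₂] at h1
  rw [pairing_symAd hs]
  have h4 : ∑ p, tau c p * (3 * ∑ i, ∑ j, c p i j * hSq h i j) =
      3 * ∑ p, tau c p * ∑ i, ∑ j, c p i j * hSq h i j := by
    rw [Finset.mul_sum]; exact Finset.sum_congr rfl fun p _ ↦ by ring
  rw [h4] at h1
  linarith

/-- The generalized scalar curvature is a Lyapunov function. -/
lemma IsClosedForm.codiff_anti (hh : IsClosedForm c h) (i j : ι) :
    codiff c h i j = -codiff c h j i := by
  have h1 : iotaZ c h i j = -iotaZ c h j i := by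
    simp only [iotaZ, ← Finset.sum_neg_distrib]
    exact Finset.sum_congr rfl fun l _ ↦ by rw [hh.anti₂ l i j]; ring
  have h2 : codiffStar c h i j = -codiffStar c h j i := by
    simp only [codiffStar, Finset.sum_sub_distrib]; ring
  simp only [codiff, h1, h2]; ring

/-- The generalized scalar curvature is a Lyapunov function. -/
theorem scal_variation (hc : IsLie c) (hh : IsClosedForm c h) :
    -(1 / 4) * (∑ i, ∑ j, ∑ k, 2 * c i j k * actC (speed c h) c i j k)
      - 1 / 2 * (∑ i, ∑ j, ∑ k, (actC (speed c h) c i j k * c i k j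
          + c i j k * actC (speed c h) c i k j))
      - (∑ i, 2 * tau c i * ∑ j, actC (speed c h) c i j j)
      - 1 / 12 * (∑ i, ∑ j, ∑ k, 2 * h i j k * (actH (speed c h) h i j k
          - dTwo c (codiff c h) i j k))
      ≥ (∑ i, ∑ j, speed c h i j ^ 2) + 1 / 4 * ∑ i, ∑ j, codiff c h i j ^ 2 := by
  have hcod := hh.codiff_anti
  have hs : ∀ i j, hSq h i j = hSq h j i := fun i j ↦ by simp only [hSq, mul_comm]
  rw [variation_star hc.anti speed_symm]
  simp only [variation_tau speed_symm]
  have f1 : ∑ i, ∑ j, ∑ k, 2 * h i j k * (actH (speed c h) h i j k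
      - dTwo c (codiff c h) i j k) = 6 * (∑ i, ∑ j, speed c h i j * hSq h i j)
      - 6 * ∑ i, ∑ j, codiff c h i j * codiffStar c h i j := by
    have := variation_form (Q := speed c h) hh.anti₁ hh.anti₂
    have := pairing_dTwo (c := c) hh.anti₁ hh.anti₂ hcod
    simp only [mul_sub, Finset.sum_sub_distrib, mul_assoc, ← Finset.mul_sum]
    linarith
  have f2 : ∑ i, 2 * tau c i * ∑ l, speed c h i l * tau c l =
      2 * ∑ i, ∑ j, tau c i * tau c j * speedStar c h i j := by
    have : ∑ i, 2 * tau c i * ∑ l, speed c h i l * tau c l =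
        2 * (∑ i, ∑ j, tau c i * tau c j * speedStar c h i j)
        - 2 * ∑ i, ∑ j, tau c i * tau c j * symAd c i j := by
      simp only [speed, Finset.mul_sum, ← Finset.sum_sub_distrib]
      exact Finset.sum_congr rfl fun p _ ↦ Finset.sum_congr rfl fun p _ ↦ by ring
    rw [this, hc.symAd_tau]; ring
  have f3 : ∑ i, ∑ j, symAd c i j * ricStar c i j = 0 := by
    rw [pairing_symAd ricStar_symm]; simp [hc.ad_ricStar]
  have f4 := hh.iotaZ_codiffStar
  have f5 := hc.speedStar_tau (h := h)
  rw [f1, f2, f5]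
  -- The mixed term ½⟨S, h²⟩ produced here, after doubling, is cancelled by the one that `f4` puts
  -- into `g2`. What remains is exactly 2|P*|² + 2|S|² + ½|δ*|² + ½|ι_Z h|², with P*, S, δ* standing
  -- for `speedStar`, `symAd`, `codiffStar`. The bounds `g3` and `g4` compare this with |P|² and
  -- |δ|².
  have g1 : ∑ i, ∑ j, speed c h i j * ricStar c i j
      - 1 / 4 * ∑ i, ∑ j, speed c h i j * hSq h i j =
      (∑ i, ∑ j, speedStar c h i j ^ 2) - (∑ i, ∑ j, symAd c i j * ricStar c i j)
        + 1 / 4 * ∑ i, ∑ j, symAd c i j * hSq h i j := by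
    simp only [speed, speedStar, Finset.mul_sum, ← Finset.sum_sub_distrib,
      ← Finset.sum_add_distrib]
    exact Finset.sum_congr rfl fun p _ ↦ Finset.sum_congr rfl fun p _ ↦ by ring
  have g2 : ∑ i, ∑ j, codiff c h i j * codiffStar c h i j = (∑ i, ∑ j, codiffStar c h i j ^ 2)
      + ∑ i, ∑ j, iotaZ c h i j * codiffStar c h i j := by
    simp only [codiff, ← Finset.sum_add_distrib]
    exact Finset.sum_congr rfl fun p _ ↦ Finset.sum_congr rfl fun p _ ↦ by ring
  have g3 : ∑ i, ∑ j, speed c h i j ^ 2 ≤ 2 * (∑ i, ∑ j, speedStar c h i j ^ 2)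
      + 2 * ∑ i, ∑ j, symAd c i j ^ 2 := by
    simp only [speed, Finset.mul_sum, ← Finset.sum_add_distrib]
    exact Finset.sum_le_sum fun p _ ↦ Finset.sum_le_sum fun q _ ↦ by
      nlinarith [sq_nonneg (speedStar c h p q + symAd c p q)]
  have g4 : ∑ i, ∑ j, codiff c h i j ^ 2 ≤ 2 * (∑ i, ∑ j, codiffStar c h i j ^ 2)
      + 2 * ∑ i, ∑ j, iotaZ c h i j ^ 2 := by
    simp only [codiff, Finset.mul_sum, ← Finset.sum_add_distrib]
    exact Finset.sum_le_sum fun p _ ↦ Finset.sum_le_sum fun q _ ↦ by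
      nlinarith [sq_nonneg (codiffStar c h p q - iotaZ c h p q)]
  linarith

end

end GRF.Frame

/-! ## The scalar curvature of a solvable Lie algebra -/

namespace GRF.Frame

section Solvable

open scoped RealInnerProductSpace

variable {W : Type*} [NormedAddCommGroup W] [InnerProductSpace ℝ W]
  {ι κ : Type*} [Fintype ι] [Fintype κ]

/-- The trace of a bilinear form does not depend on the orthonormal basis. This is what allows the
given frame to be exchanged for one adapted to the derived series. -/
lemma sum_diag_eq (e : OrthonormalBasis ι ℝ W) (f : OrthonormalBasis κ ℝ W)
    (B : W →ₗ[ℝ] W →ₗ[ℝ] ℝ) : ∑ i, B (e i) (e i) = ∑ a, B (f a) (f a) := by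
  have h1 : ∀ i, B (e i) (e i) = ∑ a, ⟪f a, e i⟫ * B (f a) (e i) := fun i ↦ by
    have := congrArg (fun u ↦ B u (e i)) (f.sum_repr' (e i)).symm
    simpa only [map_sum, LinearMap.sum_apply, map_smul, LinearMap.smul_apply, smul_eq_mul]
      using this
  have h2 : ∀ a, B (f a) (f a) = ∑ i, ⟪e i, f a⟫ * B (f a) (e i) := fun a ↦ by
    have := congrArg (fun u ↦ B (f a) u) (e.sum_repr' (f a)).symm
    simpa only [map_sum, map_smul, smul_eq_mul] using this
  simp only [h1, h2]
  rw [Finset.sum_comm]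
  simp only [real_inner_comm]

/-- The quadratic form in the structure constants whose negative is the scalar curvature, up to
the mean curvature. -/
def structureForm (μ : W →ₗ[ℝ] W →ₗ[ℝ] W) (e : ι → W) : ℝ :=
  1 / 4 * (∑ i, ∑ j, ∑ k, ⟪μ (e i) (e j), e k⟫ ^ 2)
    + 1 / 2 * ∑ i, ∑ j, ∑ k, ⟪μ (e i) (e j), e k⟫ * ⟪μ (e i) (e k), e j⟫

lemma structureForm_eq_trace (μ : W →ₗ[ℝ] W →ₗ[ℝ] W) (b : OrthonormalBasis ι ℝ W) :
    structureForm μ b = 1 / 4 * (∑ i, ∑ j, ⟪μ (b i) (b j), μ (b i) (b j)⟫)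
      + 1 / 2 * ∑ i, ∑ j, ⟪μ (b i) (μ (b i) (b j)), b j⟫ := by
  have sq_eq : ∑ i, ∑ j, ∑ k, ⟪μ (b i) (b j), b k⟫ ^ 2 =
      ∑ i, ∑ j, ⟪μ (b i) (b j), μ (b i) (b j)⟫ := by
    refine Finset.sum_congr rfl fun i _ ↦ Finset.sum_congr rfl fun j _ ↦ ?_
    conv_rhs => rw [← b.sum_inner_mul_inner]
    exact Finset.sum_congr rfl fun k _ ↦ by rw [sq, real_inner_comm (b k)]
  have tr_eq : ∑ i, ∑ j, ∑ k, ⟪μ (b i) (b j), b k⟫ * ⟪μ (b i) (b k), b j⟫ =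
      ∑ i, ∑ j, ⟪μ (b i) (μ (b i) (b j)), b j⟫ := by
    refine Finset.sum_congr rfl fun i _ ↦ Finset.sum_congr rfl fun j _ ↦ ?_
    conv_rhs => rw [← b.sum_repr' (μ (b i) (b j))]
    simp only [map_sum, map_smul, sum_inner, inner_smul_left]
    exact Finset.sum_congr rfl fun k _ ↦ by simp [real_inner_comm]
  rw [structureForm, sq_eq, tr_eq]

/-- Both terms are iterated traces, so the invariance of the trace is applied to one index at a
time. -/
lemma structureForm_eq (μ : W →ₗ[ℝ] W →ₗ[ℝ] W) (e : OrthonormalBasis ι ℝ W)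
    (f : OrthonormalBasis κ ℝ W) : structureForm μ e = structureForm μ f := by
  have h1 : ∑ i, ∑ j, ⟪μ (e i) (e j), μ (e i) (e j)⟫ =
      ∑ a, ∑ b, ⟪μ (f a) (f b), μ (f a) (f b)⟫ := by
    have : ∀ i, ∑ j, ⟪μ (e i) (e j), μ (e i) (e j)⟫ =
        ∑ b, ⟪μ (e i) (f b), μ (e i) (f b)⟫ := fun i ↦
      sum_diag_eq e f (LinearMap.mk₂ ℝ (fun u v ↦ ⟪μ (e i) u, μ (e i) v⟫)
        (by simp [inner_add_left]) (by simp [inner_smul_left])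
        (by simp [inner_add_right]) (by simp [inner_smul_right]))
    simp only [this]
    exact sum_diag_eq e f (LinearMap.mk₂ ℝ (fun u v ↦ ∑ b, ⟪μ u (f b), μ v (f b)⟫)
        (by simp [inner_add_left, Finset.sum_add_distrib])
        (by simp [inner_smul_left, Finset.mul_sum])
        (by simp [inner_add_right, Finset.sum_add_distrib])
        (by simp [inner_smul_right, Finset.mul_sum]))
  have h2 : ∑ i, ∑ j, ⟪μ (e i) (μ (e i) (e j)), e j⟫ =
      ∑ a, ∑ b, ⟪μ (f a) (μ (f a) (f b)), f b⟫ := by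
    have : ∀ i, ∑ j, ⟪μ (e i) (μ (e i) (e j)), e j⟫ =
        ∑ b, ⟪μ (e i) (μ (e i) (f b)), f b⟫ := fun i ↦
      sum_diag_eq e f (LinearMap.mk₂ ℝ (fun u v ↦ ⟪μ (e i) (μ (e i) u), v⟫)
        (by simp [inner_add_left]) (by simp [inner_smul_left])
        (by simp [inner_add_right]) (by simp [inner_smul_right]))
    simp only [this]
    exact sum_diag_eq e f (LinearMap.mk₂ ℝ (fun u v ↦ ∑ b, ⟪μ u (μ v (f b)), f b⟫)
        (by simp [inner_add_left, Finset.sum_add_distrib])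
        (by simp [inner_smul_left, Finset.mul_sum])
        (by simp [inner_add_left, Finset.sum_add_distrib])
        (by simp [inner_smul_left, Finset.mul_sum]))
  rw [structureForm_eq_trace, structureForm_eq_trace, h1, h2]

/-- An orthonormal basis that is adapted to a flag. -/
lemma exists_adapted_basis [FiniteDimensional ℝ W] (V : ℕ → Submodule ℝ W) (hV : Antitone V)
    (N : ℕ) (h0 : V 0 = ⊤) (hN : V N = ⊥) :
    ∃ (f : OrthonormalBasis (Fin (Module.finrank ℝ W)) ℝ W)
      (ℓ : Fin (Module.finrank ℝ W) → ℕ), ∀ i, f i ∈ V (ℓ i) ∧ f i ∈ (V (ℓ i + 1))ᗮ := by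
  classical
  -- The orthogonal complement of each step of the flag in the preceding one. These complements are
  -- pairwise orthogonal and their sum is W.
  let U : Fin N → Submodule ℝ W := fun k ↦ V k ⊓ (V (k + 1))ᗮ
  have hU : OrthogonalFamily ℝ (fun k ↦ U k) fun k ↦ (U k).subtypeₗᵢ := by
    have lt : ∀ j k : Fin N, j < k → ∀ v ∈ U j, ∀ w ∈ U k, ⟪w, v⟫ = 0 := fun j k h v hv w hw ↦
      Submodule.inner_right_of_mem_orthogonal (hV (Nat.succ_le_of_lt h) hw.1) hv.2
    intro j k hjk v w
    rcases lt_or_gt_of_ne hjk with h | h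
    · rw [real_inner_comm]; exact lt j k h _ v.2 _ w.2
    · exact lt k j h _ w.2 _ v.2
  have hint : DirectSum.IsInternal U := by
    rw [hU.isInternal_iff]
    -- Induction from the bottom of the flag, where V N = 0, upwards: each step is the next smaller
    -- one plus its complement.
    have hk : ∀ k ≤ N, V (N - k) ≤ ⨆ i, U i := by
      intro k
      induction k with
      | zero => intro _; simp [hN]
      | succ k ih =>
        intro hk
        have h1 : V (N - (k + 1) + 1) ≤ ⨆ i, U i := by
          have : N - (k + 1) + 1 = N - k := by omega
          rw [this]; exact ih (by omega)
        have h2 : U ⟨N - (k + 1), by omega⟩ ≤ ⨆ i, U i := le_iSup U _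
        have h3 := Submodule.sup_orthogonal_inf_of_hasOrthogonalProjection
          (hV (Nat.le_succ (N - (k + 1))))
        rw [← h3]
        refine sup_le h1 (le_trans (le_of_eq ?_) h2)
        exact inf_comm _ _
    have := hk N le_rfl
    rw [Nat.sub_self, h0, top_le_iff] at this
    rw [this, Submodule.top_orthogonal_eq_bot]
  refine ⟨hint.subordinateOrthonormalBasis rfl hU,
    fun i ↦ ((hint.subordinateOrthonormalBasisIndex rfl i hU : Fin N) : ℕ), fun i ↦ ?_⟩
  have := hint.subordinateOrthonormalBasis_subordinate rfl i hU
  exact ⟨this.1, this.2⟩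

/-- The level ℓ says where a basis vector sits in the flag. A product c i j k * c i k j can only be
nonzero when j and k have the same level and i a strictly smaller one; `d` is this part of c. By
antisymmetry in i and j every entry of `d` occurs twice in |c|², so the form is at least ½ Σ d² + ½
Σ d i j k * d i k j = ¼ Σ (d i j k + d i k j)². -/
lemma adapted_nonneg {c : ι → ι → ι → ℝ} (ℓ : ι → ℕ) (canti : ∀ i j k, c i j k = -c j i k)
    (c1 : ∀ i j k, ℓ k < ℓ j → c i j k = 0) (c2 : ∀ i j k, ℓ k < ℓ i → c i j k = 0)
    (c3 : ∀ i j k, ℓ i = ℓ j → ℓ k = ℓ i → c i j k = 0) :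
    0 ≤ 1 / 4 * (∑ i, ∑ j, ∑ k, c i j k ^ 2) + 1 / 2 * ∑ i, ∑ j, ∑ k, c i j k * c i k j := by
  let d : ι → ι → ι → ℝ :=
    fun i j k ↦ if ℓ i < ℓ j ∧ ℓ j = ℓ k then c i j k else 0
  have hprod : ∀ i j k, c i j k * c i k j = d i j k * d i k j := by
    intro i j k
    by_cases h : ℓ i < ℓ j ∧ ℓ j = ℓ k
    · have h' : ℓ i < ℓ k ∧ ℓ k = ℓ j := by omega
      simp only [d, if_pos h, if_pos h']
    · simp only [d, if_neg h, zero_mul]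
      rcases lt_trichotomy (ℓ k) (ℓ j) with h1 | h1 | h1
      · rw [c1 i j k h1, zero_mul]
      · rcases lt_trichotomy (ℓ i) (ℓ j) with h2 | h2 | h2
        · exact absurd ⟨h2, h1.symm⟩ h
        · rw [c3 i j k h2 (by omega), zero_mul]
        · rw [c2 i j k (by omega), zero_mul]
      · rw [c1 i k j h1, mul_zero]
  have hsq : ∀ i j k, d i j k ^ 2 + d j i k ^ 2 ≤ c i j k ^ 2 := by
    intro i j k
    by_cases h : ℓ i < ℓ j ∧ ℓ j = ℓ k
    · have h' : ¬(ℓ j < ℓ i ∧ ℓ i = ℓ k) := by omega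
      simp [d, if_pos h, if_neg h']
    · simp only [d, if_neg h]
      split_ifs
      · rw [canti i j k]; simp
      · simp; positivity
  have s1 : ∑ i, ∑ j, ∑ k, (d i j k ^ 2 + d j i k ^ 2) ≤ ∑ i, ∑ j, ∑ k, c i j k ^ 2 :=
    Finset.sum_le_sum fun i _ ↦ Finset.sum_le_sum fun j _ ↦ Finset.sum_le_sum fun k _ ↦ hsq i j k
  have s2 : ∑ i, ∑ j, ∑ k, d j i k ^ 2 = ∑ i, ∑ j, ∑ k, d i j k ^ 2 := Finset.sum_comm
  have s3 : ∑ i, ∑ j, ∑ k, d i k j ^ 2 = ∑ i, ∑ j, ∑ k, d i j k ^ 2 :=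
    Finset.sum_congr rfl fun _ _ ↦ Finset.sum_comm
  have s4 : 0 ≤ ∑ i, ∑ j, ∑ k, (d i j k + d i k j) ^ 2 := by positivity
  have s5 : ∑ i, ∑ j, ∑ k, (d i j k + d i k j) ^ 2 = (∑ i, ∑ j, ∑ k, d i j k ^ 2)
      + (∑ i, ∑ j, ∑ k, d i k j ^ 2) + 2 * ∑ i, ∑ j, ∑ k, d i j k * d i k j := by
    simp only [Finset.mul_sum, ← Finset.sum_add_distrib]
    refine Finset.sum_congr rfl fun i _ ↦ Finset.sum_congr rfl fun j _ ↦
      Finset.sum_congr rfl fun k _ ↦ by ring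
  have s6 : ∑ i, ∑ j, ∑ k, c i j k * c i k j = ∑ i, ∑ j, ∑ k, d i j k * d i k j := by
    simp only [hprod]
  simp only [Finset.sum_add_distrib] at s1
  rw [s6]
  linarith

/-- In the adapted basis, ideals make ad eᵢ block triangular, and the inclusion of brackets of Vₖ in
Vₖ₊₁ kills the constants whose three indices have equal level. -/
theorem structureForm_nonneg [FiniteDimensional ℝ W] (μ : W →ₗ[ℝ] W →ₗ[ℝ] W)
    (hμ : ∀ u v, μ u v = -μ v u) (V : ℕ → Submodule ℝ W) (hV : Antitone V)
    (N : ℕ) (h0 : V 0 = ⊤) (hN : V N = ⊥) (hideal : ∀ k u, ∀ v ∈ V k, μ u v ∈ V k)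
    (hder : ∀ k, ∀ u ∈ V k, ∀ v ∈ V k, μ u v ∈ V (k + 1)) (e : OrthonormalBasis ι ℝ W) :
    0 ≤ structureForm μ e := by
  obtain ⟨f, ℓ, hf⟩ := exists_adapted_basis V hV N h0 hN
  rw [structureForm_eq μ e f]
  set c : Fin (Module.finrank ℝ W) → Fin (Module.finrank ℝ W) → Fin (Module.finrank ℝ W) → ℝ :=
    fun i j k ↦ ⟪μ (f i) (f j), f k⟫ with hcdef
  have key : ∀ m, ∀ w ∈ V m, ∀ k, ℓ k < m → ⟪w, f k⟫ = 0 := fun m w hw k hk ↦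
    Submodule.inner_right_of_mem_orthogonal (hV (Nat.succ_le_of_lt hk) hw) (hf k).2
  have c1 : ∀ i j k, ℓ k < ℓ j → c i j k = 0 := fun i j k h ↦
    key _ _ (hideal _ _ _ (hf j).1) k h
  have canti : ∀ i j k, c i j k = -c j i k := fun i j k ↦ by
    simp only [hcdef]; rw [hμ, inner_neg_left]
  have c2 : ∀ i j k, ℓ k < ℓ i → c i j k = 0 := fun i j k h ↦ by
    rw [canti, c1 j i k h, neg_zero]
  have c3 : ∀ i j k, ℓ i = ℓ j → ℓ k = ℓ i → c i j k = 0 := fun i j k h h' ↦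
    key (ℓ i + 1) _ (hder _ _ (hf i).1 _ (h ▸ (hf j).1)) k (by omega)
  exact adapted_nonneg ℓ canti c1 c2 c3

end Solvable

end GRF.Frame

/-! ## Ordinary differential equations -/

namespace GRF.ODE

variable {X : Type*} [NormedAddCommGroup X] [NormedSpace ℝ X]

/-- On [0,t] both curves stay in a compact subset of U, on which the locally Lipschitz field is
Lipschitz, so Gronwall applies although U need not be convex. -/
lemma uniqueness {F : X → X} {U : Set X} (hU : IsOpen U) (hF : ContDiffOn ℝ 1 F U) {T : ℝ}
    {x y : ℝ → X} (hx : ∀ t ∈ Ico 0 T, HasDerivWithinAt x (F (x t)) (Ico 0 T) t)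
    (hy : ∀ t ∈ Ico 0 T, HasDerivWithinAt y (F (y t)) (Ico 0 T) t)
    (hxU : ∀ t ∈ Ico 0 T, x t ∈ U) (hyU : ∀ t ∈ Ico 0 T, y t ∈ U) (h0 : x 0 = y 0) :
    EqOn x y (Ico 0 T) := by
  intro t ht
  have hsub : Icc 0 t ⊆ Ico 0 T := fun s hs ↦ ⟨hs.1, hs.2.trans_lt ht.2⟩
  have hxc : ContinuousOn x (Icc 0 t) := fun s hs ↦
    ((hx s (hsub hs)).continuousWithinAt).mono hsub
  have hyc : ContinuousOn y (Icc 0 t) := fun s hs ↦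
    ((hy s (hsub hs)).continuousWithinAt).mono hsub
  set K : Set X := x '' Icc 0 t ∪ y '' Icc 0 t with hK
  have hKc : IsCompact K := (isCompact_Icc.image_of_continuousOn hxc).union
    (isCompact_Icc.image_of_continuousOn hyc)
  have hKU : K ⊆ U := by
    rintro _ (⟨s, hs, rfl⟩ | ⟨s, hs, rfl⟩)
    exacts [hxU s (hsub hs), hyU s (hsub hs)]
  have hloc : LocallyLipschitzOn K F := by
    intro z hz
    obtain ⟨C, V, hV, hL⟩ :=
      (hF.contDiffAt (hU.mem_nhds (hKU hz))).exists_lipschitzOnWith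
    exact ⟨C, V, mem_nhdsWithin_of_mem_nhds hV, hL⟩
  obtain ⟨C, hC⟩ := hloc.exists_lipschitzOnWith_of_compact hKc
  have hder : ∀ {z : ℝ → X}, (∀ t ∈ Ico 0 T, HasDerivWithinAt z (F (z t)) (Ico 0 T) t) →
      ∀ s ∈ Ico 0 t, HasDerivWithinAt z (F (z s)) (Ici s) s := fun hz s hs ↦ by
    refine (hz s (hsub ⟨hs.1, hs.2.le⟩)).mono_of_mem_nhdsWithin ?_
    have : Ico s T ∈ 𝓝[≥] s := Ico_mem_nhdsGE (hs.2.trans ht.2)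
    exact Filter.mem_of_superset this fun r hr ↦ ⟨hs.1.trans hr.1, hr.2⟩
  exact ODE_solution_unique_of_mem_Icc_right (v := fun _ ↦ F) (s := fun _ ↦ K)
    (fun _ _ ↦ hC) hxc (hder hx) (fun s hs ↦ Or.inl ⟨s, ⟨hs.1, hs.2.le⟩, rfl⟩)
    hyc (hder hy) (fun s hs ↦ Or.inr ⟨s, ⟨hs.1, hs.2.le⟩, rfl⟩) h0 ⟨ht.1, le_rfl⟩

/-- Bootstrapping: if x is Cⁿ, so is x' = F(x). -/
lemma contDiffOn_solution {F : X → X} (hF : ContDiff ℝ ∞ F) {x : ℝ → X}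
    (hx : ∀ t ∈ Ici (0 : ℝ), HasDerivWithinAt x (F (x t)) (Ici 0) t) :
    ContDiffOn ℝ ∞ x (Ici 0) := by
  rw [contDiffOn_infty]
  intro n
  induction n with
  | zero => exact contDiffOn_zero.2 fun t ht ↦ (hx t ht).continuousWithinAt
  | succ n ih =>
    rw [show ((n + 1 : ℕ) : WithTop ℕ∞) = (n : WithTop ℕ∞) + 1 by push_cast; rfl,
      contDiffOn_succ_iff_derivWithin (uniqueDiffOn_Ici 0)]
    refine ⟨fun t ht ↦ (hx t ht).differentiableWithinAt, fun h ↦ ?_, ?_⟩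
    · exact absurd h (by simp)
    · refine ContDiffOn.congr (f := fun t ↦ F (x t)) ?_
        fun t ht ↦ (hx t ht).derivWithin (uniqueDiffOn_Ici 0 t ht)
      exact (hF.of_le (by exact_mod_cast le_top)).comp_contDiffOn ih

variable [FiniteDimensional ℝ X]

/-- The field is cut off outside a large ball. A solution of the cut-off equation is a slowed-down
solution of the original one, so by hypothesis it stays where the cutoff is 1. -/
lemma exists_solution_Icc {F : X → X} (hF : ContDiff ℝ 1 F) (x₀ : X) {T : ℝ} (hT : 0 < T) {R : ℝ}
    (hR : ∀ (θ : ℝ → ℝ) (x : ℝ → X), (∀ t, 0 ≤ θ t ∧ θ t ≤ 1) → x 0 = x₀ →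
      (∀ t ∈ Icc 0 T, HasDerivWithinAt x (θ t • F (x t)) (Icc 0 T) t) →
      ∀ t ∈ Icc 0 T, ‖x t‖ ≤ R) :
    ∃ x : ℝ → X, x 0 = x₀ ∧ ∀ t ∈ Icc 0 T, HasDerivWithinAt x (F (x t)) (Icc 0 T) t := by
  let χ : ContDiffBump (0 : X) := ⟨|R| + 1, |R| + 2, by positivity, by linarith⟩
  let G : X → X := fun x ↦ χ x • F x
  have hGs : HasCompactSupport G := χ.hasCompactSupport.smul_right
  have hG : ContDiff ℝ 1 G := (χ.contDiff (n := 1)).smul hF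
  obtain ⟨K, hK⟩ := hG.lipschitzWith_of_hasCompactSupport hGs one_ne_zero
  obtain ⟨C, hC⟩ := hGs.exists_bound_of_continuous hG.continuous
  -- The cut-off field is globally Lipschitz and bounded by C, so a ball of radius C·T serves for
  -- the whole interval.
  have hPL : IsPicardLindelof (fun _ ↦ G) (⟨0, le_rfl, hT.le⟩ : Icc 0 T) x₀
      (C.toNNReal * T.toNNReal) 0 C.toNNReal K := by
    refine ⟨fun _ _ ↦ hK.lipschitzOnWith, fun _ _ ↦ continuousOn_const, fun _ _ x _ ↦ ?_, ?_⟩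
    · exact (hC x).trans (Real.le_coe_toNNReal C)
    · simp [hT.le]
  obtain ⟨x, hx0, hx⟩ := hPL.exists_eq_forall_mem_Icc_hasDerivWithinAt₀
  refine ⟨x, hx0, fun t ht ↦ ?_⟩
  -- The cutoff along the solution itself plays the role of θ.
  have hb := hR (fun t ↦ χ (x t)) x (fun t ↦ ⟨χ.nonneg, χ.le_one⟩) hx0 hx t ht
  have h1 : χ (x t) = 1 := χ.one_of_mem_closedBall <| by
    rw [mem_closedBall_zero_iff]
    exact hb.trans ((le_abs_self R).trans (by change |R| ≤ |R| + 1; linarith))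
  have := hx t ht
  simpa [G, h1] using this

/-- Global existence under a priori bounds that are insensitive to slowing down the flow. -/
theorem exists_global_solution {F : X → X} (hF : ContDiff ℝ ∞ F) (x₀ : X)
    (hR : ∀ T : ℝ, 0 < T → ∃ R : ℝ, ∀ (θ : ℝ → ℝ) (x : ℝ → X), (∀ t, 0 ≤ θ t ∧ θ t ≤ 1) →
      x 0 = x₀ → (∀ t ∈ Icc 0 T, HasDerivWithinAt x (θ t • F (x t)) (Icc 0 T) t) →
      ∀ t ∈ Icc 0 T, ‖x t‖ ≤ R) :
    ∃ x : ℝ → X, x 0 = x₀ ∧ (∀ t ∈ Ici (0 : ℝ), HasDerivWithinAt x (F (x t)) (Ici 0) t) ∧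
      ContDiffOn ℝ ∞ x (Ici 0) := by
  have hF1 : ContDiff ℝ 1 F := hF.of_le (by exact_mod_cast le_top)
  have hex : ∀ n : ℕ, ∃ x : ℝ → X, x 0 = x₀ ∧ ∀ t ∈ Icc (0 : ℝ) (n + 1),
      HasDerivWithinAt x (F (x t)) (Icc (0 : ℝ) (n + 1)) t := fun n ↦ by
    obtain ⟨R, hR'⟩ := hR (n + 1) (by positivity)
    exact exists_solution_Icc hF1 x₀ (by positivity) hR'
  choose x hx0 hx using hex
  have hle : ∀ m n : ℕ, m ≤ n → EqOn (x n) (x m) (Ico 0 (m + 1)) := by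
    intro m n hmn
    have hmn' : (m : ℝ) ≤ n := by exact_mod_cast hmn
    refine uniqueness isOpen_univ hF1.contDiffOn (fun t ht ↦ ?_) (fun t ht ↦ ?_)
      (fun _ _ ↦ mem_univ _) (fun _ _ ↦ mem_univ _) (by rw [hx0, hx0])
    · exact (hx n t ⟨ht.1, by linarith [ht.2]⟩).mono fun s hs ↦ ⟨hs.1, by linarith [hs.2]⟩
    · exact (hx m t ⟨ht.1, ht.2.le⟩).mono fun s hs ↦ ⟨hs.1, hs.2.le⟩
  -- The n-th solution lives on [0, n+1], so for t in [n, n+1) it is still defined to the right of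
  -- t, and y agrees with it near t.
  let y : ℝ → X := fun t ↦ x ⌊t⌋₊ t
  have hy : ∀ n : ℕ, EqOn y (x n) (Ico 0 (n + 1)) := by
    intro n t ht
    have h1 : ⌊t⌋₊ ≤ n := by
      have : ⌊t⌋₊ < n + 1 := (Nat.floor_lt ht.1).2 (by exact_mod_cast ht.2)
      omega
    exact (hle _ _ h1 ⟨ht.1, Nat.lt_floor_add_one t⟩).symm
  have hder : ∀ t ∈ Ici (0 : ℝ), HasDerivWithinAt y (F (y t)) (Ici 0) t := by
    intro t ht
    have ht1 : t ∈ Ico (0 : ℝ) (⌊t⌋₊ + 1) := ⟨ht, Nat.lt_floor_add_one t⟩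
    have hmem : Ico (0 : ℝ) (⌊t⌋₊ + 1) ∈ 𝓝[Ici 0] t := by
      rw [← Ici_inter_Iio]
      exact inter_mem_nhdsWithin _ (Iio_mem_nhds ht1.2)
    have h1 := (hx ⌊t⌋₊ t ⟨ht, ht1.2.le⟩).mono Ico_subset_Icc_self
    rw [hy _ ht1]
    exact (h1.congr (hy _) (hy _ ht1)).mono_of_mem_nhdsWithin hmem
  refine ⟨y, ?_, hder, contDiffOn_solution hF hder⟩
  simp [y, hx0]

end GRF.ODE

/-! ## The flow of frames -/

namespace GRF.Frame

variable {E : Type*} [NormedAddCommGroup E] [NormedSpace ℝ E]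

/-- The identities of a Lie bracket. -/
structure IsLieBracket (br : E →L[ℝ] E →L[ℝ] E) : Prop where
  anti : ∀ u v, br u v = -br v u
  jacobi : ∀ u v w, br (br u v) w + br (br v w) u + br (br w u) v = 0

/-- A flag that is adapted to the derived series. -/
structure IsSolvableFlag (br : E →L[ℝ] E →L[ℝ] E) (V : ℕ → Submodule ℝ E) (N : ℕ) : Prop where
  antitone : Antitone V
  zero : V 0 = ⊤
  last : V N = ⊥
  ideal : ∀ k u, ∀ v ∈ V k, br u v ∈ V k
  derived : ∀ k, ∀ u ∈ V k, ∀ v ∈ V k, br u v ∈ V (k + 1)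

/-- Closed alternating trilinear forms on a Lie algebra. -/
structure IsClosedThree (br : E →L[ℝ] E →L[ℝ] E) (η : E → E → E → ℝ) : Prop where
  anti₁ : ∀ u v w, η u v w = -η v u w
  anti₂ : ∀ u v w, η u v w = -η u w v
  closed : ∀ u v w x, η (br u v) w x - η (br u w) v x + η (br u x) v w + η (br v w) u x
    - η (br v x) u w + η (br w x) u v = 0

/-- The differential of a `2`-form on a Lie algebra. -/
def dTwoForm (br : E →L[ℝ] E →L[ℝ] E) (β : E →L[ℝ] E →L[ℝ] ℝ) (u v w : E) : ℝ :=
  -β (br u v) w + β (br u w) v - β (br v w) u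

/-- Closedness is d² = 0 on 2-forms: the terms β([[a,b],c],d) vanish by Jacobi, and the terms
β([a,b],[c,d]) cancel in pairs by antisymmetry. -/
lemma IsClosedThree.add_dTwoForm {br : E →L[ℝ] E →L[ℝ] E} (hbr : IsLieBracket br)
    {η : E → E → E → ℝ} (hη : IsClosedThree br η) {β : E →L[ℝ] E →L[ℝ] ℝ}
    (hβ : ∀ u v, β u v = -β v u) :
    IsClosedThree br (fun u v w ↦ η u v w + dTwoForm br β u v w) := by
  have hl : ∀ u v w, β (br u v) w = -β (br v u) w := fun u v w ↦ by
    rw [hbr.anti u v]; simp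
  refine ⟨fun u v w ↦ ?_, fun u v w ↦ ?_, fun u v w x ↦ ?_⟩
  · rw [hη.anti₁ u v w]; simp only [dTwoForm]; linarith [hl u v w]
  · rw [hη.anti₂ u v w]; simp only [dTwoForm]; linarith [hl v w u]
  · have h1 := hη.closed u v w x
    simp only [dTwoForm]
    have J : ∀ a b c d, β (br (br a b) c) d + β (br (br b c) a) d + β (br (br c a) b) d = 0 :=
      fun a b c d ↦ by
        have := congrArg (fun z ↦ β z d) (hbr.jacobi a b c)
        simpa using this
    have ha : ∀ a b c d, β (br (br a b) c) d = -β (br (br b a) c) d := fun a b c d ↦ by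
      rw [hbr.anti a b]; simp
    have hb : ∀ a b c d, β (br a b) (br c d) = -β (br c d) (br a b) := fun a b c d ↦ hβ _ _
    have j1 := J u v w x
    have j2 := J u v x w
    have j3 := J u w x v
    have j4 := J v w x u
    have a1 := ha w u v x
    have a2 := ha x u v w
    have a3 := ha x u w v
    have a4 := ha x v w u
    have b1 := hb u v w x
    have b2 := hb u w v x
    have b3 := hb u x v w
    linarith

variable {ι : Type*} [Fintype ι]

/-- The bilinear form with components `B` in the coframe `κ`. -/
def bil (κ : ι → E →L[ℝ] ℝ) (B : ι → ι → ℝ) : E →L[ℝ] E →L[ℝ] ℝ :=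
  ∑ i, ∑ j, (B i j • κ i).smulRight (κ j)

/-- The trilinear form with components `A` in the coframe `κ`. -/
def tri (κ : ι → E →L[ℝ] ℝ) (A : ι → ι → ι → ℝ) (u v w : E) : ℝ :=
  ∑ k, bil κ (fun i j ↦ A i j k) u v * κ k w

/-- The state space: a frame, its dual frame, and the components of a `2`-form in a
fixed frame. -/
abbrev State (ι E : Type*) [NormedAddCommGroup E] [NormedSpace ℝ E] : Type _ :=
  (ι → E) × (ι → E →L[ℝ] ℝ) × (ι → ι → ℝ)

lemma bil_apply (κ : ι → E →L[ℝ] ℝ) (B : ι → ι → ℝ) (u v : E) :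
    bil κ B u v = ∑ i, ∑ j, B i j * (κ i u * κ j v) := by
  simp [bil, mul_assoc]

lemma bil_anti {κ : ι → E →L[ℝ] ℝ} {B : ι → ι → ℝ} (hB : ∀ i j, B i j = -B j i) (u v : E) :
    bil κ B u v = -bil κ B v u := by
  rw [bil_apply, bil_apply, Finset.sum_comm]
  simp only [← Finset.sum_neg_distrib]
  exact Finset.sum_congr rfl fun i _ ↦ Finset.sum_congr rfl fun j _ ↦ by rw [hB]; ring

/-- The structure constants in a frame. -/
def cst (br : E →L[ℝ] E →L[ℝ] E) (x : State ι E) (i j k : ι) : ℝ := x.2.1 k (br (x.1 i) (x.1 j))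

/-- The torsion `3`-form. -/
def torsion (br : E →L[ℝ] E →L[ℝ] E) (η : E → E → E → ℝ) (β : E →L[ℝ] E →L[ℝ] ℝ)
    (u v w : E) : ℝ := η u v w + dTwoForm br β u v w

section Linearity

variable {κ : ι → E →L[ℝ] ℝ} {A : ι → ι → ι → ℝ} {br : E →L[ℝ] E →L[ℝ] E} {α : Type*}

lemma tri_sum₁ (s : Finset α) (a : α → ℝ) (u : α → E) (v w : E) :
    tri κ A (∑ l ∈ s, a l • u l) v w = ∑ l ∈ s, a l * tri κ A (u l) v w := by
  simp only [tri, map_sum, map_smul, sum_apply, smul_apply, smul_eq_mul, Finset.sum_mul,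
    Finset.mul_sum, mul_assoc]
  exact Finset.sum_comm

lemma tri_sum₂ (s : Finset α) (a : α → ℝ) (u : α → E) (v w : E) :
    tri κ A v (∑ l ∈ s, a l • u l) w = ∑ l ∈ s, a l * tri κ A v (u l) w := by
  simp only [tri, map_sum, map_smul, smul_eq_mul, Finset.sum_mul,
    Finset.mul_sum, mul_assoc]
  exact Finset.sum_comm

lemma tri_sum₃ (s : Finset α) (a : α → ℝ) (u : α → E) (v w : E) :
    tri κ A v w (∑ l ∈ s, a l • u l) = ∑ l ∈ s, a l * tri κ A v w (u l) := by
  simp only [tri, map_sum, map_smul, smul_eq_mul, Finset.mul_sum]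
  rw [Finset.sum_comm]
  exact Finset.sum_congr rfl fun _ _ ↦ Finset.sum_congr rfl fun _ _ ↦ by ring

lemma torsion_sum₁ (β : E →L[ℝ] E →L[ℝ] ℝ) (s : Finset α) (a : α → ℝ) (u : α → E) (v w : E) :
    torsion br (tri κ A) β (∑ l ∈ s, a l • u l) v w =
      ∑ l ∈ s, a l * torsion br (tri κ A) β (u l) v w := by
  simp only [torsion, dTwoForm, tri_sum₁, map_sum, map_smul, sum_apply,
    smul_apply, smul_eq_mul, mul_add, mul_sub, mul_neg,
    Finset.sum_add_distrib, Finset.sum_sub_distrib, Finset.sum_neg_distrib]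

lemma torsion_sum₂ (β : E →L[ℝ] E →L[ℝ] ℝ) (s : Finset α) (a : α → ℝ) (u : α → E) (v w : E) :
    torsion br (tri κ A) β v (∑ l ∈ s, a l • u l) w =
      ∑ l ∈ s, a l * torsion br (tri κ A) β v (u l) w := by
  simp only [torsion, dTwoForm, tri_sum₂, map_sum, map_smul, sum_apply,
    smul_apply, smul_eq_mul, mul_add, mul_sub, mul_neg,
    Finset.sum_add_distrib, Finset.sum_sub_distrib, Finset.sum_neg_distrib]

lemma torsion_sum₃ (β : E →L[ℝ] E →L[ℝ] ℝ) (s : Finset α) (a : α → ℝ) (u : α → E) (v w : E) :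
    torsion br (tri κ A) β v w (∑ l ∈ s, a l • u l) =
      ∑ l ∈ s, a l * torsion br (tri κ A) β v w (u l) := by
  simp only [torsion, dTwoForm, tri_sum₃, map_sum, map_smul, sum_apply,
    smul_apply, smul_eq_mul, mul_add, mul_sub, mul_neg,
    Finset.sum_add_distrib, Finset.sum_sub_distrib, Finset.sum_neg_distrib]

end Linearity

/-- The components of the torsion in a frame. -/
def hst (br : E →L[ℝ] E →L[ℝ] E) (A : ι → ι → ι → ℝ) (κ : ι → E →L[ℝ] ℝ)
    (x : State ι E) (i j k : ι) : ℝ := torsion br (tri κ A) (bil κ x.2.2) (x.1 i) (x.1 j) (x.1 k)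

/-- The generalized Ricci flow as a flow of frames and `2`-forms. -/
def field (br : E →L[ℝ] E →L[ℝ] E) (A : ι → ι → ι → ℝ) (κ : ι → E →L[ℝ] ℝ)
    (f : ι → E) (x : State ι E) : State ι E :=
  (fun i ↦ ∑ j, speed (cst br x) (hst br A κ x) i j • x.1 j,
    fun i ↦ -∑ j, speed (cst br x) (hst br A κ x) i j • x.2.1 j,
    -- The codifferential is antisymmetrized by hand so that the field preserves antisymmetry at
    -- every state. On states with alternating components and closed initial torsion nothing
    -- changes, by `codiff_anti`.
    fun p q ↦ -∑ i, ∑ j, (1 / 2 * (codiff (cst br x) (hst br A κ x) i j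
      - codiff (cst br x) (hst br A κ x) j i)) * (x.2.1 i (f p) * x.2.1 j (f q)))

variable (br : E →L[ℝ] E →L[ℝ] E) (A : ι → ι → ι → ℝ)
  (κ : ι → E →L[ℝ] ℝ) (f : ι → E)

lemma contDiff_cst (i j k : ι) : ContDiff ℝ ∞ fun x : State ι E ↦ cst br x i j k := by
  unfold cst; fun_prop

lemma contDiff_hst (i j k : ι) : ContDiff ℝ ∞ fun x : State ι E ↦ hst br A κ x i j k := by
  unfold hst torsion dTwoForm
  simp only [tri, bil_apply]
  fun_prop

/-- Since the dual frame is a separate variable, no inversion is needed: the field is polynomial and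
smooth on the whole state space, also at degenerate frames. -/
lemma contDiff_field : ContDiff ℝ ∞ (field br A κ f) := by
  have hc := contDiff_cst (ι := ι) br
  have hh := contDiff_hst br A κ
  have h1 : ∀ i j, ContDiff ℝ ∞ fun x : State ι E ↦ speed (cst br x) (hst br A κ x) i j := by
    intro i j
    unfold speed speedStar ricStar symAd hSq tau
    fun_prop
  have h2 : ∀ i j, ContDiff ℝ ∞ fun x : State ι E ↦ codiff (cst br x) (hst br A κ x) i j := by
    intro i j
    unfold codiff codiffStar iotaZ tau
    fun_prop
  unfold field
  refine ContDiff.prodMk ?_ (ContDiff.prodMk ?_ ?_)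
  · fun_prop
  · fun_prop
  · fun_prop

/-- The second frame of the state is dual to the first one, and the `2`-form is alternating. -/
structure State.IsDual (x : State ι E) : Prop where
  complete : ∀ v, ∑ i, x.2.1 i v • x.1 i = v
  anti : ∀ i j, x.2.2 i j = -x.2.2 j i

variable {br A κ} {x : State ι E}

/-- Completeness makes the vectors span, and a spanning family of the right cardinality is a basis,
whose coordinates are unique. -/
lemma State.IsDual.apply [DecidableEq ι] (hx : x.IsDual) (hcard : Fintype.card ι = Module.finrank ℝ E) (i j : ι) :
    x.2.1 i (x.1 j) = if i = j then 1 else 0 := by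
  have hli : LinearIndependent ℝ x.1 := by
    refine linearIndependent_of_top_le_span_of_card_eq_finrank (fun v _ ↦ ?_) hcard
    rw [← hx.complete v]
    exact Submodule.sum_mem _ fun i _ ↦ Submodule.smul_mem _ _ (Submodule.subset_span ⟨i, rfl⟩)
  have h1 := hx.complete (x.1 j)
  have h2 : ∑ k, (x.2.1 k (x.1 j) - if k = j then 1 else 0) • x.1 k = 0 := by
    simp [sub_smul, Finset.sum_sub_distrib, h1]
  exact sub_eq_zero.1 (Fintype.linearIndependent_iff.1 hli _ h2 i)

lemma State.IsDual.isLie (hx : x.IsDual) (hbr : IsLieBracket br) : IsLie (cst br x) := by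
  refine ⟨fun i j k ↦ ?_, fun i j k l ↦ ?_⟩
  · simp only [cst]; rw [hbr.anti]; simp
  · have h : ∀ a b d, ∑ m, cst br x a b m * cst br x m d l =
        x.2.1 l (br (br (x.1 a) (x.1 b)) (x.1 d)) := fun a b d ↦ by
      conv_rhs => rw [← hx.complete (br (x.1 a) (x.1 b))]
      simp [cst]
    simp only [Finset.sum_add_distrib, h, ← map_add, hbr.jacobi, map_zero]

lemma State.IsDual.isClosedForm (hx : x.IsDual) (hbr : IsLieBracket br)
    (hA : IsClosedThree br (tri κ A)) : IsClosedForm (cst br x) (hst br A κ x) := by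
  have hc := hA.add_dTwoForm hbr (bil_anti (κ := κ) hx.anti)
  refine ⟨fun i j k ↦ hc.anti₁ _ _ _, fun i j k ↦ hc.anti₂ _ _ _, fun i j k l ↦ ?_⟩
  have h : ∀ a b d f, ∑ m, cst br x a b m * hst br A κ x m d f =
      torsion br (tri κ A) (bil κ x.2.2) (br (x.1 a) (x.1 b)) (x.1 d) (x.1 f) := fun a b d f ↦ by
    conv_rhs => rw [← hx.complete (br (x.1 a) (x.1 b))]
    rw [torsion_sum₁]
    rfl
  simp only [Finset.sum_add_distrib, Finset.sum_sub_distrib, h]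
  exact hc.closed _ _ _ _

end GRF.Frame

/-! ### Derivatives of the structure constants and the torsion along the flow -/

namespace GRF.Frame

variable {E : Type*} [NormedAddCommGroup E] [NormedSpace ℝ E] {ι : Type*} [Fintype ι]
  {br : E →L[ℝ] E →L[ℝ] E} {A : ι → ι → ι → ℝ} {κ : ι → E →L[ℝ] ℝ} {f : ι → E}

section Derivatives

variable {x : ℝ → State ι E} {θ t : ℝ} {s : Set ℝ}

lemma hasDeriv_frame (hx : HasDerivWithinAt x (θ • field br A κ f (x t)) s t) (i : ι) :
    HasDerivWithinAt (fun r ↦ (x r).1 i)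
      (θ • ∑ j, speed (cst br (x t)) (hst br A κ (x t)) i j • (x t).1 j) s t :=
  hasDerivWithinAt_pi.1 hx.fst i

lemma hasDeriv_coframe (hx : HasDerivWithinAt x (θ • field br A κ f (x t)) s t) (i : ι) :
    HasDerivWithinAt (fun r ↦ (x r).2.1 i)
      (θ • -∑ j, speed (cst br (x t)) (hst br A κ (x t)) i j • (x t).2.1 j) s t :=
  hasDerivWithinAt_pi.1 hx.snd.fst i

lemma hasDeriv_coframe_apply (hx : HasDerivWithinAt x (θ • field br A κ f (x t)) s t) (i : ι) (v : E) :
    HasDerivWithinAt (fun r ↦ (x r).2.1 i v)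
      (θ * -∑ j, speed (cst br (x t)) (hst br A κ (x t)) i j * (x t).2.1 j v) s t := by
  have := (hasDeriv_coframe hx i).clm_apply (hasDerivWithinAt_const t s v)
  simpa using this

/-- The state records the 2-form in the fixed frame, whereas its velocity is natural in the moving
coframe; expanding in the fixed frame reconciles the two. -/
lemma field_form_apply (hf : ∀ v, ∑ i, κ i v • f i = v) (y : State ι E) (u v : E) :
    bil κ (field br A κ f y).2.2 u v = -∑ i, ∑ j, (1 / 2 * (codiff (cst br y) (hst br A κ y) i j
        - codiff (cst br y) (hst br A κ y) j i)) * (y.2.1 i u * y.2.1 j v) := by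
  have h : ∀ (α : E →L[ℝ] ℝ) (w : E), α w = ∑ p, κ p w * α (f p) := fun α w ↦ by
    conv_lhs => rw [← hf w]
    simp
  have h2 : ∀ i j, y.2.1 i u * y.2.1 j v =
      ∑ p, ∑ q, y.2.1 i (f p) * y.2.1 j (f q) * (κ p u * κ q v) := fun i j ↦ by
    rw [h (y.2.1 i) u, h (y.2.1 j) v, Finset.sum_mul_sum]
    exact Finset.sum_congr rfl fun p _ ↦ Finset.sum_congr rfl fun q _ ↦ by ring
  rw [bil_apply]
  simp only [field, h2, Finset.mul_sum, Finset.sum_mul, neg_mul, Finset.sum_neg_distrib]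
  congr 1
  change S4 _ = S4 _
  rw [S4_swap13, S4_swap24]
  exact S4_congr fun i j k l ↦ by ring

lemma hasDeriv_bil (hx : HasDerivWithinAt x (θ • field br A κ f (x t)) s t) {u v : ℝ → E}
    {u' v' : E} (hu : HasDerivWithinAt u u' s t) (hv : HasDerivWithinAt v v' s t) :
    HasDerivWithinAt (fun r ↦ bil κ (x r).2.2 (u r) (v r))
      (θ * bil κ (field br A κ f (x t)).2.2 (u t) (v t) + bil κ (x t).2.2 u' (v t)
        + bil κ (x t).2.2 (u t) v') s t := by
  have hB : ∀ i j, HasDerivWithinAt (fun r ↦ (x r).2.2 i j)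
      (θ * (field br A κ f (x t)).2.2 i j) s t := fun i j ↦
    hasDerivWithinAt_pi.1 (hasDerivWithinAt_pi.1 hx.snd.snd i) j
  have hκ : ∀ i {w : ℝ → E} {w' : E}, HasDerivWithinAt w w' s t →
      HasDerivWithinAt (fun r ↦ κ i (w r)) (κ i w') s t := fun i w w' hw ↦
    (κ i).hasFDerivAt.comp_hasDerivWithinAt t hw
  simp only [bil_apply]
  refine (HasDerivWithinAt.fun_sum fun i _ ↦ HasDerivWithinAt.fun_sum fun j _ ↦
    (hB i j).fun_mul ((hκ i hu).fun_mul (hκ j hv))).congr_deriv ?_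
  simp only [Finset.mul_sum, ← Finset.sum_add_distrib]
  exact Finset.sum_congr rfl fun p _ ↦ Finset.sum_congr rfl fun q _ ↦ by ring

lemma hasDeriv_form_apply (hf : ∀ v, ∑ i, κ i v • f i = v)
    (hx : HasDerivWithinAt x (θ • field br A κ f (x t)) s t) (u v : E) :
    HasDerivWithinAt (fun r ↦ bil κ (x r).2.2 u v)
      (θ * -∑ i, ∑ j, (1 / 2 * (codiff (cst br (x t)) (hst br A κ (x t)) i j
        - codiff (cst br (x t)) (hst br A κ (x t)) j i)) * ((x t).2.1 i u * (x t).2.1 j v)) s t := by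
  refine (hasDeriv_bil hx (hasDerivWithinAt_const t s u)
    (hasDerivWithinAt_const t s v)).congr_deriv ?_
  rw [field_form_apply hf]
  simp

/-- The product rule: the two frame slots move with +P and the coframe slot with −P, which gives the
signs in `actC`. -/
lemma hasDeriv_cst (hx : HasDerivWithinAt x (θ • field br A κ f (x t)) s t) (i j k : ι) :
    HasDerivWithinAt (fun r ↦ cst br (x r) i j k)
      (θ * actC (speed (cst br (x t)) (hst br A κ (x t))) (cst br (x t)) i j k) s t := by
  have h1 := (hasDerivWithinAt_const t s br).clm_apply (hasDeriv_frame hx i)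
  have h2 := h1.clm_apply (hasDeriv_frame hx j)
  have h3 := (hasDeriv_coframe hx k).clm_apply h2
  refine h3.congr_deriv ?_
  simp only [actC, cst]
  simp
  ring

lemma hasDeriv_tri {u v w : ℝ → E} {u' v' w' : E} (hu : HasDerivWithinAt u u' s t)
    (hv : HasDerivWithinAt v v' s t) (hw : HasDerivWithinAt w w' s t) :
    HasDerivWithinAt (fun r ↦ tri κ A (u r) (v r) (w r))
      (tri κ A u' (v t) (w t) + tri κ A (u t) v' (w t) + tri κ A (u t) (v t) w') s t := by
  have hκ : ∀ i {w : ℝ → E} {w' : E}, HasDerivWithinAt w w' s t →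
      HasDerivWithinAt (fun r ↦ κ i (w r)) (κ i w') s t := fun i w w' hw ↦
    (κ i).hasFDerivAt.comp_hasDerivWithinAt t hw
  simp only [tri, bil_apply]
  refine (HasDerivWithinAt.fun_sum fun k _ ↦ ((HasDerivWithinAt.fun_sum fun i _ ↦
    HasDerivWithinAt.fun_sum fun j _ ↦ ((hκ i hu).fun_mul (hκ j hv)).const_mul (A i j k)).fun_mul
      (hκ k hw))).congr_deriv ?_
  simp only [← Finset.sum_add_distrib]
  refine Finset.sum_congr rfl fun k _ ↦ ?_
  simp only [Finset.sum_mul, ← Finset.sum_add_distrib]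
  exact Finset.sum_congr rfl fun p _ ↦ Finset.sum_congr rfl fun q _ ↦ by ring

lemma hasDeriv_br {u v : ℝ → E} {u' v' : E} (hu : HasDerivWithinAt u u' s t)
    (hv : HasDerivWithinAt v v' s t) :
    HasDerivWithinAt (fun r ↦ br (u r) (v r)) (br u' (v t) + br (u t) v') s t := by
  have h1 : HasDerivWithinAt (fun r ↦ br (u r)) (br u') s t :=
    br.hasFDerivAt.comp_hasDerivWithinAt t hu
  exact h1.clm_apply hv

lemma hasDeriv_torsion (hx : HasDerivWithinAt x (θ • field br A κ f (x t)) s t)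
    {u v w : ℝ → E} {u' v' w' : E} (hu : HasDerivWithinAt u u' s t)
    (hv : HasDerivWithinAt v v' s t) (hw : HasDerivWithinAt w w' s t) :
    HasDerivWithinAt (fun r ↦ torsion br (tri κ A) (bil κ (x r).2.2) (u r) (v r) (w r))
      (torsion br (tri κ A) (bil κ (x t).2.2) u' (v t) (w t)
        + torsion br (tri κ A) (bil κ (x t).2.2) (u t) v' (w t)
        + torsion br (tri κ A) (bil κ (x t).2.2) (u t) (v t) w'
        + θ * dTwoForm br (bil κ (field br A κ f (x t)).2.2) (u t) (v t) (w t)) s t := by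
  have h1 := hasDeriv_tri (κ := κ) (A := A) hu hv hw
  have h2 := hasDeriv_bil hx (hasDeriv_br (br := br) hu hv) hw
  have h3 := hasDeriv_bil hx (hasDeriv_br (br := br) hu hw) hv
  have h4 := hasDeriv_bil hx (hasDeriv_br (br := br) hv hw) hu
  refine (h1.add ((h2.neg.add h3).sub h4)).congr_deriv ?_
  simp only [torsion, dTwoForm, map_add, add_apply]
  ring

/-- The components change for two reasons: the frame moves, which gives `actH`, and the 2-form
changes by −d*H, which adds −d d*H. -/
lemma hasDeriv_hst [DecidableEq ι] (hf : ∀ v, ∑ i, κ i v • f i = v)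
    (hx : HasDerivWithinAt x (θ • field br A κ f (x t)) s t)
    (hd : (x t).IsDual) (hcard : Fintype.card ι = Module.finrank ℝ E)
    (hcod : ∀ i j, codiff (cst br (x t)) (hst br A κ (x t)) i j =
      -codiff (cst br (x t)) (hst br A κ (x t)) j i) (i j k : ι) :
    HasDerivWithinAt (fun r ↦ hst br A κ (x r) i j k)
      (θ * (actH (speed (cst br (x t)) (hst br A κ (x t))) (hst br A κ (x t)) i j k
        - dTwo (cst br (x t)) (codiff (cst br (x t)) (hst br A κ (x t))) i j k)) s t := by
  have h := hasDeriv_torsion hx (hasDeriv_frame hx i) (hasDeriv_frame hx j) (hasDeriv_frame hx k)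
  refine h.congr_deriv ?_
  have hB : ∀ a b d, bil κ (field br A κ f (x t)).2.2 (br ((x t).1 a) ((x t).1 b)) ((x t).1 d) =
      -∑ l, cst br (x t) a b l * codiff (cst br (x t)) (hst br A κ (x t)) l d := by
    intro a b d
    have hD : ∀ i j, 1 / 2 * (codiff (cst br (x t)) (hst br A κ (x t)) i j
        - codiff (cst br (x t)) (hst br A κ (x t)) j i) =
        codiff (cst br (x t)) (hst br A κ (x t)) i j := fun i j ↦ by rw [hcod j i]; ring
    rw [field_form_apply hf]
    simp only [hD, hd.apply hcard, mul_ite, mul_one, mul_zero, Finset.sum_ite_eq',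
      Finset.mem_univ, if_true, cst]
    congr 1
    exact Finset.sum_congr rfl fun _ _ ↦ by ring
  simp only [Finset.smul_sum, smul_smul, torsion_sum₁, torsion_sum₂, torsion_sum₃, actH]
  simp only [dTwoForm, hB, dTwo, Finset.sum_add_distrib, Finset.sum_sub_distrib,
    Finset.sum_neg_distrib, mul_assoc, ← Finset.mul_sum, hst]
  ring

end Derivatives

end GRF.Frame

/-! ### A priori bounds and long-time existence of the flow of frames -/

namespace GRF.Frame

section Comparison

lemma le_of_deriv_le {f m f' m' : ℝ → ℝ} {T : ℝ}
    (hf : ∀ t ∈ Icc 0 T, HasDerivWithinAt f (f' t) (Icc 0 T) t)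
    (hm : ∀ t ∈ Icc 0 T, HasDerivWithinAt m (m' t) (Icc 0 T) t)
    (h : ∀ t ∈ Icc 0 T, f' t ≤ m' t) {t : ℝ} (ht : t ∈ Icc 0 T) : f t - f 0 ≤ m t - m 0 := by
  have hd : ∀ s ∈ Icc 0 T, HasDerivWithinAt (fun s ↦ m s - f s) (m' s - f' s) (Icc 0 T) s :=
    fun s hs ↦ (hm s hs).sub (hf s hs)
  have := monotoneOn_of_hasDerivWithinAt_nonneg (convex_Icc 0 T)
    (fun s hs ↦ (hd s hs).continuousWithinAt)
    (fun s hs ↦ (hd s (interior_subset hs)).mono interior_subset)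
    (fun s hs ↦ sub_nonneg.2 (h s (interior_subset hs)))
  have h2 := this ⟨le_rfl, ht.1.trans ht.2⟩ ht ht.1
  dsimp only at h2
  linarith

/-- Gronwall's inequality with a given primitive m of the growth rate: f·exp(−m) is nonincreasing.
No sign of f or of the rate is required, and no integral is formed. -/
lemma le_exp_of_deriv_le {f m f' m' : ℝ → ℝ} {T : ℝ}
    (hf : ∀ t ∈ Icc 0 T, HasDerivWithinAt f (f' t) (Icc 0 T) t)
    (hm : ∀ t ∈ Icc 0 T, HasDerivWithinAt m (m' t) (Icc 0 T) t)
    (h : ∀ t ∈ Icc 0 T, f' t ≤ m' t * f t) {t : ℝ} (ht : t ∈ Icc 0 T) :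
    f t ≤ f 0 * Real.exp (m t - m 0) := by
  have hd : ∀ s ∈ Icc 0 T, HasDerivWithinAt (fun s ↦ f s * Real.exp (-m s))
      (f' s * Real.exp (-m s) + f s * (Real.exp (-m s) * -m' s)) (Icc 0 T) s :=
    fun s hs ↦ (hf s hs).mul (hm s hs).neg.exp
  have h0 : ∀ s ∈ Icc 0 T, HasDerivWithinAt (fun _ : ℝ ↦ (0 : ℝ)) 0 (Icc 0 T) s :=
    fun s _ ↦ hasDerivWithinAt_const _ _ _
  have h1 := le_of_deriv_le hd h0 (fun s hs ↦ by
    have := mul_le_mul_of_nonneg_right (h s hs) (Real.exp_pos (-m s)).le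
    linarith) ht
  have h2 : f t * Real.exp (-m t) ≤ f 0 * Real.exp (-m 0) := by linarith
  have h3 := mul_le_mul_of_nonneg_right h2 (Real.exp_pos (m t)).le
  rw [mul_assoc, ← Real.exp_add, neg_add_cancel, Real.exp_zero, mul_one, mul_assoc,
    ← Real.exp_add] at h3
  rwa [show m t - m 0 = -m 0 + m t by ring]

variable {ι : Type*} [Fintype ι]

/-- Cauchy–Schwarz gives |P||a|², and |P| ≤ ½(1 + |P|²). It is |P|² that the growth of `scal`
controls. -/
lemma abs_quadratic_le (P : ι → ι → ℝ) (a : ι → ℝ) :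
    |∑ i, ∑ j, P i j * (a i * a j)| ≤
      1 / 2 * (1 + ∑ i, ∑ j, P i j ^ 2) * ∑ i, a i ^ 2 := by
  have h := Finset.sum_mul_sq_le_sq_mul_sq Finset.univ (fun p : ι × ι ↦ P p.1 p.2)
    (fun p : ι × ι ↦ a p.1 * a p.2)
  simp only [Fintype.sum_prod_type] at h
  have e : ∑ i, ∑ j, (a i * a j) ^ 2 = (∑ i, a i ^ 2) ^ 2 := by
    rw [sq (∑ i, a i ^ 2), Finset.sum_mul_sum]; simp only [mul_pow]
  rw [e] at h
  set p := ∑ i, ∑ j, P i j ^ 2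
  set q := ∑ i, a i ^ 2
  have hq : 0 ≤ q := Finset.sum_nonneg fun i _ ↦ sq_nonneg _
  have hp : 0 ≤ p := Finset.sum_nonneg fun i _ ↦ Finset.sum_nonneg fun i _ ↦ sq_nonneg _
  refine abs_le_of_sq_le_sq (h.trans ?_) (by positivity)
  nlinarith [mul_nonneg (sq_nonneg (1 - p)) (sq_nonneg q)]

lemma bilinear_le (D : ι → ι → ℝ) (a b : ι → ℝ) :
    -∑ i, ∑ j, D i j * (a i * b j) ≤
      1 / 2 * (∑ i, ∑ j, D i j ^ 2) + 1 / 2 * ((∑ i, a i ^ 2) * ∑ i, b i ^ 2) := by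
  rw [Finset.sum_mul_sum]
  simp only [Finset.mul_sum, ← Finset.sum_add_distrib, ← Finset.sum_neg_distrib]
  exact Finset.sum_le_sum fun i _ ↦ Finset.sum_le_sum fun j _ ↦ by
    nlinarith [sq_nonneg (D i j + a i * b j)]

lemma hasDeriv_scal {c h : ℝ → ι → ι → ι → ℝ} {c' h' : ι → ι → ι → ℝ} {θ t : ℝ} {s : Set ℝ}
    (hc : ∀ i j k, HasDerivWithinAt (fun r ↦ c r i j k) (θ * c' i j k) s t)
    (hh : ∀ i j k, HasDerivWithinAt (fun r ↦ h r i j k) (θ * h' i j k) s t) :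
    HasDerivWithinAt (fun r ↦ scal (c r) (h r))
      (θ * (-(1 / 4) * (∑ i, ∑ j, ∑ k, 2 * c t i j k * c' i j k)
      - 1 / 2 * (∑ i, ∑ j, ∑ k, (c' i j k * c t i k j + c t i j k * c' i k j))
      - (∑ i, 2 * tau (c t) i * ∑ j, c' i j j)
      - 1 / 12 * (∑ i, ∑ j, ∑ k, 2 * h t i j k * h' i j k))) s t := by
  have h1 := HasDerivWithinAt.fun_sum (u := Finset.univ) fun i _ ↦
    HasDerivWithinAt.fun_sum (u := Finset.univ) fun j _ ↦
    HasDerivWithinAt.fun_sum (u := Finset.univ) fun k _ ↦ (hc i j k).fun_pow 2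
  have h2 := HasDerivWithinAt.fun_sum (u := Finset.univ) fun i _ ↦
    HasDerivWithinAt.fun_sum (u := Finset.univ) fun j _ ↦
    HasDerivWithinAt.fun_sum (u := Finset.univ) fun k _ ↦ (hc i j k).fun_mul (hc i k j)
  have h3 := HasDerivWithinAt.fun_sum (u := Finset.univ) fun i _ ↦
    (HasDerivWithinAt.fun_sum (u := Finset.univ) fun j _ ↦ hc i j j).fun_pow 2
  have h4 := HasDerivWithinAt.fun_sum (u := Finset.univ) fun i _ ↦
    HasDerivWithinAt.fun_sum (u := Finset.univ) fun j _ ↦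
    HasDerivWithinAt.fun_sum (u := Finset.univ) fun k _ ↦ (hh i j k).fun_pow 2
  refine ((((h1.const_mul (-(1 / 4))).sub (h2.const_mul (1 / 2))).sub h3).sub
    (h4.const_mul (1 / 12))).congr_deriv ?_
  have e3 : ∀ i, (∑ j, c t i j j) = tau (c t) i := fun i ↦ rfl
  simp only [e3, mul_sub]
  rw [Finset.mul_sum Finset.univ (fun i ↦ 2 * tau (c t) i * ∑ j, c' i j j) θ]
  congr 1
  · congr 1
    · simp only [Finset.mul_sum]
      congr 1 <;> exact Finset.sum_congr rfl fun i _ ↦ Finset.sum_congr rfl fun j _ ↦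
        Finset.sum_congr rfl fun k _ ↦ by push_cast; ring
    · refine Finset.sum_congr rfl fun i _ ↦ ?_
      rw [← Finset.mul_sum]
      push_cast; ring
  · simp only [Finset.mul_sum]
    exact Finset.sum_congr rfl fun i _ ↦ Finset.sum_congr rfl fun j _ ↦
        Finset.sum_congr rfl fun k _ ↦ by push_cast; ring

end Comparison

variable {E : Type*} [NormedAddCommGroup E] [NormedSpace ℝ E] {ι : Type*} [Fintype ι]
  {br : E →L[ℝ] E →L[ℝ] E} {A : ι → ι → ι → ℝ} {κ : ι → E →L[ℝ] ℝ} {f : ι → E}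

open scoped RealInnerProductSpace in
-- The frame identifies E with a Euclidean space in which it is the standard basis. Transported
-- there, the bracket and the flag satisfy the hypotheses of `structureForm_nonneg`; the terms with
-- `tau` and h only lower `scal`.
lemma State.IsDual.scal_nonpos [DecidableEq ι] {x : State ι E} (hx : x.IsDual)
    (hbr : IsLieBracket br) (hcard : Fintype.card ι = Module.finrank ℝ E)
    {V : ℕ → Submodule ℝ E} {N : ℕ} (hV : IsSolvableFlag br V N) (h : ι → ι → ι → ℝ) :
    scal (cst br x) h ≤ 0 := by
  let W := EuclideanSpace ℝ ι
  let p : W →ₗ[ℝ] E := Fintype.linearCombination ℝ x.1 ∘ₗ (WithLp.linearEquiv 2 ℝ (ι → ℝ)).toLinearMap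
  let q : E →ₗ[ℝ] W := (WithLp.linearEquiv 2 ℝ (ι → ℝ)).symm.toLinearMap ∘ₗ
    LinearMap.pi fun i ↦ (x.2.1 i).toLinearMap
  have hpq : ∀ v, p (q v) = v := fun v ↦ hx.complete v
  have hqi : ∀ v i, q v i = x.2.1 i v := fun v i ↦ rfl
  have hp : ∀ a, p a = ∑ i, a i • x.1 i := fun a ↦ rfl
  have hqp : ∀ a, q (p a) = a := fun a ↦ by
    ext i
    rw [hqi, hp]
    simp [hx.apply hcard]
  let μ : W →ₗ[ℝ] W →ₗ[ℝ] W := LinearMap.mk₂ ℝ (fun a b ↦ q (br (p a) (p b)))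
    (by simp) (by simp) (by simp) (by simp)
  have hμ : ∀ a b, μ a b = q (br (p a) (p b)) := fun a b ↦ rfl
  have h1 := structureForm_nonneg μ (fun a b ↦ by rw [hμ, hμ, hbr.anti]; simp)
    (fun k ↦ (V k).comap p) (fun k l hkl ↦ Submodule.comap_mono (hV.antitone hkl)) N
    (by simp [hV.zero]) (by
      simp only [hV.last]
      rw [Submodule.eq_bot_iff]
      intro a ha
      rw [← hqp a, (Submodule.mem_bot ℝ).1 (Submodule.mem_comap.1 ha), map_zero])
    (fun k a b hb ↦ by
      rw [Submodule.mem_comap, hμ, hpq]; exact hV.ideal _ _ _ hb)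
    (fun k a ha b hb ↦ by
      rw [Submodule.mem_comap, hμ, hpq]; exact hV.derived _ _ ha _ hb)
    (EuclideanSpace.basisFun ι ℝ)
  have h2 : ∀ i j k, ⟪μ (EuclideanSpace.basisFun ι ℝ i) (EuclideanSpace.basisFun ι ℝ j),
      EuclideanSpace.basisFun ι ℝ k⟫ = cst br x i j k := by
    intro i j k
    have hb : ∀ i, p (EuclideanSpace.basisFun ι ℝ i) = x.1 i := fun i ↦ by
      rw [hp]; simp
    rw [hμ, hb, hb]
    rw [EuclideanSpace.basisFun_apply, EuclideanSpace.inner_single_right, hqi]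
    simp [cst]
  simp only [structureForm, h2] at h1
  have h3 : 0 ≤ ∑ i, tau (cst br x) i ^ 2 := Finset.sum_nonneg fun i _ ↦ sq_nonneg _
  have h4 : 0 ≤ ∑ i, ∑ j, ∑ k, h i j k ^ 2 := by positivity
  simp only [scal]
  linarith

lemma eq_of_deriv_zero {F : Type*} [NormedAddCommGroup F] [NormedSpace ℝ F] {y : ℝ → F} {T : ℝ}
    (hy : ∀ t ∈ Icc 0 T, HasDerivWithinAt y 0 (Icc 0 T) t) : ∀ t ∈ Icc 0 T, y t = y 0 := by
  refine constant_of_has_deriv_right_zero (fun t ht ↦ (hy t ht).continuousWithinAt)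
    fun t ht ↦ (hy t ⟨ht.1, ht.2.le⟩).mono_of_mem_nhdsWithin ?_
  exact Filter.mem_of_superset (Icc_mem_nhdsGE ht.2) (Icc_subset_Icc_left ht.1)

section Flow

variable {x : ℝ → State ι E} {θ : ℝ → ℝ} {T : ℝ}

/-- As P is symmetric, the motions of frame and coframe cancel in Σ εᵢ ⊗ eᵢ. The antisymmetry of the
2-form is kept because its velocity is antisymmetrized by definition, so neither part presupposes
the other. -/
lemma isDual_of_flow
    (hx : ∀ t ∈ Icc 0 T, HasDerivWithinAt x (θ t • field br A κ f (x t)) (Icc 0 T) t)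
    (h0 : (x 0).IsDual) : ∀ t ∈ Icc 0 T, (x t).IsDual := by
  refine fun t ht ↦ ⟨fun v ↦ ?_, fun i j ↦ ?_⟩
  · refine (eq_of_deriv_zero (y := fun r ↦ ∑ i, (x r).2.1 i v • (x r).1 i) (T := T)
      (fun r hr ↦ ?_) t ht).trans (h0.complete v)
    refine (HasDerivWithinAt.fun_sum fun i _ ↦ (hasDeriv_coframe_apply (hx r hr) i v).fun_smul
      (hasDeriv_frame (hx r hr) i)).congr_deriv ?_
    simp only [Finset.smul_sum, smul_smul, mul_neg, neg_smul, Finset.mul_sum, Finset.sum_smul,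
      Finset.sum_add_distrib, Finset.sum_neg_distrib]
    rw [add_neg_eq_zero, Finset.sum_comm]
    refine Finset.sum_congr rfl fun p _ ↦ Finset.sum_congr rfl fun q _ ↦ ?_
    rw [speed_symm]; congr 1; ring
  · have h1 : ∀ r ∈ Icc 0 T, ∀ i j, HasDerivWithinAt (fun r ↦ (x r).2.2 i j)
      (θ r * (field br A κ f (x r)).2.2 i j) (Icc 0 T) r := fun r hr i j ↦
      hasDerivWithinAt_pi.1 (hasDerivWithinAt_pi.1 (hx r hr).snd.snd i) j
    have h2 := eq_of_deriv_zero (y := fun r ↦ (x r).2.2 i j + (x r).2.2 j i) (T := T)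
      (fun r hr ↦ ((h1 r hr i j).add (h1 r hr j i)).congr_deriv ?_) t ht
    · have := h0.anti i j
      linarith
    · rw [← mul_add]
      convert mul_zero _
      simp only [field]
      rw [Finset.sum_comm, ← Finset.sum_neg_distrib, ← Finset.sum_neg_distrib,
        ← Finset.sum_add_distrib]
      refine Finset.sum_eq_zero fun p _ ↦ ?_
      rw [← Finset.sum_neg_distrib, ← Finset.sum_neg_distrib, ← Finset.sum_add_distrib]
      refine Finset.sum_eq_zero fun q _ ↦ ?_
      ring

/-- The integrability data of the flow. -/
structure FlowData [DecidableEq ι] (br : E →L[ℝ] E →L[ℝ] E) (A : ι → ι → ι → ℝ)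
    (κ : ι → E →L[ℝ] ℝ) (f : ι → E) : Prop where
  bracket : IsLieBracket br
  solvable : ∃ V N, IsSolvableFlag br V N
  closed : IsClosedThree br (tri κ A)
  frame : ∀ v, ∑ i, κ i v • f i = v
  card : Fintype.card ι = Module.finrank ℝ E

variable [DecidableEq ι]

/-- The rate S' is stated without the factor θ: the slowed flow multiplies it by θ, while the lower
bound is the one of the true flow. -/
lemma hasDeriv_scal_flow (hd : FlowData br A κ f)
    (hx : ∀ t ∈ Icc 0 T, HasDerivWithinAt x (θ t • field br A κ f (x t)) (Icc 0 T) t)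
    (h0 : (x 0).IsDual) : ∃ S' : ℝ → ℝ, ∀ t ∈ Icc 0 T,
      HasDerivWithinAt (fun r ↦ scal (cst br (x r)) (hst br A κ (x r))) (θ t * S' t) (Icc 0 T) t ∧
      (∑ i, ∑ j, speed (cst br (x t)) (hst br A κ (x t)) i j ^ 2)
        + 1 / 4 * (∑ i, ∑ j, codiff (cst br (x t)) (hst br A κ (x t)) i j ^ 2) ≤ S' t := by
  refine ⟨fun t ↦ -(1 / 4) * (∑ i, ∑ j, ∑ k, 2 * cst br (x t) i j k *
      actC (speed (cst br (x t)) (hst br A κ (x t))) (cst br (x t)) i j k)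
      - 1 / 2 * (∑ i, ∑ j, ∑ k, (actC (speed (cst br (x t)) (hst br A κ (x t))) (cst br (x t)) i j k
        * cst br (x t) i k j + cst br (x t) i j k *
          actC (speed (cst br (x t)) (hst br A κ (x t))) (cst br (x t)) i k j))
      - (∑ i, 2 * tau (cst br (x t)) i *
        ∑ j, actC (speed (cst br (x t)) (hst br A κ (x t))) (cst br (x t)) i j j)
      - 1 / 12 * (∑ i, ∑ j, ∑ k, 2 * hst br A κ (x t) i j k *
        (actH (speed (cst br (x t)) (hst br A κ (x t))) (hst br A κ (x t)) i j k
          - dTwo (cst br (x t)) (codiff (cst br (x t)) (hst br A κ (x t))) i j k)),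
    fun t ht ↦ ?_⟩
  have hdt := isDual_of_flow hx h0 t ht
  have hc := hdt.isLie hd.bracket
  have hh := hdt.isClosedForm hd.bracket hd.closed
  exact ⟨hasDeriv_scal (hasDeriv_cst (hx t ht))
    (hasDeriv_hst hd.frame (hx t ht) hdt hd.card hh.codiff_anti), scal_variation hc hh⟩

/-- The logarithmic growth of |a|² is at most θ(1 + |P|²) ≤ 1 + θS', the derivative of t + `scal`.
Since `scal` ends nonpositive, the total growth exponent is at most T − scal(0). The sign σ is 1 for
the frame and −1 for the coframe. -/
lemma sum_sq_le (hd : FlowData br A κ f)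
    (hx : ∀ t ∈ Icc 0 T, HasDerivWithinAt x (θ t • field br A κ f (x t)) (Icc 0 T) t)
    (h0 : (x 0).IsDual) (hθ : ∀ t, 0 ≤ θ t ∧ θ t ≤ 1) {a : ℝ → ι → ℝ} {σ : ℝ} (hσ : |σ| = 1)
    (ha : ∀ t ∈ Icc 0 T, ∀ i, HasDerivWithinAt (fun r ↦ a r i)
      (σ * (θ t * ∑ j, speed (cst br (x t)) (hst br A κ (x t)) i j * a t j)) (Icc 0 T) t) :
    ∀ t ∈ Icc 0 T, ∑ i, a t i ^ 2 ≤
      (∑ i, a 0 i ^ 2) * Real.exp (T - scal (cst br (x 0)) (hst br A κ (x 0))) := by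
  intro t ht
  obtain ⟨S', hS⟩ := hasDeriv_scal_flow hd hx h0
  have hm : ∀ t ∈ Icc 0 T, HasDerivWithinAt
      (fun r ↦ r + scal (cst br (x r)) (hst br A κ (x r))) (1 + θ t * S' t) (Icc 0 T) t :=
    fun t ht ↦ (hasDerivWithinAt_id t _).add (hS t ht).1
  have hq : ∀ t ∈ Icc 0 T, HasDerivWithinAt (fun r ↦ ∑ i, a r i ^ 2)
      (2 * σ * θ t * ∑ i, ∑ j, speed (cst br (x t)) (hst br A κ (x t)) i j * (a t i * a t j))
      (Icc 0 T) t := fun t ht ↦ by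
    refine (HasDerivWithinAt.fun_sum fun i _ ↦ (ha t ht i).fun_pow 2).congr_deriv ?_
    simp only [Finset.mul_sum]
    exact Finset.sum_congr rfl fun p _ ↦ Finset.sum_congr rfl fun q _ ↦ by push_cast; ring
  have hle := le_exp_of_deriv_le hq hm (fun s hs ↦ ?_) ht
  · refine hle.trans (mul_le_mul_of_nonneg_left (Real.exp_le_exp.2 ?_)
      (Finset.sum_nonneg fun i _ ↦ sq_nonneg _))
    obtain ⟨V, N, hV⟩ := hd.solvable
    have := (isDual_of_flow hx h0 t ht).scal_nonpos hd.bracket hd.card hV (hst br A κ (x t))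
    linarith [ht.2]
  · have h1 := abs_quadratic_le (speed (cst br (x s)) (hst br A κ (x s))) (a s)
    set Z := ∑ i, ∑ j, speed (cst br (x s)) (hst br A κ (x s)) i j * (a s i * a s j)
    set p := ∑ i, ∑ j, speed (cst br (x s)) (hst br A κ (x s)) i j ^ 2
    set q := ∑ i, a s i ^ 2
    have hS2 := (hS s hs).2
    have hD : 0 ≤ ∑ i, ∑ j, codiff (cst br (x s)) (hst br A κ (x s)) i j ^ 2 :=
      Finset.sum_nonneg fun i _ ↦ Finset.sum_nonneg fun i _ ↦ sq_nonneg _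
    have hq0 : 0 ≤ q := Finset.sum_nonneg fun i _ ↦ sq_nonneg _
    have h2 : σ * Z ≤ |Z| := (le_abs_self _).trans (by rw [abs_mul, hσ, one_mul])
    have h3 : 2 * σ * θ s * Z ≤ θ s * ((1 + p) * q) := by
      have := mul_le_mul_of_nonneg_left (h2.trans h1) (hθ s).1
      linarith
    have h4 : θ s * ((1 + p) * q) ≤ (1 + θ s * S' s) * q := by
      rw [← mul_assoc]
      refine mul_le_mul_of_nonneg_right ?_ hq0
      nlinarith [mul_le_mul_of_nonneg_left (show p ≤ S' s by linarith) (hθ s).1, (hθ s).2]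
    exact h3.trans h4

/-- By `bilinear_le` the speed of a component is at most ½|d*H|² + ½CₚC_q times θ, and ½|d*H|² ≤
2S'. The comparison function is therefore ½CₚC_q t + 2 `scal`. -/
lemma abs_form_le (hd : FlowData br A κ f)
    (hx : ∀ t ∈ Icc 0 T, HasDerivWithinAt x (θ t • field br A κ f (x t)) (Icc 0 T) t)
    (h0 : (x 0).IsDual) (hθ : ∀ t, 0 ≤ θ t ∧ θ t ≤ 1) {C : ι → ℝ}
    (hC : ∀ t ∈ Icc 0 T, ∀ p, ∑ i, (x t).2.1 i (f p) ^ 2 ≤ C p) (p q : ι) :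
    ∀ t ∈ Icc 0 T, |(x t).2.2 p q| ≤ |(x 0).2.2 p q|
      + (1 / 2 * (C p * C q) * T - 2 * scal (cst br (x 0)) (hst br A κ (x 0))) := by
  obtain ⟨S', hS⟩ := hasDeriv_scal_flow hd hx h0
  have key : ∀ p q, ∀ t ∈ Icc 0 T, (x t).2.2 p q - (x 0).2.2 p q ≤
      1 / 2 * (C p * C q) * T - 2 * scal (cst br (x 0)) (hst br A κ (x 0)) := by
    intro p q t ht
    have h1 : ∀ r ∈ Icc 0 T, HasDerivWithinAt (fun r ↦ (x r).2.2 p q)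
      (θ r * (field br A κ f (x r)).2.2 p q) (Icc 0 T) r := fun r hr ↦
      hasDerivWithinAt_pi.1 (hasDerivWithinAt_pi.1 (hx r hr).snd.snd p) q
    have hm : ∀ t ∈ Icc 0 T, HasDerivWithinAt
        (fun r ↦ 1 / 2 * (C p * C q) * r + 2 * scal (cst br (x r)) (hst br A κ (x r)))
        (1 / 2 * (C p * C q) * 1 + 2 * (θ t * S' t)) (Icc 0 T) t :=
      fun t ht ↦ ((hasDerivWithinAt_id t _).const_mul _).add ((hS t ht).1.const_mul 2)
    have h0p : ∀ p, 0 ≤ C p := fun p ↦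
      (Finset.sum_nonneg fun i _ ↦ sq_nonneg _).trans (hC t ht p)
    have hle := le_of_deriv_le h1 hm (fun s hs ↦ ?_) ht
    · obtain ⟨V, N, hV⟩ := hd.solvable
      have h3 := (isDual_of_flow hx h0 t ht).scal_nonpos hd.bracket hd.card hV (hst br A κ (x t))
      have h4 := mul_le_mul_of_nonneg_left ht.2 (mul_nonneg (h0p p) (h0p q))
      linarith
    · have hds := isDual_of_flow hx h0 s hs
      have hanti := (hds.isClosedForm hd.bracket hd.closed).codiff_anti
      have hfield : (field br A κ f (x s)).2.2 p q = -∑ i, ∑ j,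
          codiff (cst br (x s)) (hst br A κ (x s)) i j * ((x s).2.1 i (f p) * (x s).2.1 j (f q)) := by
        simp only [field]
        congr 1
        refine Finset.sum_congr rfl fun i _ ↦ Finset.sum_congr rfl fun j _ ↦ ?_
        rw [hanti j i]; ring
      have h2 := bilinear_le (codiff (cst br (x s)) (hst br A κ (x s)))
        (fun i ↦ (x s).2.1 i (f p)) (fun i ↦ (x s).2.1 i (f q))
      rw [← hfield] at h2
      have hP : 0 ≤ ∑ i, ∑ j, speed (cst br (x s)) (hst br A κ (x s)) i j ^ 2 :=
        Finset.sum_nonneg fun i _ ↦ Finset.sum_nonneg fun i _ ↦ sq_nonneg _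
      have h3 := mul_le_mul (hC s hs p) (hC s hs q) (Finset.sum_nonneg fun i _ ↦ sq_nonneg _)
        (h0p p)
      have h4 : (field br A κ f (x s)).2.2 p q ≤ 2 * S' s + 1 / 2 * (C p * C q) := by
        linarith [(hS s hs).2]
      have h5 := mul_le_mul_of_nonneg_left h4 (hθ s).1
      have h6 := mul_le_of_le_one_left (mul_nonneg (h0p p) (h0p q)) (hθ s).2
      linarith
  intro t ht
  have h1 := key p q t ht
  have h2 := key q p t ht
  -- The lower bound for the component (p,q) is the upper bound for (q,p).
  rw [(isDual_of_flow hx h0 t ht).anti q p, h0.anti q p] at h2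
  have h3 := le_abs_self ((x 0).2.2 p q)
  have h4 := neg_abs_le ((x 0).2.2 p q)
  rw [abs_le]
  constructor <;> nlinarith

theorem exists_flow [FiniteDimensional ℝ E] (hd : FlowData br A κ f) (x₀ : State ι E)
    (h0 : x₀.IsDual) :
    ∃ x : ℝ → State ι E, x 0 = x₀ ∧
      (∀ t ∈ Ici (0 : ℝ), HasDerivWithinAt x (field br A κ f (x t)) (Ici 0) t) ∧
      ContDiffOn ℝ ∞ x (Ici 0) ∧ ∀ t ∈ Ici (0 : ℝ), (x t).IsDual := by
  have hR : ∀ T : ℝ, 0 < T → ∃ R : ℝ, ∀ (θ : ℝ → ℝ) (x : ℝ → State ι E),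
      (∀ t, 0 ≤ θ t ∧ θ t ≤ 1) → x 0 = x₀ →
      (∀ t ∈ Icc 0 T, HasDerivWithinAt x (θ t • field br A κ f (x t)) (Icc 0 T) t) →
      ∀ t ∈ Icc 0 T, ‖x t‖ ≤ R := by
    intro T hT
    let b := Module.finBasis ℝ E
    -- The growth factor from `sum_sq_le`; it depends on T and the initial state, but on neither θ
    -- nor the solution.
    let K := Real.exp (T - scal (cst br x₀) (hst br A κ x₀))
    let C₁ : ℝ := ∑ k, (1 + (∑ i, b.coord k (x₀.1 i) ^ 2) * K) * ‖b k‖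
    let C₂ : ℝ := ∑ k, (1 + (∑ i, x₀.2.1 i (b k) ^ 2) * K) *
      ‖LinearMap.toContinuousLinearMap (b.coord k)‖
    let C : ι → ℝ := fun p ↦ (∑ i, x₀.2.1 i (f p) ^ 2) * K
    let C₃ : ι → ι → ℝ := fun p q ↦ |x₀.2.2 p q|
        + (1 / 2 * (C p * C q) * T - 2 * scal (cst br x₀) (hst br A κ x₀))
    let R₃ : ℝ := ∑ p, ∑ q, |C₃ p q|
    refine ⟨C₁ + C₂ + R₃, fun θ x hθ hx0 hx t ht ↦ ?_⟩
    have h0' : (x 0).IsDual := hx0 ▸ h0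
    have hK : 0 ≤ K := (Real.exp_pos _).le
    have hC₁ : 0 ≤ C₁ := by positivity
    have hC₂ : 0 ≤ C₂ := by positivity
    have hR₃ : 0 ≤ R₃ := by positivity
    have hframe : ∀ (l : E →L[ℝ] ℝ), ∑ i, l ((x t).1 i) ^ 2 ≤ (∑ i, l (x₀.1 i) ^ 2) * K := by
      intro l
      have := sum_sq_le hd hx h0' hθ (a := fun r i ↦ l ((x r).1 i)) (σ := 1) (by simp)
        (fun s hs i ↦ ?_) t ht
      · rwa [hx0] at this
      · have := l.hasFDerivAt.comp_hasDerivWithinAt s (hasDeriv_frame (hx s hs) i)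
        exact this.congr_deriv (by simp)
    have hcoframe : ∀ s ∈ Icc 0 T, ∀ v, ∑ i, (x s).2.1 i v ^ 2 ≤ (∑ i, x₀.2.1 i v ^ 2) * K := by
      intro s hs v
      have := sum_sq_le hd hx h0' hθ (a := fun r i ↦ (x r).2.1 i v) (σ := -1) (by simp)
        (fun s hs i ↦ ?_) s hs
      · rwa [hx0] at this
      · simpa using hasDeriv_coframe_apply (hx s hs) i v
    -- The bound 1 + D replaces √D, to avoid square roots.
    have hsq : ∀ (a : ι → ℝ) (D : ℝ), ∑ i, a i ^ 2 ≤ D → ∀ i, |a i| ≤ 1 + D := fun a D h i ↦ by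
      have h1 : a i ^ 2 ≤ D :=
        (Finset.single_le_sum (fun i _ ↦ sq_nonneg (a i)) (Finset.mem_univ i)).trans h
      rw [abs_le]; constructor <;> nlinarith
    refine norm_prod_le_iff.2 ⟨?_, norm_prod_le_iff.2 ⟨?_, ?_⟩⟩
    · refine (pi_norm_le_iff_of_nonneg (by positivity)).2 fun i ↦ ?_
      have h1 : ‖(x t).1 i‖ ≤ C₁ := by
        conv_lhs => rw [← b.sum_repr ((x t).1 i)]
        refine (norm_sum_le _ _).trans (Finset.sum_le_sum fun k _ ↦ ?_)
        rw [norm_smul]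
        refine mul_le_mul_of_nonneg_right ?_ (norm_nonneg _)
        exact hsq _ _ (hframe (LinearMap.toContinuousLinearMap (b.coord k))) i
      linarith
    · refine (pi_norm_le_iff_of_nonneg (by positivity)).2 fun i ↦ ?_
      have h1 : ‖(x t).2.1 i‖ ≤ C₂ := by
        have e : (x t).2.1 i = ∑ k, (x t).2.1 i (b k) • LinearMap.toContinuousLinearMap (b.coord k) := by
          ext v
          conv_lhs => rw [← b.sum_repr v, map_sum]
          rw [sum_apply]
          exact Finset.sum_congr rfl fun k _ ↦ by simp [mul_comm]
        rw [e]
        refine (norm_sum_le _ _).trans (Finset.sum_le_sum fun k _ ↦ ?_)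
        rw [norm_smul]
        exact mul_le_mul_of_nonneg_right (hsq _ _ (hcoframe t ht (b k)) i) (norm_nonneg _)
      linarith
    · refine (pi_norm_le_iff_of_nonneg (by positivity)).2 fun p ↦
        (pi_norm_le_iff_of_nonneg (by positivity)).2 fun q ↦ ?_
      have h1 := abs_form_le hd hx h0' hθ (C := C) (fun s hs p ↦ hcoframe s hs (f p)) p q t ht
      rw [hx0] at h1
      have h2 : |C₃ p q| ≤ R₃ :=
        (Finset.single_le_sum (f := fun q ↦ |C₃ p q|) (fun i _ ↦ abs_nonneg _)
          (Finset.mem_univ q)).trans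
        (Finset.single_le_sum (f := fun p ↦ ∑ q, |C₃ p q|)
          (fun i _ ↦ Finset.sum_nonneg fun i _ ↦ abs_nonneg _) (Finset.mem_univ p))
      rw [Real.norm_eq_abs]
      have h3 : |(x t).2.2 p q| ≤ C₃ p q := h1
      linarith [le_abs_self (C₃ p q)]
  obtain ⟨x, hx0, hx, hs⟩ := ODE.exists_global_solution (contDiff_field br A κ f) x₀ hR
  refine ⟨x, hx0, hx, hs, fun t ht ↦ ?_⟩
  refine isDual_of_flow (br := br) (A := A) (κ := κ) (f := f) (θ := fun _ ↦ 1) (T := t)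
    (fun s hs ↦ ?_) (hx0 ▸ h0) t ⟨ht, le_rfl⟩
  rw [one_smul]
  exact (hx s hs.1).mono Icc_subset_Ici_self

end Flow

end GRF.Frame

/-! ## Left-invariant tensors in a moving frame -/

namespace GRF

variable {E : Type*} [NormedAddCommGroup E] [NormedSpace ℝ E]

/-- A moving frame on an open set, with constant structure constants. -/
structure MovingFrame (br : E →L[ℝ] E →L[ℝ] E) (U : Set E) (Φ Ψ : E → E →L[ℝ] E) : Prop where
  isOpen : IsOpen U
  smooth : ContDiffOn ℝ ∞ Φ U
  smooth_inv : ContDiffOn ℝ ∞ Ψ U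
  left_inv : ∀ y ∈ U, ∀ v, Ψ y (Φ y v) = v
  right_inv : ∀ y ∈ U, ∀ v, Φ y (Ψ y v) = v
  bracket : ∀ y ∈ U, ∀ v w,
    fderiv ℝ Φ y (Φ y v) w - fderiv ℝ Φ y (Φ y w) v = Φ y (br v w)

namespace MovingFrame

section Calculus

lemma fderiv_clm_apply_const {F G : Type*} [NormedAddCommGroup F] [NormedSpace ℝ F]
    [NormedAddCommGroup G] [NormedSpace ℝ G] {c : E → F →L[ℝ] G} {y : E}
    (hc : DifferentiableAt ℝ c y) (A : E) (v : F) :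
    fderiv ℝ (fun z ↦ c z v) y A = fderiv ℝ c y A v := by
  rw [fderiv_clm_apply hc (differentiableAt_const v)]
  simp

lemma hasFDerivAt_bilin {c : E → E →L[ℝ] E →L[ℝ] ℝ} {u v : E → E} {y : E}
    (hc : DifferentiableAt ℝ c y) (hu : DifferentiableAt ℝ u y) (hv : DifferentiableAt ℝ v y)
    (A : E) : fderiv ℝ (fun z ↦ c z (u z) (v z)) y A =
      fderiv ℝ c y A (u y) (v y) + c y (fderiv ℝ u y A) (v y) + c y (u y) (fderiv ℝ v y A) := by
  rw [fderiv_clm_apply (hc.clm_apply hu) hv, fderiv_clm_apply hc hu]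
  simp
  ring

/-- Symmetry of second derivatives. -/
lemma fderiv_fderiv_symm {F : Type*} [NormedAddCommGroup F] [NormedSpace ℝ F] {f : E → F} {y : E}
    (hf : ContDiffAt ℝ ∞ f y) (u v : E) :
    fderiv ℝ (fun z ↦ fderiv ℝ f z v) y u = fderiv ℝ (fun z ↦ fderiv ℝ f z u) y v := by
  have h1 : DifferentiableAt ℝ (fderiv ℝ f) y :=
    (hf.fderiv_right (m := 1) (by rw [one_add_one_eq_two]; exact ENat.LEInfty.out)).differentiableAt (by simp)
  rw [fderiv_clm_apply_const h1, fderiv_clm_apply_const h1]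
  exact hf.isSymmSndFDerivAt (by simpa using ENat.LEInfty.out) u v

end Calculus

variable {br : E →L[ℝ] E →L[ℝ] E} {U : Set E} {Φ Ψ : E → E →L[ℝ] E}
  (hΦ : MovingFrame br U Φ Ψ) {y : E} (hy : y ∈ U)

include hΦ hy

lemma contDiffAt : ContDiffAt ℝ ∞ Φ y := hΦ.smooth.contDiffAt (hΦ.isOpen.mem_nhds hy)

lemma contDiffAt_inv : ContDiffAt ℝ ∞ Ψ y := hΦ.smooth_inv.contDiffAt (hΦ.isOpen.mem_nhds hy)

lemma differentiableAt : DifferentiableAt ℝ Φ y := (hΦ.contDiffAt hy).differentiableAt (by simp)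

lemma differentiableAt_inv : DifferentiableAt ℝ Ψ y :=
  (hΦ.contDiffAt_inv hy).differentiableAt (by simp)

lemma fderiv_inv_apply (A w : E) :
    fderiv ℝ Ψ y A w = -Ψ y (fderiv ℝ Φ y A (Ψ y w)) := by
  have h1 : (fun z ↦ Φ z (Ψ z w)) =ᶠ[𝓝 y] fun _ ↦ w :=
    Filter.eventually_of_mem (hΦ.isOpen.mem_nhds hy) fun z hz ↦ hΦ.right_inv z hz w
  have h2 := congrArg (fun L : E →L[ℝ] E ↦ L A) h1.fderiv_eq
  have hΨw : DifferentiableAt ℝ (fun z ↦ Ψ z w) y :=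
    (hΦ.differentiableAt_inv hy).clm_apply (differentiableAt_const w)
  rw [fderiv_clm_apply (hΦ.differentiableAt hy) hΨw] at h2
  simp only [add_apply, ContinuousLinearMap.coe_comp, Function.comp_apply,
    ContinuousLinearMap.flip_apply, fderiv_fun_const, Pi.zero_apply, zero_apply] at h2
  rw [fderiv_clm_apply_const (hΦ.differentiableAt_inv hy)] at h2
  have h3 := congrArg (Ψ y) h2
  rw [map_add, hΦ.left_inv y hy, map_zero] at h3
  exact eq_neg_of_add_eq_zero_left h3

/-- A bilinear form with constant coefficients. -/
lemma fderiv_metric {γ : E → E →L[ℝ] E →L[ℝ] ℝ} (hγ : ContDiffOn ℝ ∞ γ U)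
    {q : E →L[ℝ] E →L[ℝ] ℝ} (hq : ∀ z ∈ U, ∀ v w, γ z (Φ z v) (Φ z w) = q v w) (A b w : E) :
    fderiv ℝ γ y A (Φ y b) (Φ y w) =
      -γ y (fderiv ℝ Φ y A b) (Φ y w) - γ y (Φ y b) (fderiv ℝ Φ y A w) := by
  have h1 : (fun z ↦ γ z (Φ z b) (Φ z w)) =ᶠ[𝓝 y] fun _ ↦ q b w :=
    Filter.eventually_of_mem (hΦ.isOpen.mem_nhds hy) fun z hz ↦ hq z hz b w
  have h2 := congrArg (fun L : E →L[ℝ] ℝ ↦ L A) h1.fderiv_eq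
  have hd := hΦ.differentiableAt hy
  rw [hasFDerivAt_bilin ((hγ.contDiffAt (hΦ.isOpen.mem_nhds hy)).differentiableAt (by simp))
    (hd.clm_apply (differentiableAt_const b)) (hd.clm_apply (differentiableAt_const w)),
    fderiv_clm_apply_const hd, fderiv_clm_apply_const hd] at h2
  simp only [fderiv_fun_const, Pi.zero_apply, zero_apply] at h2
  linarith

/-- A form with constant coefficients. -/
lemma fderiv_form {n : ℕ} {η : E → E [⋀^Fin n]→L[ℝ] ℝ} (hη : ContDiffOn ℝ ∞ η U)
    {q : (Fin n → E) → ℝ} (hq : ∀ z ∈ U, ∀ v, η z (fun i ↦ Φ z (v i)) = q v) (A : E) (v : Fin n → E) :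
    fderiv ℝ η y A (fun i ↦ Φ y (v i)) =
      -∑ i, η y (Function.update (fun i ↦ Φ y (v i)) i (fderiv ℝ Φ y A (v i))) := by
  have h1 : (fun z ↦ η z (fun i ↦ Φ z (v i))) =ᶠ[𝓝 y] fun _ ↦ q v :=
    Filter.eventually_of_mem (hΦ.isOpen.mem_nhds hy) fun z hz ↦ hq z hz v
  have h2 := congrArg (fun L : E →L[ℝ] ℝ ↦ L A) h1.fderiv_eq
  have hd := hΦ.differentiableAt hy
  rw [fderiv_continuousAlternatingMap_apply_apply
    ((hη.contDiffAt (hΦ.isOpen.mem_nhds hy)).differentiableAt (by simp))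
    (fun i ↦ hd.clm_apply (differentiableAt_const (v i)))] at h2
  simp only [fderiv_fun_const, Pi.zero_apply, zero_apply] at h2
  simp only [fderiv_clm_apply_const hd] at h2
  linarith

lemma metric_isInvertible [FiniteDimensional ℝ E] {γ : E → E →L[ℝ] E →L[ℝ] ℝ}
    {q : E →L[ℝ] E →L[ℝ] ℝ} (hq : ∀ z ∈ U, ∀ v w, γ z (Φ z v) (Φ z w) = q v w)
    (hpos : ∀ v, v ≠ 0 → 0 < q v v) : (γ y).IsInvertible := by
  have hinj : Function.Injective (γ y) := by
    rw [injective_iff_map_eq_zero]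
    intro v hv
    by_contra h0
    have h1 := hpos (Ψ y v) fun h ↦ h0 (by rw [← hΦ.right_inv y hy v, h, map_zero])
    rw [← hq y hy, hΦ.right_inv y hy, hv] at h1
    simp at h1
  have hdim : Module.finrank ℝ E = Module.finrank ℝ (E →L[ℝ] ℝ) := by
    rw [← (LinearMap.toContinuousLinearMap (𝕜 := ℝ) (E := E) (F' := ℝ)).finrank_eq]
    exact Subspace.dual_finrank_eq.symm
  let e : E ≃ₗ[ℝ] (E →L[ℝ] ℝ) := LinearEquiv.ofInjectiveOfFinrankEq (γ y).toLinearMap hinj hdim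
  refine ⟨e.toContinuousLinearEquiv, ?_⟩
  ext v w
  rfl

/-- The covariant derivative of the field Φw along Φa is DΦ(Φa)w + Γ(Φa,Φw), and for invariant
fields it is Φ(∇_a w), with ∇ given by Koszul's formula. The derivatives of γ are removed by
differentiating the constant γ(Φv,Φw). -/
lemma christoffel_frame [FiniteDimensional ℝ E] {γ : E → E →L[ℝ] E →L[ℝ] ℝ}
    (hγ : ContDiffOn ℝ ∞ γ U) {q : E →L[ℝ] E →L[ℝ] ℝ}
    (hq : ∀ z ∈ U, ∀ v w, γ z (Φ z v) (Φ z w) = q v w) (hsymm : ∀ v w, q v w = q w v)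
    (hpos : ∀ v, v ≠ 0 → 0 < q v v) (hanti : ∀ u v, br u v = -br v u)
    {nab : E →L[ℝ] E →L[ℝ] E} (hnab : ∀ a v w,
      2 * q (nab a v) w = q (br a v) w - q (br v w) a + q (br w a) v) (a v : E) :
    LocalGeom.christoffel γ y (Φ y a) (Φ y v) = Φ y (nab a v) - fderiv ℝ Φ y (Φ y a) v := by
  have hsymm' : ∀ v w, γ y v w = γ y w v := fun v w ↦ by
    rw [← hΦ.right_inv y hy v, ← hΦ.right_inv y hy w, hq y hy, hq y hy, hsymm]
  have hinv := hΦ.metric_isInvertible hy hq hpos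
  unfold LocalGeom.christoffel
  rw [hinv.inverse_apply_eq]
  ext w
  obtain ⟨w, rfl⟩ : ∃ w', w = Φ y w' := ⟨Ψ y w, (hΦ.right_inv y hy w).symm⟩
  have hm := hΦ.fderiv_metric hy hγ hq
  have hb : ∀ v w, fderiv ℝ Φ y (Φ y v) w = fderiv ℝ Φ y (Φ y w) v + Φ y (br v w) := fun v w ↦ by
    rw [← hΦ.bracket y hy]; abel
  simp only [smul_apply, sub_apply, add_apply, ContinuousLinearMap.flip_apply, smul_eq_mul, hm,
    map_sub, hq y hy]
  -- The order of differentiation is normalized with the bracket relation. The derivatives of Φ then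
  -- cancel by the symmetry of γ, and the brackets assemble into Koszul's formula.
  rw [hb w a, hb w v, hb v a]
  simp only [map_add, add_apply, hq y hy]
  have e1 := hnab a v w
  have e2 : q (br v a) w = -q (br a v) w := by rw [hanti v a]; simp
  have e3 : q (br w v) a = -q (br v w) a := by rw [hanti w v]; simp
  have e4 := hsymm a (br w v)
  have e5 := hsymm' (Φ y v) (fderiv ℝ Φ y (Φ y a) w)
  have e6 := hsymm' (Φ y a) (fderiv ℝ Φ y (Φ y v) w)
  rw [e4]
  linarith

/-- Substitute the Christoffel symbols in the frame. The second derivatives of Φ drop out by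
symmetry, and the difference of its first derivatives is Φ[a,b], the source of the last term. -/
lemma riemann_frame [FiniteDimensional ℝ E] {γ : E → E →L[ℝ] E →L[ℝ] ℝ}
    (hγ : ContDiffOn ℝ ∞ γ U) {q : E →L[ℝ] E →L[ℝ] ℝ}
    (hq : ∀ z ∈ U, ∀ v w, γ z (Φ z v) (Φ z w) = q v w) (hsymm : ∀ v w, q v w = q w v)
    (hpos : ∀ v, v ≠ 0 → 0 < q v v) (hanti : ∀ u v, br u v = -br v u)
    {nab : E →L[ℝ] E →L[ℝ] E} (hnab : ∀ a v w,
      2 * q (nab a v) w = q (br a v) w - q (br v w) a + q (br w a) v) (a b c : E) :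
    LocalGeom.riemann γ y (Φ y a) (Φ y b) (Φ y c) =
      Φ y (nab a (nab b c) - nab b (nab a c) - nab (br a b) c) := by
  have hdΦ := hΦ.differentiableAt hy
  have hdΨ := hΦ.differentiableAt_inv hy
  have hd2 : DifferentiableAt ℝ (fderiv ℝ Φ) y :=
    ((hΦ.contDiffAt hy).fderiv_right (m := 1)
      (by rw [one_add_one_eq_two]; exact ENat.LEInfty.out)).differentiableAt (by simp)
  have hchr : ∀ z ∈ U, ∀ v w, LocalGeom.christoffel γ z v w =
      Φ z (nab (Ψ z v) (Ψ z w)) - fderiv ℝ Φ z v (Ψ z w) := fun z hz v w ↦ by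
    have := hΦ.christoffel_frame hz hγ hq hsymm hpos hanti hnab (Ψ z v) (Ψ z w)
    rwa [hΦ.right_inv z hz, hΦ.right_inv z hz] at this
  have hΨv : ∀ v, DifferentiableAt ℝ (fun z ↦ Ψ z v) y := fun v ↦
    hdΨ.clm_apply (differentiableAt_const v)
  have hdN : ∀ v, DifferentiableAt ℝ (fun z ↦ fderiv ℝ Φ z v) y := fun v ↦
    hd2.clm_apply (differentiableAt_const v)
  have hder : ∀ u v w, fderiv ℝ (fun z ↦ LocalGeom.christoffel γ z v w) y u =
      fderiv ℝ Φ y u (nab (Ψ y v) (Ψ y w))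
      + Φ y (nab (fderiv ℝ Ψ y u v) (Ψ y w) + nab (Ψ y v) (fderiv ℝ Ψ y u w))
      - (fderiv ℝ (fun z ↦ fderiv ℝ Φ z v) y u (Ψ y w)
        + fderiv ℝ Φ y v (fderiv ℝ Ψ y u w)) := by
    intro u v w
    have h1 : (fun z ↦ LocalGeom.christoffel γ z v w) =ᶠ[𝓝 y] fun z ↦
      Φ z (nab (Ψ z v) (Ψ z w)) - fderiv ℝ Φ z v (Ψ z w) :=
      Filter.eventually_of_mem (hΦ.isOpen.mem_nhds hy) fun z hz ↦ hchr z hz v w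
    have hnab1 : DifferentiableAt ℝ (fun z ↦ nab (Ψ z v)) y :=
      nab.differentiableAt.comp y (hΨv v)
    have hnab1' : fderiv ℝ (fun z ↦ nab (Ψ z v)) y u = nab (fderiv ℝ Ψ y u v) := by
      have := nab.hasFDerivAt.comp y (hΨv v).hasFDerivAt
      rw [show (fun z ↦ nab (Ψ z v)) = nab ∘ fun z ↦ Ψ z v from rfl, this.fderiv]
      simp [fderiv_clm_apply_const hdΨ]
    have hnab2 : DifferentiableAt ℝ (fun z ↦ nab (Ψ z v) (Ψ z w)) y := hnab1.clm_apply (hΨv w)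
    rw [h1.fderiv_eq, fderiv_fun_sub (hdΦ.clm_apply hnab2) ((hdN v).clm_apply (hΨv w)),
      fderiv_clm_apply hdΦ hnab2, fderiv_clm_apply hnab1 (hΨv w),
      fderiv_clm_apply (hdN v) (hΨv w)]
    simp only [sub_apply, add_apply, ContinuousLinearMap.coe_comp, Function.comp_apply,
      ContinuousLinearMap.flip_apply, hnab1', fderiv_clm_apply_const hdΨ, map_add]
    abel
  have hsym2 := fderiv_fderiv_symm (hΦ.contDiffAt hy) (Φ y a) (Φ y b)
  have hb : fderiv ℝ Φ y (Φ y a) b = fderiv ℝ Φ y (Φ y b) a + Φ y (br a b) := by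
    rw [← hΦ.bracket y hy]; abel
  unfold LocalGeom.riemann
  rw [hder, hder, hsym2, hchr y hy (Φ y b) (Φ y c), hchr y hy (Φ y a) (Φ y c), hchr y hy, hchr y hy]
  simp only [hΦ.fderiv_inv_apply hy, hΦ.left_inv y hy, map_add, map_sub, map_neg, neg_apply,
    add_apply, hb]
  abel

end MovingFrame

end GRF

/-! ### Curvature and exterior calculus in an orthonormal invariant frame -/

namespace GRF

variable {E : Type*} [NormedAddCommGroup E] [NormedSpace ℝ E]

section TriLin

/-- A `3`-form as a trilinear map. -/
def triLin (η : E [⋀^Fin 3]→L[ℝ] ℝ) : E →ₗ[ℝ] E →ₗ[ℝ] E →ₗ[ℝ] ℝ :=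
  LinearMap.mk₂ ℝ (fun u v ↦
    { toFun := fun w ↦ η ![u, v, w]
      map_add' := fun w w' ↦ by
        have h := η.toMultilinearMap.map_update_add ![u, v, w] 2 w w'
        have e : ∀ z, Function.update ![u, v, w] 2 z = ![u, v, z] := fun z ↦ by
          ext i; fin_cases i <;> rfl
        simp only [e] at h; exact h
      map_smul' := fun a w ↦ by
        have h := η.toMultilinearMap.map_update_smul ![u, v, w] 2 a w
        have e : ∀ z, Function.update ![u, v, w] 2 z = ![u, v, z] := fun z ↦ by
          ext i; fin_cases i <;> rfl
        simp only [e] at h; exact h })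
    (fun u u' v ↦ by
      ext w
      have h := η.toMultilinearMap.map_update_add ![u, v, w] 0 u u'
      have e : ∀ z, Function.update ![u, v, w] 0 z = ![z, v, w] := fun z ↦ by
        ext i; fin_cases i <;> rfl
      simp only [e] at h; exact h)
    (fun a u v ↦ by
      ext w
      have h := η.toMultilinearMap.map_update_smul ![u, v, w] 0 a u
      have e : ∀ z, Function.update ![u, v, w] 0 z = ![z, v, w] := fun z ↦ by
        ext i; fin_cases i <;> rfl
      simp only [e] at h; exact h)
    (fun u v v' ↦ by
      ext w
      have h := η.toMultilinearMap.map_update_add ![u, v, w] 1 v v'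
      have e : ∀ z, Function.update ![u, v, w] 1 z = ![u, z, w] := fun z ↦ by
        ext i; fin_cases i <;> rfl
      simp only [e] at h; exact h)
    (fun a u v ↦ by
      ext w
      have h := η.toMultilinearMap.map_update_smul ![u, v, w] 1 a v
      have e : ∀ z, Function.update ![u, v, w] 1 z = ![u, z, w] := fun z ↦ by
        ext i; fin_cases i <;> rfl
      simp only [e] at h; exact h)

lemma triLin_apply (η : E [⋀^Fin 3]→L[ℝ] ℝ) (u v w : E) : triLin η u v w = η ![u, v, w] := rfl

lemma triLin_anti₁ (η : E [⋀^Fin 3]→L[ℝ] ℝ) (u v w : E) : triLin η u v w = -triLin η v u w := by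
  have h := η.toAlternatingMap.map_swap ![v, u, w] (show (0 : Fin 3) ≠ 1 by decide)
  have e : ![v, u, w] ∘ Equiv.swap (0 : Fin 3) 1 = ![u, v, w] := by
    ext i; fin_cases i <;> rfl
  rw [e] at h
  exact h

lemma triLin_anti₂ (η : E [⋀^Fin 3]→L[ℝ] ℝ) (u v w : E) : triLin η u v w = -triLin η u w v := by
  have h := η.toAlternatingMap.map_swap ![u, w, v] (show (1 : Fin 3) ≠ 2 by decide)
  have e : ![u, w, v] ∘ Equiv.swap (1 : Fin 3) 2 = ![u, v, w] := by
    ext i; fin_cases i <;> rfl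
  rw [e] at h
  exact h

end TriLin

variable {ι : Type*} [Fintype ι] [DecidableEq ι]

/-- An orthonormal frame of a scalar product, with the dual frame. -/
structure IsONFrame (q : E →L[ℝ] E →L[ℝ] ℝ) (e : ι → E) (ε : ι → E →L[ℝ] ℝ) : Prop where
  complete : ∀ v, ∑ i, ε i v • e i = v
  dual : ∀ i j, ε i (e j) = if i = j then 1 else 0
  metric : ∀ v w, q v w = ∑ i, ε i v * ε i w

namespace IsONFrame

variable {q : E →L[ℝ] E →L[ℝ] ℝ} {e : ι → E} {ε : ι → E →L[ℝ] ℝ} (he : IsONFrame q e ε)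

include he

lemma symm (v w : E) : q v w = q w v := by
  rw [he.metric, he.metric]; simp only [mul_comm]

lemma pos (v : E) (hv : v ≠ 0) : 0 < q v v := by
  rw [he.metric]
  refine lt_of_le_of_ne (Finset.sum_nonneg fun i _ ↦ mul_self_nonneg _) fun h ↦ hv ?_
  have h1 := (Finset.sum_eq_zero_iff_of_nonneg fun i _ ↦ mul_self_nonneg _).1 h.symm
  rw [← he.complete v]
  exact Finset.sum_eq_zero fun i hi ↦ by rw [mul_self_eq_zero.1 (h1 i hi), zero_smul]

lemma apply_frame (i : ι) (w : E) : q (e i) w = ε i w := by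
  rw [he.metric]; simp [he.dual]

lemma expand (l : E →ₗ[ℝ] ℝ) (v : E) : l v = ∑ i, ε i v * l (e i) := by
  conv_lhs => rw [← he.complete v]
  simp

lemma expand₂ (l : E →ₗ[ℝ] E →ₗ[ℝ] ℝ) (v w : E) :
    l v w = ∑ i, ∑ j, l (e i) (e j) * (ε i v * ε j w) := by
  rw [he.expand (l v) w]
  have : ∀ j, l v (e j) = ∑ i, ε i v * l (e i) (e j) := fun j ↦ he.expand (l.flip (e j)) v
  simp only [this, Finset.mul_sum]
  rw [Finset.sum_comm]
  exact Finset.sum_congr rfl fun i _ ↦ Finset.sum_congr rfl fun j _ ↦ by ring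

end IsONFrame

/-- The coefficients of the Levi-Civita connection in an orthonormal frame. -/
def connCoeff (c : ι → ι → ι → ℝ) (i j k : ι) : ℝ := 1 / 2 * (c i j k - c j k i + c k i j)

/-- The Levi-Civita connection of a left-invariant metric. -/
def nabla (br : E →L[ℝ] E →L[ℝ] E) (e : ι → E) (ε : ι → E →L[ℝ] ℝ) : E →L[ℝ] E →L[ℝ] E :=
  ∑ i, ∑ j, ∑ k, (ε i).smulRight ((ε j).smulRight
    (connCoeff (fun i j k ↦ ε k (br (e i) (e j))) i j k • e k))

namespace IsONFrame

variable {q : E →L[ℝ] E →L[ℝ] ℝ} {e : ι → E} {ε : ι → E →L[ℝ] ℝ} (he : IsONFrame q e ε)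
  (br : E →L[ℝ] E →L[ℝ] E)

omit [DecidableEq ι] in
lemma nabla_apply (a v : E) : nabla br e ε a v = ∑ i, ∑ j, ∑ k,
    (ε i a * ε j v * connCoeff (fun i j k ↦ ε k (br (e i) (e j))) i j k) • e k := by
  simp [nabla, smul_smul, mul_assoc]

include he

lemma nabla_frame (i j : ι) : nabla br e ε (e i) (e j) =
    ∑ k, connCoeff (fun i j k ↦ ε k (br (e i) (e j))) i j k • e k := by
  rw [nabla_apply]
  simp [he.dual, ite_smul, Finset.sum_ite_irrel, ite_mul]

/-- Each term is expanded in the frame; renaming indices turns the right side into twice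
`connCoeff`. -/
lemma koszul (a v w : E) : 2 * q (nabla br e ε a v) w =
    q (br a v) w - q (br v w) a + q (br w a) v := by
  have hq : ∀ a v w, q (br a v) w =
      ∑ i, ∑ j, ∑ k, ε i a * ε j v * ε k w * ε k (br (e i) (e j)) := fun a v w ↦ by
    have h1 : ∀ k, ε k (br a v) = ∑ i, ∑ j, ε k (br (e i) (e j)) * (ε i a * ε j v) := fun k ↦
      he.expand₂ (LinearMap.mk₂ ℝ (fun a v ↦ ε k (br a v)) (by simp) (by simp) (by simp) (by simp)) a v
    rw [he.metric]
    simp only [h1, Finset.sum_mul]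
    rw [Finset.sum_comm]
    refine Finset.sum_congr rfl fun i _ ↦ ?_
    rw [Finset.sum_comm]
    exact Finset.sum_congr rfl fun j _ ↦ Finset.sum_congr rfl fun k _ ↦ by ring
  have h2 : q (br v w) a = ∑ i, ∑ j, ∑ k, ε i a * ε j v * ε k w * ε i (br (e j) (e k)) := by
    rw [hq]
    refine ((Frame.sum_perm_132 _).trans (Frame.sum_perm_213 _)).trans ?_
    exact Finset.sum_congr rfl fun i _ ↦ Finset.sum_congr rfl fun j _ ↦
      Finset.sum_congr rfl fun k _ ↦ by ring
  have h3 : q (br w a) v = ∑ i, ∑ j, ∑ k, ε i a * ε j v * ε k w * ε j (br (e k) (e i)) := by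
    rw [hq]
    refine ((Frame.sum_perm_213 _).trans (Frame.sum_perm_132 _)).trans ?_
    exact Finset.sum_congr rfl fun i _ ↦ Finset.sum_congr rfl fun j _ ↦
      Finset.sum_congr rfl fun k _ ↦ by ring
  rw [nabla_apply, hq a v w, h2, h3]
  simp only [map_sum, map_smul, sum_apply, smul_apply, smul_eq_mul, he.apply_frame,
    Finset.mul_sum, ← Finset.sum_sub_distrib, ← Finset.sum_add_distrib, connCoeff]
  exact Finset.sum_congr rfl fun i _ ↦ Finset.sum_congr rfl fun j _ ↦
    Finset.sum_congr rfl fun k _ ↦ by ring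

end IsONFrame

namespace MovingFrame

variable [FiniteDimensional ℝ E] {br : E →L[ℝ] E →L[ℝ] E} {U : Set E} {Φ Ψ : E → E →L[ℝ] E}
  {q : E →L[ℝ] E →L[ℝ] ℝ} {e : ι → E} {ε : ι → E →L[ℝ] ℝ} {γ : E → E →L[ℝ] E →L[ℝ] ℝ}

/-- A metric contraction may be computed in any basis. The frame coefficients of ♯bⁱ are the
coordinates bⁱ(Φ eₖ), and summing over i reassembles eₖ. -/
lemma sum_sharpDual (hΦ : MovingFrame br U Φ Ψ) {y : E} (hy : y ∈ U) (he : IsONFrame q e ε)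
    (hq : ∀ z ∈ U, ∀ v w, γ z (Φ z v) (Φ z w) = q v w) (C : E →ₗ[ℝ] E →ₗ[ℝ] ℝ) :
    ∑ i, C (Ψ y (Module.finBasis ℝ E i)) (Ψ y (LocalGeom.sharpDual (γ y) i)) =
      ∑ k, C (e k) (e k) := by
  have h1 : ∀ i k, ε k (Ψ y (LocalGeom.sharpDual (γ y) i)) =
      (Module.finBasis ℝ E).coord i (Φ y (e k)) := fun i k ↦ by
    rw [← he.apply_frame, he.symm, ← hq y hy, hΦ.right_inv y hy, LocalGeom.sharpDual,
      (hΦ.metric_isInvertible hy hq he.pos).self_apply_inverse]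
    rfl
  have h2 : ∀ i, C (Ψ y (Module.finBasis ℝ E i)) (Ψ y (LocalGeom.sharpDual (γ y) i)) =
      ∑ k, (Module.finBasis ℝ E).coord i (Φ y (e k)) * C (Ψ y (Module.finBasis ℝ E i)) (e k) :=
    fun i ↦ by
      rw [he.expand (C _)]
      simp only [h1]
  simp only [h2]
  rw [Finset.sum_comm]
  refine Finset.sum_congr rfl fun k _ ↦ ?_
  have h3 : Ψ y (∑ i, (Module.finBasis ℝ E).coord i (Φ y (e k)) • Module.finBasis ℝ E i) = e k := by
    rw [show ∑ i, (Module.finBasis ℝ E).coord i (Φ y (e k)) • Module.finBasis ℝ E i = Φ y (e k) from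
      (Module.finBasis ℝ E).sum_repr _, hΦ.left_inv y hy]
  rw [show C (e k) (e k) = C (Ψ y (∑ i, (Module.finBasis ℝ E).coord i (Φ y (e k)) •
    Module.finBasis ℝ E i)) (e k) by rw [h3]]
  simp only [map_sum, map_smul, LinearMap.sum_apply, LinearMap.smul_apply, smul_eq_mul]

/-- The trace of Φ l Φ⁻¹ in the coordinate basis is the trace of l in the frame. -/
lemma sum_coord (hΦ : MovingFrame br U Φ Ψ) {y : E} (hy : y ∈ U) (he : IsONFrame q e ε)
    (l : E →ₗ[ℝ] E) :
    ∑ i, (Module.finBasis ℝ E).coord i (Φ y (l (Ψ y (Module.finBasis ℝ E i)))) =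
      ∑ k, ε k (l (e k)) := by
  have h1 : ∀ i, (Module.finBasis ℝ E).coord i (Φ y (l (Ψ y (Module.finBasis ℝ E i)))) =
      ∑ k, (Module.finBasis ℝ E).coord i (Φ y (e k)) * ε k (l (Ψ y (Module.finBasis ℝ E i))) :=
    fun i ↦ by
      conv_lhs => rw [← he.complete (l (Ψ y (Module.finBasis ℝ E i)))]
      simp [mul_comm]
  simp only [h1]
  rw [Finset.sum_comm]
  refine Finset.sum_congr rfl fun k _ ↦ ?_
  have h3 : Ψ y (∑ i, (Module.finBasis ℝ E).coord i (Φ y (e k)) • Module.finBasis ℝ E i) = e k := by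
    rw [show ∑ i, (Module.finBasis ℝ E).coord i (Φ y (e k)) • Module.finBasis ℝ E i = Φ y (e k) from
      (Module.finBasis ℝ E).sum_repr _, hΦ.left_inv y hy]
  conv_rhs => rw [← h3]
  simp only [map_sum, map_smul, smul_eq_mul]

theorem formSq_frame (hΦ : MovingFrame br U Φ Ψ) {y : E} (hy : y ∈ U) (he : IsONFrame q e ε)
    (hq : ∀ z ∈ U, ∀ v w, γ z (Φ z v) (Φ z w) = q v w) {η : E → E [⋀^Fin 3]→L[ℝ] ℝ}
    {p : E [⋀^Fin 3]→L[ℝ] ℝ} (hp : ∀ z ∈ U, ∀ v, η z (fun i ↦ Φ z (v i)) = p v) (u v : E) :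
    LocalGeom.formSq (γ y) (η y) (Φ y u) (Φ y v) =
      ∑ i, ∑ j, Frame.hSq (fun i j k ↦ triLin p (e i) (e j) (e k)) i j * (ε i u * ε j v) := by
  have h0 : ∀ u v w, η y ![Φ y u, v, w] = triLin p u (Ψ y v) (Ψ y w) := fun u v w ↦ by
    rw [triLin_apply, ← hp y hy]
    congr 1
    ext i; fin_cases i <;> simp [hΦ.right_inv y hy]
  unfold LocalGeom.formSq
  simp only [h0]
  have h1 : ∀ i, ∑ j, triLin p u (Ψ y (Module.finBasis ℝ E i)) (Ψ y (Module.finBasis ℝ E j)) *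
      triLin p v (Ψ y (LocalGeom.sharpDual (γ y) i)) (Ψ y (LocalGeom.sharpDual (γ y) j)) =
      ∑ k, triLin p u (Ψ y (Module.finBasis ℝ E i)) (e k) *
        triLin p v (Ψ y (LocalGeom.sharpDual (γ y) i)) (e k) := fun i ↦
    hΦ.sum_sharpDual hy he hq ((triLin p u (Ψ y (Module.finBasis ℝ E i))).smulRight
      (triLin p v (Ψ y (LocalGeom.sharpDual (γ y) i))))
  simp only [h1]
  rw [Finset.sum_comm]
  have h2 : ∀ k, ∑ i, triLin p u (Ψ y (Module.finBasis ℝ E i)) (e k) *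
        triLin p v (Ψ y (LocalGeom.sharpDual (γ y) i)) (e k) =
      ∑ l, triLin p u (e l) (e k) * triLin p v (e l) (e k) := fun k ↦
    hΦ.sum_sharpDual hy he hq (((triLin p u).flip (e k)).smulRight ((triLin p v).flip (e k)))
  simp only [h2]
  rw [Finset.sum_comm]
  have h3 := he.expand₂ (LinearMap.mk₂ ℝ
    (fun u v ↦ ∑ l, ∑ k, triLin p u (e l) (e k) * triLin p v (e l) (e k))
    (fun a b c ↦ by simp [add_mul, Finset.sum_add_distrib])
    (fun a b c ↦ by simp [mul_assoc, Finset.mul_sum])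
    (fun a b c ↦ by simp [mul_add, Finset.sum_add_distrib])
    (fun a b c ↦ by simp [mul_left_comm, Finset.mul_sum])) u v
  exact h3

omit [DecidableEq ι] in
lemma sum_eq_zero_of_antisymm {F : ι → ι → ℝ} (hF : ∀ k l, F k l + F l k = 0) :
    ∑ k, ∑ l, F k l = 0 := by
  have h1 : ∑ k, ∑ l, F k l = ∑ k, ∑ l, F l k := Finset.sum_comm
  have h2 : ∑ k, ∑ l, F k l + ∑ k, ∑ l, F l k = 0 := by
    simp [← Finset.sum_add_distrib, hF]
  linarith

omit [DecidableEq ι] in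
-- The trace Σₖ of the k-component of ∇_{eₖ} e_l is −`tau` l, which yields −S(ad Z), as `tau`
-- vanishes on [e_a,e_b]. The remaining quadratic terms agree with `ricStar` only after summation.
lemma ricci_coeff {c : ι → ι → ι → ℝ} (hc : Frame.IsLie c) (a b : ι) :
    (∑ k, ∑ l, (connCoeff c a b l * connCoeff c k l k - connCoeff c k b l * connCoeff c a l k
      - c k a l * connCoeff c l b k)) = Frame.ricStar c a b - Frame.symAd c a b := by
  have hc' := hc.anti
  have hd : ∀ i k, c i i k = 0 := fun i k ↦ by linarith [hc' i i k]
  -- The difference is not zero term by term, but it is antisymmetric in k and l.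
  have h0 := sum_eq_zero_of_antisymm (F := fun k l ↦ connCoeff c k b l * connCoeff c a l k
      + c k a l * connCoeff c l b k + (-(1 / 2) * (c a k l * c b k l) + 1 / 4 * (c k l a * c k l b)
        - 1 / 2 * (c a k l * c b l k))) fun k l ↦ by
    simp only [connCoeff]
    rw [hc' k a l, hc' l a k, hc' k b l, hc' l b k, hc' l k a, hc' l k b]
    ring
  have h3 : ∑ k, ∑ l, connCoeff c a b l * connCoeff c k l k = -Frame.symAd c a b := by
    have h4 : ∀ k l, connCoeff c k l k = -c l k k := fun k l ↦ by
      simp only [connCoeff]; rw [hd, hc' k l k]; ring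
    have h5 := hc.tau_bracket a b
    simp only [h4, Frame.symAd]
    rw [Finset.sum_comm]
    simp only [mul_neg, Finset.sum_neg_distrib, ← Finset.mul_sum]
    congr 1
    have h6 : ∑ l, connCoeff c a b l * Frame.tau c l =
        1 / 2 * (∑ l, c a b l * Frame.tau c l)
          + 1 / 2 * ∑ l, Frame.tau c l * (c l a b + c l b a) := by
      simp only [Finset.mul_sum, ← Finset.sum_add_distrib]
      refine Finset.sum_congr rfl fun l _ ↦ ?_
      simp only [connCoeff]; rw [hc' b l a]; ring
    rw [h5, mul_zero, zero_add] at h6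
    exact h6
  simp only [Finset.sum_sub_distrib, h3, Frame.ricStar]
  simp only [Finset.sum_add_distrib, Finset.sum_sub_distrib, ← Finset.mul_sum] at h0
  linarith

theorem ricci_frame (hΦ : MovingFrame br U Φ Ψ) {y : E} (hy : y ∈ U) (he : IsONFrame q e ε)
    (hγ : ContDiffOn ℝ ∞ γ U) (hq : ∀ z ∈ U, ∀ v w, γ z (Φ z v) (Φ z w) = q v w)
    (hanti : ∀ u v, br u v = -br v u)
    (hc : Frame.IsLie (fun i j k ↦ ε k (br (e i) (e j)))) (u v : E) :
    LocalGeom.ricci γ y (Φ y u) (Φ y v) =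
      ∑ i, ∑ j, (Frame.ricStar (fun i j k ↦ ε k (br (e i) (e j))) i j
        - Frame.symAd (fun i j k ↦ ε k (br (e i) (e j))) i j) * (ε i u * ε j v) := by
  set nab := nabla br e ε with hnab
  have h1 : ∀ w, LocalGeom.riemann γ y w (Φ y u) (Φ y v) =
      Φ y (nab (Ψ y w) (nab u v) - nab u (nab (Ψ y w) v) - nab (br (Ψ y w) u) v) := fun w ↦ by
    have := hΦ.riemann_frame hy hγ hq he.symm he.pos hanti (he.koszul br) (Ψ y w) u v
    rwa [hΦ.right_inv y hy] at this
  unfold LocalGeom.ricci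
  simp only [h1]
  have h2 := hΦ.sum_coord hy he ((nab.flip (nab u v)).toLinearMap
    - (nab u).toLinearMap ∘ₗ (nab.flip v).toLinearMap
    - (nab.flip v).toLinearMap ∘ₗ (br.flip u).toLinearMap)
  refine h2.trans ?_
  have h3 := he.expand₂ (LinearMap.mk₂ ℝ
    (fun u v ↦ ∑ k, ε k (nab (e k) (nab u v) - nab u (nab (e k) v) - nab (br (e k) u) v))
    (fun a b c ↦ by simp [Finset.sum_add_distrib, Finset.sum_sub_distrib]; ring)
    (fun a b c ↦ by simp [Finset.mul_sum, mul_sub])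
    (fun a b c ↦ by simp [Finset.sum_add_distrib, Finset.sum_sub_distrib]; ring)
    (fun a b c ↦ by simp [Finset.mul_sum, mul_sub])) u v
  refine h3.trans ?_
  refine Finset.sum_congr rfl fun a _ ↦ Finset.sum_congr rfl fun b _ ↦ ?_
  congr 1
  rw [← ricci_coeff hc]
  simp only [LinearMap.mk₂_apply]
  refine Finset.sum_congr rfl fun k _ ↦ ?_
  have h4 : nab (br (e k) (e a)) (e b) = ∑ l, ε l (br (e k) (e a)) • nab (e l) (e b) := by
    conv_lhs => rw [← he.complete (br (e k) (e a))]
    simp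
  rw [h4]
  simp only [hnab, he.nabla_frame, map_sum, map_sub, map_smul, smul_eq_mul, he.dual,
    Finset.sum_sub_distrib, mul_ite, mul_one, mul_zero, Finset.sum_ite_eq, Finset.mem_univ, if_true]

omit [DecidableEq ι] in
-- The first term is the contraction with Σₖ ∇_{eₖ} eₖ = Z. The other two match `codiffStar` up to
-- an expression antisymmetric in k and l.
lemma codiff_coeff {c h : ι → ι → ι → ℝ} (hc : Frame.IsLie c)
    (h₁ : ∀ i j k, h i j k = -h j i k) (h₂ : ∀ i j k, h i j k = -h i k j) (a b : ι) :
    (∑ k, ∑ l, (connCoeff c k k l * h l a b + connCoeff c k a l * h k l b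
      + connCoeff c k b l * h k a l)) = Frame.codiff c h a b := by
  have hc' := hc.anti
  have hd : ∀ i k, c i i k = 0 := fun i k ↦ by linarith [hc' i i k]
  have h0 := sum_eq_zero_of_antisymm (F := fun k l ↦ connCoeff c k a l * h k l b
      + connCoeff c k b l * h k a l + 1 / 2 * (c k l a * h k l b - c k l b * h k l a))
      fun k l ↦ by
    simp only [connCoeff]
    rw [hc' k a l, hc' l a k, hc' k b l, hc' l b k, hc' l k a, hc' l k b, h₁ l k b, h₁ l k a,
      h₂ k a l, h₂ l a k, h₁ l k a]
    ring
  have h3 : ∀ k l, connCoeff c k k l * h l a b = c l k k * h l a b := fun k l ↦ by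
    simp only [connCoeff]; rw [hd, hc' k l k]; ring
  simp only [Frame.codiff, Frame.codiffStar, Frame.iotaZ, Frame.tau, h3, Finset.sum_add_distrib,
    Finset.sum_mul]
  rw [Finset.sum_comm (f := fun k l ↦ c l k k * h l a b)]
  simp only [Finset.sum_add_distrib, ← Finset.mul_sum] at h0
  linarith

/-- As η has constant components in the frame, differentiating it produces terms with DΦ, and these
cancel the DΦ part of the Christoffel symbols. -/
lemma covDeriv_frame (hΦ : MovingFrame br U Φ Ψ) {y : E} (hy : y ∈ U) (he : IsONFrame q e ε)
    (hγ : ContDiffOn ℝ ∞ γ U) (hq : ∀ z ∈ U, ∀ v w, γ z (Φ z v) (Φ z w) = q v w)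
    (hanti : ∀ u v, br u v = -br v u) {η : E → E [⋀^Fin 3]→L[ℝ] ℝ}
    (hη : ContDiffOn ℝ ∞ η U)
    {p : E [⋀^Fin 3]→L[ℝ] ℝ} (hp : ∀ z ∈ U, ∀ v, η z (fun i ↦ Φ z (v i)) = p v) (a u v w : E) :
    LocalGeom.covDeriv γ η y (Φ y a) (Φ y u) (Φ y v) (Φ y w) =
      -triLin p (nabla br e ε a u) v w - triLin p u (nabla br e ε a v) w
        - triLin p u v (nabla br e ε a w) := by
  have h1 := hΦ.fderiv_form hy hη hp (Φ y a) ![u, v, w]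
  have h2 : ∀ u v w, η y ![Φ y u, Φ y v, Φ y w] = triLin p u v w := fun u v w ↦ by
    rw [triLin_apply, ← hp y hy]
    congr 1
    ext i; fin_cases i <;> rfl
  have e0 : (fun i ↦ Φ y (![u, v, w] i)) = ![Φ y u, Φ y v, Φ y w] := by
    ext i; fin_cases i <;> rfl
  have e1 : ∀ z, Function.update ![Φ y u, Φ y v, Φ y w] 0 z = ![z, Φ y v, Φ y w] := fun z ↦ by
    ext i; fin_cases i <;> rfl
  have e2 : ∀ z, Function.update ![Φ y u, Φ y v, Φ y w] 1 z = ![Φ y u, z, Φ y w] := fun z ↦ by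
    ext i; fin_cases i <;> rfl
  have e3 : ∀ z, Function.update ![Φ y u, Φ y v, Φ y w] 2 z = ![Φ y u, Φ y v, z] := fun z ↦ by
    ext i; fin_cases i <;> rfl
  have h3 : ∀ u v w, η y ![u, v, w] = triLin p (Ψ y u) (Ψ y v) (Ψ y w) := fun u v w ↦ by
    rw [← h2, hΦ.right_inv y hy, hΦ.right_inv y hy, hΦ.right_inv y hy]
  have hchr : ∀ v, LocalGeom.christoffel γ y (Φ y a) (Φ y v) =
      Φ y (nabla br e ε a v - Ψ y (fderiv ℝ Φ y (Φ y a) v)) := fun v ↦ by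
    rw [hΦ.christoffel_frame hy hγ hq he.symm he.pos hanti (he.koszul br), map_sub,
      hΦ.right_inv y hy]
  rw [e0, Fin.sum_univ_three, e1, e2, e3] at h1
  simp only [Matrix.cons_val_zero, Matrix.cons_val_one, Matrix.cons_val] at h1
  unfold LocalGeom.covDeriv
  rw [h1, hchr, hchr, hchr]
  simp only [h3, hΦ.left_inv y hy, map_sub, LinearMap.sub_apply]
  ring

theorem codiff_frame (hΦ : MovingFrame br U Φ Ψ) {y : E} (hy : y ∈ U) (he : IsONFrame q e ε)
    (hγ : ContDiffOn ℝ ∞ γ U) (hq : ∀ z ∈ U, ∀ v w, γ z (Φ z v) (Φ z w) = q v w)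
    (hanti : ∀ u v, br u v = -br v u)
    (hc : Frame.IsLie (fun i j k ↦ ε k (br (e i) (e j)))) {η : E → E [⋀^Fin 3]→L[ℝ] ℝ}
    (hη : ContDiffOn ℝ ∞ η U)
    {p : E [⋀^Fin 3]→L[ℝ] ℝ} (hp : ∀ z ∈ U, ∀ v, η z (fun i ↦ Φ z (v i)) = p v) (u v : E) :
    LocalGeom.codiff γ η y (Φ y u) (Φ y v) =
      ∑ i, ∑ j, Frame.codiff (fun i j k ↦ ε k (br (e i) (e j)))
        (fun i j k ↦ triLin p (e i) (e j) (e k)) i j * (ε i u * ε j v) := by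
  set nab := nabla br e ε with hnab
  unfold LocalGeom.codiff
  have h1 : ∀ i, LocalGeom.covDeriv γ η y (Module.finBasis ℝ E i) (LocalGeom.sharpDual (γ y) i)
      (Φ y u) (Φ y v) = -(LinearMap.mk₂ ℝ
        (fun a w ↦ triLin p (nab a w) u v + triLin p w (nab a u) v + triLin p w u (nab a v))
        (fun a b c ↦ by simp; ring) (fun a b c ↦ by simp; ring)
        (fun a b c ↦ by simp; ring) (fun a b c ↦ by simp; ring))
        (Ψ y (Module.finBasis ℝ E i)) (Ψ y (LocalGeom.sharpDual (γ y) i)) := fun i ↦ by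
    have := hΦ.covDeriv_frame hy he hγ hq hanti hη hp (Ψ y (Module.finBasis ℝ E i))
      (Ψ y (LocalGeom.sharpDual (γ y) i)) u v
    rw [hΦ.right_inv y hy, hΦ.right_inv y hy] at this
    rw [this, LinearMap.mk₂_apply]
    ring
  simp only [h1]
  rw [Finset.sum_neg_distrib, neg_neg, hΦ.sum_sharpDual hy he hq]
  have h3 := he.expand₂ (LinearMap.mk₂ ℝ
    (fun u v ↦ ∑ k, (triLin p (nab (e k) (e k)) u v + triLin p (e k) (nab (e k) u) v
      + triLin p (e k) u (nab (e k) v)))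
    (fun a b c ↦ by simp [Finset.sum_add_distrib]; ring)
    (fun a b c ↦ by simp [Finset.mul_sum, mul_add])
    (fun a b c ↦ by simp [Finset.sum_add_distrib]; ring)
    (fun a b c ↦ by simp [Finset.mul_sum, mul_add])) u v
  refine h3.trans ?_
  refine Finset.sum_congr rfl fun a _ ↦ Finset.sum_congr rfl fun b _ ↦ ?_
  congr 1
  rw [← codiff_coeff (h := fun i j k ↦ triLin p (e i) (e j) (e k)) hc (fun i j k ↦ triLin_anti₁ p _ _ _) (fun i j k ↦ triLin_anti₂ p _ _ _)]
  simp only [LinearMap.mk₂_apply]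
  refine Finset.sum_congr rfl fun k _ ↦ ?_
  simp only [hnab, he.nabla_frame, map_sum, map_smul, smul_eq_mul, LinearMap.sum_apply,
    LinearMap.smul_apply, Finset.sum_add_distrib]

omit [FiniteDimensional ℝ E] in
-- Constant components reduce the derivatives of η to derivatives of Φ, and these enter only through
-- differences that are brackets; this is the Chevalley–Eilenberg differential.
theorem extDeriv_two_frame (hΦ : MovingFrame br U Φ Ψ) {y : E} (hy : y ∈ U)
    {η : E → E [⋀^Fin 2]→L[ℝ] ℝ} (hη : ContDiffOn ℝ ∞ η U)
    {p : E [⋀^Fin 2]→L[ℝ] ℝ} (hp : ∀ z ∈ U, ∀ v, η z (fun i ↦ Φ z (v i)) = p v) (u v w : E) :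
    extDeriv η y ![Φ y u, Φ y v, Φ y w] =
      -p ![br u v, w] + p ![br u w, v] - p ![br v w, u] := by
  have hd : DifferentiableAt ℝ η y :=
    (hη.contDiffAt (hΦ.isOpen.mem_nhds hy)).differentiableAt (by simp)
  have h1 : ∀ a u v, fderiv ℝ η y (Φ y a) ![Φ y u, Φ y v] =
      -(η y ![fderiv ℝ Φ y (Φ y a) u, Φ y v] + η y ![Φ y u, fderiv ℝ Φ y (Φ y a) v]) := by
    intro a u v
    have h := hΦ.fderiv_form hy hη hp (Φ y a) ![u, v]
    have e0 : (fun i ↦ Φ y (![u, v] i)) = ![Φ y u, Φ y v] := by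
      ext i; fin_cases i <;> rfl
    have e1 : ∀ z, Function.update ![Φ y u, Φ y v] 0 z = ![z, Φ y v] := fun z ↦ by
      ext i; fin_cases i <;> rfl
    have e2 : ∀ z, Function.update ![Φ y u, Φ y v] 1 z = ![Φ y u, z] := fun z ↦ by
      ext i; fin_cases i <;> rfl
    rwa [e0, Fin.sum_univ_two, e1, e2] at h
  have h2 : ∀ u v, p ![u, v] = η y ![Φ y u, Φ y v] := fun u v ↦ by
    rw [← hp y hy]
    congr 1
    ext i; fin_cases i <;> rfl
  have hswap : ∀ u v, η y ![u, v] = -η y ![v, u] := fun u v ↦ by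
    have h := (η y).toAlternatingMap.map_swap ![v, u] (show (0 : Fin 2) ≠ 1 by decide)
    have e : ![v, u] ∘ Equiv.swap (0 : Fin 2) 1 = ![u, v] := by
      ext i; fin_cases i <;> rfl
    rw [e] at h
    exact h
  have hadd : ∀ u u' v, η y ![u + u', v] = η y ![u, v] + η y ![u', v] := fun u u' v ↦
    (η y).toMultilinearMap.cons_add ![v] u u'
  rw [extDeriv_apply hd, Fin.sum_univ_three]
  have r0 : (0 : Fin 3).removeNth ![Φ y u, Φ y v, Φ y w] = ![Φ y v, Φ y w] := by
    ext i; fin_cases i <;> rfl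
  have r1 : (1 : Fin 3).removeNth ![Φ y u, Φ y v, Φ y w] = ![Φ y u, Φ y w] := by
    ext i; fin_cases i <;> rfl
  have r2 : (2 : Fin 3).removeNth ![Φ y u, Φ y v, Φ y w] = ![Φ y u, Φ y v] := by
    ext i; fin_cases i <;> rfl
  have hb : ∀ v w, fderiv ℝ Φ y (Φ y v) w = fderiv ℝ Φ y (Φ y w) v + Φ y (br v w) := fun v w ↦ by
    rw [← hΦ.bracket y hy]; abel
  simp only [r0, r1, r2, fderiv_continuousAlternatingMap_apply_const_apply hd, Matrix.cons_val, h1,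
    Fin.val_zero, Fin.val_one, Fin.val_two, h2, pow_zero, pow_one, one_smul, neg_smul, even_two,
    Even.neg_pow, one_pow]
  rw [hb u v, hb u w, hb v w, hadd, hswap (Φ y v), hswap (Φ y u), hswap (Φ y u) (fderiv ℝ Φ y (Φ y w) v),
    hadd, hadd]
  ring

omit [FiniteDimensional ℝ E] in
theorem extDeriv_three_frame (hΦ : MovingFrame br U Φ Ψ) {y : E} (hy : y ∈ U)
    {η : E → E [⋀^Fin 3]→L[ℝ] ℝ} (hη : ContDiffOn ℝ ∞ η U)
    {p : E [⋀^Fin 3]→L[ℝ] ℝ} (hp : ∀ z ∈ U, ∀ v, η z (fun i ↦ Φ z (v i)) = p v) (u v w x : E) :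
    extDeriv η y ![Φ y u, Φ y v, Φ y w, Φ y x] =
      -(triLin p (br u v) w x - triLin p (br u w) v x + triLin p (br u x) v w
        + triLin p (br v w) u x - triLin p (br v x) u w + triLin p (br w x) u v) := by
  have hd : DifferentiableAt ℝ η y :=
    (hη.contDiffAt (hΦ.isOpen.mem_nhds hy)).differentiableAt (by simp)
  set D : E → E → E := fun a b ↦ fderiv ℝ Φ y (Φ y a) b with hD
  have hanti : ∀ u v w, triLin (η y) u v w = -triLin (η y) v u w := triLin_anti₁ _
  have hcyc : ∀ u v w, triLin (η y) u v w = triLin (η y) w u v := fun u v w ↦ by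
    rw [triLin_anti₂, triLin_anti₁, neg_neg]
  have h1 : ∀ a u v w, fderiv ℝ η y (Φ y a) ![Φ y u, Φ y v, Φ y w] =
      -(triLin (η y) (D a u) (Φ y v) (Φ y w) - triLin (η y) (D a v) (Φ y u) (Φ y w)
        + triLin (η y) (D a w) (Φ y u) (Φ y v)) := by
    intro a u v w
    have h := hΦ.fderiv_form hy hη hp (Φ y a) ![u, v, w]
    have e0 : (fun i ↦ Φ y (![u, v, w] i)) = ![Φ y u, Φ y v, Φ y w] := by
      ext i; fin_cases i <;> rfl
    have e1 : ∀ z, Function.update ![Φ y u, Φ y v, Φ y w] 0 z = ![z, Φ y v, Φ y w] := fun z ↦ by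
      ext i; fin_cases i <;> rfl
    have e2 : ∀ z, Function.update ![Φ y u, Φ y v, Φ y w] 1 z = ![Φ y u, z, Φ y w] := fun z ↦ by
      ext i; fin_cases i <;> rfl
    have e3 : ∀ z, Function.update ![Φ y u, Φ y v, Φ y w] 2 z = ![Φ y u, Φ y v, z] := fun z ↦ by
      ext i; fin_cases i <;> rfl
    rw [e0, Fin.sum_univ_three, e1, e2, e3, ← triLin_apply, ← triLin_apply, ← triLin_apply,
      ← triLin_apply] at h
    rw [← triLin_apply]
    rw [h, hanti (Φ y u), hcyc (Φ y u)]
    rfl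
  have h2 : ∀ u v w, triLin p u v w = triLin (η y) (Φ y u) (Φ y v) (Φ y w) := fun u v w ↦ by
    rw [triLin_apply, triLin_apply, ← hp y hy]
    congr 1
    ext i; fin_cases i <;> rfl
  rw [extDeriv_apply hd, Fin.sum_univ_four]
  have r0 : (0 : Fin 4).removeNth ![Φ y u, Φ y v, Φ y w, Φ y x] = ![Φ y v, Φ y w, Φ y x] := by
    ext i; fin_cases i <;> rfl
  have r1 : (1 : Fin 4).removeNth ![Φ y u, Φ y v, Φ y w, Φ y x] = ![Φ y u, Φ y w, Φ y x] := by
    ext i; fin_cases i <;> rfl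
  have r2 : (2 : Fin 4).removeNth ![Φ y u, Φ y v, Φ y w, Φ y x] = ![Φ y u, Φ y v, Φ y x] := by
    ext i; fin_cases i <;> rfl
  have r3 : (3 : Fin 4).removeNth ![Φ y u, Φ y v, Φ y w, Φ y x] = ![Φ y u, Φ y v, Φ y w] := by
    ext i; fin_cases i <;> rfl
  have hb : ∀ v w, D v w = D w v + Φ y (br v w) := fun v w ↦ by
    rw [← hΦ.bracket y hy]; abel
  have s2 : ((2 : Fin 4) : ℕ) = 2 := rfl
  have s3 : ((3 : Fin 4) : ℕ) = 3 := rfl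
  simp only [r0, r1, r2, r3, fderiv_continuousAlternatingMap_apply_const_apply hd, Matrix.cons_val,
    h1, Fin.val_zero, Fin.val_one, s2, s3, h2, pow_zero, pow_one]
  rw [hb u v, hb u w, hb u x, hb v w, hb v x, hb w x]
  simp only [map_add, LinearMap.add_apply]
  ring

end MovingFrame

end GRF

/-! ## Local groups -/

namespace GRF.LocalGroup

variable {E : Type*} [NormedAddCommGroup E] [NormedSpace ℝ E]

/-- The derivative of a function of two variables in the second variable, at `(y, o)`. -/
def dRight (f : E × E → E) (o y : E) : E →L[ℝ] E :=
  (fderiv ℝ f (y, o)).comp (ContinuousLinearMap.inr ℝ E E)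

/-- The bracket of a local group. -/
def bracket (m : E × E → E) (o : E) : E →L[ℝ] E →L[ℝ] E :=
  fderiv ℝ (dRight m o) o - (fderiv ℝ (dRight m o) o).flip

lemma dRight_apply (f : E × E → E) (o y w : E) : dRight f o y w = fderiv ℝ f (y, o) (0, w) := rfl

lemma bracket_apply (m : E × E → E) (o v w : E) :
    bracket m o v w = fderiv ℝ (dRight m o) o v w - fderiv ℝ (dRight m o) o w v := rfl

variable {f m c : E × E → E} {o y : E}

lemma hasFDerivAt_right {a b : E} (hf : DifferentiableAt ℝ f (a, b)) :
    HasFDerivAt (fun z ↦ f (a, z)) ((fderiv ℝ f (a, b)).comp (ContinuousLinearMap.inr ℝ E E)) b :=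
  hf.hasFDerivAt.comp b (hasFDerivAt_prodMk_right a b)

lemma hasFDerivAt_left {a b : E} (hf : DifferentiableAt ℝ f (a, b)) :
    HasFDerivAt (fun z ↦ f (z, b)) ((fderiv ℝ f (a, b)).comp (ContinuousLinearMap.inl ℝ E E)) a :=
  hf.hasFDerivAt.comp a (hasFDerivAt_prodMk_left a b)

lemma contDiffAt_fderiv {p : E × E} (hf : ContDiffAt ℝ ∞ f p) : ContDiffAt ℝ ∞ (fderiv ℝ f) p :=
  hf.fderiv_right (by exact_mod_cast le_rfl)

lemma contDiffAt_dRight (hf : ContDiffAt ℝ ∞ f (y, o)) : ContDiffAt ℝ ∞ (dRight f o) y := by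
  have h1 : ContDiffAt ℝ ∞ (fun z : E ↦ fderiv ℝ f (z, o)) y :=
    (contDiffAt_fderiv hf).comp y (contDiffAt_id.prodMk contDiffAt_const)
  exact h1.clm_comp contDiffAt_const

lemma eventually_differentiableAt {p : E × E} (hf : ContDiffAt ℝ ∞ f p) :
    ∀ᶠ q in 𝓝 p, DifferentiableAt ℝ f q :=
  ((hf.of_le (m := 1) (by exact_mod_cast le_top)).eventually (by simp)).mono
    fun _ h ↦ h.differentiableAt (by simp)

lemma fderiv_fderiv_apply {p : E → E × E} {u : E → E × E} {p' u' : E →L[ℝ] E × E} {z : E}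
    (hf : ContDiffAt ℝ ∞ f (p z)) (hp : HasFDerivAt p p' z) (hu : HasFDerivAt u u' z) (v : E) :
    fderiv ℝ (fun z ↦ fderiv ℝ f (p z) (u z)) z v =
      fderiv ℝ (fderiv ℝ f) (p z) (p' v) (u z) + fderiv ℝ f (p z) (u' v) := by
  have h1 : HasFDerivAt (fun z ↦ fderiv ℝ f (p z)) ((fderiv ℝ (fderiv ℝ f) (p z)).comp p') z :=
    ((contDiffAt_fderiv hf).differentiableAt (by simp)).hasFDerivAt.comp z hp
  rw [(h1.clm_apply hu).fderiv]
  simp [add_comm]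

lemma second_symm {p : E × E} (hf : ContDiffAt ℝ ∞ f p) (u v : E × E) :
    fderiv ℝ (fderiv ℝ f) p u v = fderiv ℝ (fderiv ℝ f) p v u :=
  hf.isSymmSndFDerivAt (by simpa using ENat.LEInfty.out) u v

/-- The frame fields of a right action of a local group have constant structure constants. -/
theorem bracket_of_action (hm : ContDiffAt ℝ ∞ m (o, o)) (hml : ∀ᶠ z in 𝓝 o, m (o, z) = z)
    (hmr : ∀ᶠ z in 𝓝 o, m (z, o) = z)
    (hf : ContDiffAt ℝ ∞ f (y, o)) (hfo : f (y, o) = y)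
    (h : ∀ᶠ p : E × E in 𝓝 (o, o), f (f (y, p.1), p.2) = f (y, m p)) (v w : E) :
    fderiv ℝ (dRight f o) y (dRight f o y v) w - fderiv ℝ (dRight f o) y (dRight f o y w) v =
      dRight f o y (bracket m o v w) := by
  have hA0 : ∀ w, dRight m o o w = w := fun w ↦ by
    have h1 := (hasFDerivAt_right (hm.differentiableAt (by simp)) : HasFDerivAt _ _ o)
    have h2 := h1.congr_of_eventuallyEq (f₁ := fun z ↦ z) (hml.mono fun z hz ↦ hz.symm)
    exact congrArg (fun L : E →L[ℝ] E ↦ L w) (h2.unique (hasFDerivAt_id o))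
  have key : ∀ v w, fderiv ℝ (dRight f o) y (dRight f o y v) w =
      fderiv ℝ (fderiv ℝ f) (y, o) (0, v) (0, w) + dRight f o y (fderiv ℝ (dRight m o) o v w) := by
    intro v w
    have hfy : ContinuousAt (fun z ↦ f (y, z)) o :=
      (hasFDerivAt_right (hf.differentiableAt (by simp))).continuousAt
    have hcy : Filter.Tendsto (fun z ↦ (f (y, z), o)) (𝓝 o) (𝓝 (y, o)) := by
      have : ContinuousAt (fun z ↦ (f (y, z), o)) o := hfy.prodMk continuousAt_const
      simpa [ContinuousAt, hfo] using this
    have hcz : Filter.Tendsto (fun z : E ↦ (y, z)) (𝓝 o) (𝓝 (y, o)) :=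
      (continuous_const.prodMk continuous_id).tendsto o
    have hcm : Filter.Tendsto (fun z : E ↦ (z, o)) (𝓝 o) (𝓝 (o, o)) :=
      (continuous_id.prodMk continuous_const).tendsto o
    -- The action law differentiated in its second group variable at o. It holds for all z near o
    -- and can be differentiated again in z, which gives `key`.
    have e1 : (fun z ↦ dRight f o (f (y, z)) w) =ᶠ[𝓝 o]
        fun z ↦ fderiv ℝ f (y, z) (0, dRight m o z w) := by
      rw [nhds_prod_eq] at h
      filter_upwards [h.curry, hcy.eventually (eventually_differentiableAt hf),
        hcz.eventually (eventually_differentiableAt hf),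
        hcm.eventually (eventually_differentiableAt hm), hmr] with z h1 h2 h3 h4 h5
      have d1 := hasFDerivAt_right h2
      have d2 : HasFDerivAt (fun z' ↦ f (y, m (z, z'))) ((fderiv ℝ f (y, z)).comp
          ((ContinuousLinearMap.inr ℝ E E).comp (dRight m o z))) o := by
        have d3 : HasFDerivAt (fun z' ↦ (y, m (z, z')))
            ((ContinuousLinearMap.inr ℝ E E).comp (dRight m o z)) o :=
          (hasFDerivAt_prodMk_right y (m (z, o))).comp o (hasFDerivAt_right h4)
        have d4 : HasFDerivAt f (fderiv ℝ f (y, z)) (y, m (z, o)) := by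
          rw [h5]; exact h3.hasFDerivAt
        exact d4.comp o d3
      exact congrArg (fun L : E →L[ℝ] E ↦ L w) ((d1.congr_of_eventuallyEq
        (h1.mono fun z' hz' ↦ hz'.symm)).unique d2)
    have e2 := congrArg (fun L : E →L[ℝ] E ↦ L v) e1.fderiv_eq
    have hu : HasFDerivAt (fun z ↦ ((0 : E), dRight m o z w)) ((ContinuousLinearMap.inr ℝ E E).comp
        ((fderiv ℝ (dRight m o) o).flip w)) o := by
      have d1 : HasFDerivAt (fun z ↦ dRight m o z w) ((fderiv ℝ (dRight m o) o).flip w) o := by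
        have := ((contDiffAt_dRight hm).differentiableAt (by simp)).hasFDerivAt.clm_apply
          (hasFDerivAt_const w o)
        simpa using this
      exact (hasFDerivAt_prodMk_right 0 (dRight m o o w)).comp o d1
    rw [fderiv_fderiv_apply (p := fun z ↦ (y, z)) hf (hasFDerivAt_prodMk_right y o) hu] at e2
    have d5 : HasFDerivAt (fun z ↦ dRight f o (f (y, z)) w)
        ((((fderiv ℝ (dRight f o) y).comp (dRight f o y))).flip w) o := by
      have d6 : HasFDerivAt (dRight f o) (fderiv ℝ (dRight f o) y) (f (y, o)) := by
        rw [hfo]; exact ((contDiffAt_dRight hf).differentiableAt (by simp)).hasFDerivAt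
      have d7 := (d6.comp o (hasFDerivAt_right (hf.differentiableAt (by simp)))).clm_apply
          (hasFDerivAt_const w o)
      exact d7.congr_fderiv (by ext v; simp [dRight_apply])
    rw [d5.fderiv] at e2
    rw [hA0] at e2
    exact e2
  -- Exchanging v and w, the second derivative of f cancels by symmetry; only the antisymmetrized
  -- second derivative of the multiplication survives.
  rw [key, key, second_symm hf, bracket_apply, map_sub]
  abel

/-- The derivative of the commutator map. -/
theorem fderiv_commutator (hm : ContDiffAt ℝ ∞ m (o, o)) (hml : ∀ᶠ z in 𝓝 o, m (o, z) = z)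
    (hmr : ∀ᶠ z in 𝓝 o, m (z, o) = z) (hc : ContDiffAt ℝ ∞ c (o, o))
    (hcr : ∀ᶠ z in 𝓝 o, c (z, o) = o)
    (h : ∀ᶠ p : E × E in 𝓝 (o, o), m (c p, m (p.2, p.1)) = m p) (v w : E) :
    dRight c o o w = 0 ∧ fderiv ℝ (dRight c o) o v w = bracket m o v w := by
  have hB0 : ∀ w, fderiv ℝ m (o, o) (w, 0) = w := fun w ↦ by
    have h1 := (hasFDerivAt_left (hm.differentiableAt (by simp)) : HasFDerivAt _ _ o)
    have h2 := h1.congr_of_eventuallyEq (f₁ := fun z ↦ z) (hmr.mono fun z hz ↦ hz.symm)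
    exact congrArg (fun L : E →L[ℝ] E ↦ L w) (h2.unique (hasFDerivAt_id o))
  have hcz : Filter.Tendsto (fun z : E ↦ (o, z)) (𝓝 o) (𝓝 (o, o)) :=
    (continuous_const.prodMk continuous_id).tendsto o
  have hcm : Filter.Tendsto (fun z : E ↦ (z, o)) (𝓝 o) (𝓝 (o, o)) :=
    (continuous_id.prodMk continuous_const).tendsto o
  -- The identity c(x,z)·(zx) = xz differentiated in z at o. At z = o one has c = o, so only first
  -- derivatives at (o,x) appear.
  have e1 : ∀ᶠ x in 𝓝 o, fderiv ℝ m (o, x) (dRight c o x w + w, 0) = dRight m o x w := by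
    rw [nhds_prod_eq] at h
    filter_upwards [h.curry, hcz.eventually (eventually_differentiableAt hm),
      hcm.eventually (eventually_differentiableAt hm),
      hcm.eventually (eventually_differentiableAt hc), hcr, hml, hml.eventually_nhds]
      with x h1 h2 h3 h4 h5 h6 h7
    have d1 := hasFDerivAt_right h3
    have d2 := hasFDerivAt_left h2
    have d3 : HasFDerivAt m (fderiv ℝ m (o, x)) (c (x, o), m (o, x)) := by
      rw [h5, h6]; exact h2.hasFDerivAt
    have d4 := d3.comp o ((hasFDerivAt_right h4).prodMk d2)
    have d5 := congrArg (fun L : E →L[ℝ] E ↦ L w) ((d4.congr_of_eventuallyEq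
      (h1.mono fun z' hz' ↦ hz'.symm)).unique d1)
    have hid : ∀ b, fderiv ℝ m (o, x) (0, b) = b := fun b ↦ by
      have d6 := (hasFDerivAt_right h2).congr_of_eventuallyEq (f₁ := fun z ↦ z)
        (h7.mono fun z hz ↦ hz.symm)
      exact congrArg (fun L : E →L[ℝ] E ↦ L b) (d6.unique (hasFDerivAt_id x))
    have d7 : fderiv ℝ m (o, x) (dRight c o x w, fderiv ℝ m (o, x) (w, 0)) = dRight m o x w := d5
    have d8 : (dRight c o x w, fderiv ℝ m (o, x) (w, 0)) =
      (dRight c o x w, (0 : E)) + (0, fderiv ℝ m (o, x) (w, 0)) := by simp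
    rw [d8, map_add, hid, ← map_add] at d7
    simpa using d7
  have hA0 : dRight m o o w = w := by
    have h1 := (hasFDerivAt_right (hm.differentiableAt (by simp)) : HasFDerivAt _ _ o)
    have h2 := h1.congr_of_eventuallyEq (f₁ := fun z ↦ z) (hml.mono fun z hz ↦ hz.symm)
    exact congrArg (fun L : E →L[ℝ] E ↦ L w) (h2.unique (hasFDerivAt_id o))
  have hC0 : dRight c o o w = 0 := by
    have := e1.self_of_nhds
    rw [hB0, hA0] at this
    simpa using this
  refine ⟨hC0, ?_⟩
  have dC : HasFDerivAt (fun z ↦ dRight c o z w) ((fderiv ℝ (dRight c o) o).flip w) o := by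
    have := ((contDiffAt_dRight hc).differentiableAt (by simp)).hasFDerivAt.clm_apply
      (hasFDerivAt_const w o)
    simpa using this
  have hu : HasFDerivAt (fun z ↦ (dRight c o z w + w, (0 : E)))
      ((ContinuousLinearMap.inl ℝ E E).comp ((fderiv ℝ (dRight c o) o).flip w)) o :=
    (hasFDerivAt_prodMk_left (dRight c o o w + w) (0 : E)).comp o (dC.add_const w)
  have e2 := congrArg (fun L : E →L[ℝ] E ↦ L v) (Filter.EventuallyEq.fderiv_eq (𝕜 := ℝ) e1)
  rw [fderiv_fderiv_apply (p := fun z ↦ (o, z)) hm (hasFDerivAt_prodMk_right o o) hu,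
    MovingFrame.fderiv_clm_apply_const ((contDiffAt_dRight hm).differentiableAt (by simp))] at e2
  -- Both mixed second derivatives of m at (o,o) are the same bilinear map with its arguments
  -- exchanged, so their difference is the bracket.
  have e3 : fderiv ℝ (dRight m o) o w v = fderiv ℝ (fderiv ℝ m) (o, o) (w, 0) (0, v) := by
    rw [← MovingFrame.fderiv_clm_apply_const ((contDiffAt_dRight hm).differentiableAt (by simp))]
    have := fderiv_fderiv_apply (p := fun z ↦ (z, o)) (u := fun _ ↦ (0, v)) hm
      (hasFDerivAt_prodMk_left o o) (hasFDerivAt_const _ _) w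
    refine this.trans ?_
    simp
  rw [bracket_apply, e3, ← e2, second_symm hm (w, 0)]
  simp [hC0, hB0]

end GRF.LocalGroup

/-! ### The Jacobi identity for the structure constants -/

namespace GRF.MovingFrame

variable {E : Type*} [NormedAddCommGroup E] [NormedSpace ℝ E] {br : E →L[ℝ] E →L[ℝ] E} {U : Set E}
  {Φ Ψ : E → E →L[ℝ] E}

/-- The map v ↦ Φv is injective and carries `br` to the bracket of vector fields, so the identities
are inherited from vector fields. -/
lemma isLieBracket [CompleteSpace E] (hΦ : MovingFrame br U Φ Ψ) {y : E} (hy : y ∈ U) :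
    Frame.IsLieBracket br := by
  have hinj : Function.Injective (Φ y) := Function.LeftInverse.injective (hΦ.left_inv y hy)
  refine ⟨fun u v ↦ hinj ?_, fun u v w ↦ hinj ?_⟩
  · rw [map_neg, ← hΦ.bracket y hy, ← hΦ.bracket y hy]; abel
  · have hV : ∀ v, ContDiffAt ℝ ∞ (fun z ↦ Φ z v) y := fun v ↦
      (hΦ.contDiffAt hy).clm_apply contDiffAt_const
    have hb : ∀ u v, VectorField.lieBracket ℝ (fun z ↦ Φ z u) (fun z ↦ Φ z v) =ᶠ[𝓝 y]
        fun z ↦ Φ z (br u v) := fun u v ↦ by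
      refine Filter.eventually_of_mem (hΦ.isOpen.mem_nhds hy) fun z hz ↦ ?_
      change _ = Φ z (br u v)
      rw [← hΦ.bracket z hz, VectorField.lieBracket, fderiv_clm_apply_const (hΦ.differentiableAt hz),
        fderiv_clm_apply_const (hΦ.differentiableAt hz)]
    have hbb : ∀ u v w, VectorField.lieBracket ℝ (fun z ↦ Φ z u)
        (VectorField.lieBracket ℝ (fun z ↦ Φ z v) (fun z ↦ Φ z w)) y = Φ y (br u (br v w)) :=
      fun u v w ↦ by
        rw [((Filter.EventuallyEq.refl _ _).lieBracket_vectorField (hb v w)).self_of_nhds]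
        exact (hb _ _).self_of_nhds
    have hbb' : ∀ u v w, VectorField.lieBracket ℝ
        (VectorField.lieBracket ℝ (fun z ↦ Φ z u) (fun z ↦ Φ z v)) (fun z ↦ Φ z w) y =
          Φ y (br (br u v) w) :=
      fun u v w ↦ by
        rw [((hb u v).lieBracket_vectorField (Filter.EventuallyEq.refl _ _)).self_of_nhds]
        exact (hb _ _).self_of_nhds
    have hL := VectorField.leibniz_identity_lieBracket (n := ∞) (by simpa using ENat.LEInfty.out)
      (hV u) (hV v) (hV w)
    rw [hbb, hbb', hbb] at hL
    have hanti : ∀ u v, Φ y (br u v) = -Φ y (br v u) := fun u v ↦ by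
      rw [← hΦ.bracket y hy, ← hΦ.bracket y hy]; abel
    rw [map_add, map_add, map_zero, hanti (br v w) u, hL, hanti (br w u) v]
    have hwu : br w u = -br u w := hinj (by rw [map_neg]; exact hanti _ _)
    rw [hwu]
    simp

end GRF.MovingFrame

/-! ## The frames of a quotient of a Lie group -/

namespace GRF

open LocalGroup
open scoped commutatorElement

variable {E : Type*} [NormedAddCommGroup E] [NormedSpace ℝ E]

section Charts

variable {M : Type*} [TopologicalSpace M] [ChartedSpace E M]

lemma chart_target_mem_nhds {x₀ : M} {y : E} (hy : y ∈ (extChartAt 𝓘(ℝ, E) x₀).target) :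
    (extChartAt 𝓘(ℝ, E) x₀).target ∈ 𝓝 y :=
  (isOpen_extChartAt_target x₀).mem_nhds hy

lemma chart_source_mem_nhds {x₀ x : M} (hx : x ∈ (extChartAt 𝓘(ℝ, E) x₀).source) :
    (extChartAt 𝓘(ℝ, E) x₀).source ∈ 𝓝 x :=
  (isOpen_extChartAt_source x₀).mem_nhds hx

variable [IsManifold 𝓘(ℝ, E) ∞ M]

lemma contMDiffAt_chart_symm {x₀ : M} {y : E} (hy : y ∈ (extChartAt 𝓘(ℝ, E) x₀).target) :
    ContMDiffAt 𝓘(ℝ, E) 𝓘(ℝ, E) ∞ (extChartAt 𝓘(ℝ, E) x₀).symm y :=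
  (contMDiffOn_extChartAt_symm x₀).contMDiffAt (chart_target_mem_nhds hy)

lemma contMDiffAt_chart {x₀ x : M} (hx : x ∈ (extChartAt 𝓘(ℝ, E) x₀).source) :
    ContMDiffAt 𝓘(ℝ, E) 𝓘(ℝ, E) ∞ (extChartAt 𝓘(ℝ, E) x₀) x :=
  contMDiffAt_extChartAt' (by rwa [extChartAt_source] at hx)

end Charts

section Group

variable (E) (G : Type*) [Group G] [TopologicalSpace G] [ChartedSpace E G]

/-- The coordinates of the neutral element. -/
def origin : E := extChartAt 𝓘(ℝ, E) (1 : G) 1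

variable {E}

/-- The inverse of the chart at the neutral element. -/
def ofChart (z : E) : G := (extChartAt 𝓘(ℝ, E) (1 : G)).symm z

/-- The chart at the neutral element. -/
def toChart {G : Type*} [Group G] [TopologicalSpace G] [ChartedSpace E G] (g : G) : E :=
  extChartAt 𝓘(ℝ, E) (1 : G) g

/-- The multiplication in the chart at the neutral element. -/
def mulChart (p : E × E) : E := toChart (ofChart G p.1 * ofChart G p.2)

/-- The commutator in the chart at the neutral element. -/
def commChart (p : E × E) : E := toChart ⁅ofChart G p.1, ofChart G p.2⁆

variable {G}

lemma ofChart_origin : ofChart G (origin E G) = 1 := extChartAt_to_inv (I := 𝓘(ℝ, E)) (1 : G)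

lemma toChart_one : toChart (1 : G) = origin E G := rfl

lemma origin_mem : origin E G ∈ (extChartAt 𝓘(ℝ, E) (1 : G)).target := mem_extChartAt_target 1

lemma toChart_ofChart : ∀ᶠ z in 𝓝 (origin E G), toChart (ofChart G z) = z :=
  Filter.eventually_of_mem (chart_target_mem_nhds origin_mem) fun _ hz ↦ PartialEquiv.right_inv _ hz

lemma ofChart_toChart : ∀ᶠ g in 𝓝 (1 : G), ofChart G (toChart (E := E) g) = g :=
  Filter.eventually_of_mem (chart_source_mem_nhds (E := E) (mem_extChartAt_source (1 : G)))
    fun _ hz ↦ PartialEquiv.left_inv _ hz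

lemma mulChart_left : ∀ᶠ z in 𝓝 (origin E G), mulChart G (origin E G, z) = z := by
  filter_upwards [toChart_ofChart (E := E) (G := G)] with z hz
  rw [mulChart, ofChart_origin, one_mul, hz]

lemma mulChart_right : ∀ᶠ z in 𝓝 (origin E G), mulChart G (z, origin E G) = z := by
  filter_upwards [toChart_ofChart (E := E) (G := G)] with z hz
  rw [mulChart, ofChart_origin, mul_one, hz]

lemma commChart_right (z : E) : commChart G (z, origin E G) = origin E G := by
  rw [commChart, ofChart_origin, commutatorElement_one_right, toChart_one]

variable [LieGroup 𝓘(ℝ, E) ∞ G]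

lemma contMDiffAt_ofChart : ContMDiffAt 𝓘(ℝ, E) 𝓘(ℝ, E) ∞ (ofChart G) (origin E G) :=
  contMDiffAt_chart_symm origin_mem

lemma contMDiffAt_toChart : ContMDiffAt 𝓘(ℝ, E) 𝓘(ℝ, E) ∞ (toChart (E := E)) (1 : G) :=
  contMDiffAt_chart (mem_extChartAt_source (1 : G))

lemma contMDiffAt_ofChart_fst :
    ContMDiffAt 𝓘(ℝ, E × E) 𝓘(ℝ, E) ∞ (fun p : E × E ↦ ofChart G p.1) (origin E G, origin E G) :=
  ContMDiffAt.comp (g := ofChart G) (f := Prod.fst) (I' := 𝓘(ℝ, E)) _ contMDiffAt_ofChart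
    contDiff_fst.contMDiff.contMDiffAt

lemma contMDiffAt_ofChart_snd (y : E) :
    ContMDiffAt 𝓘(ℝ, E × E) 𝓘(ℝ, E) ∞ (fun p : E × E ↦ ofChart G p.2) (y, origin E G) :=
  ContMDiffAt.comp (g := ofChart G) (f := Prod.snd) (I' := 𝓘(ℝ, E)) _ contMDiffAt_ofChart
    contDiff_snd.contMDiff.contMDiffAt

lemma contDiffAt_mulChart : ContDiffAt ℝ ∞ (mulChart (E := E) G) (origin E G, origin E G) := by
  rw [← contMDiffAt_iff_contDiffAt]
  have h := (contMDiffAt_ofChart_fst (E := E) (G := G)).mul (contMDiffAt_ofChart_snd (origin E G))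
  refine ContMDiffAt.comp (I' := 𝓘(ℝ, E)) _ ?_ h
  simp only [ofChart_origin, mul_one]
  exact contMDiffAt_toChart

lemma contDiffAt_commChart : ContDiffAt ℝ ∞ (commChart (E := E) G) (origin E G, origin E G) := by
  rw [← contMDiffAt_iff_contDiffAt]
  have h1 := contMDiffAt_ofChart_fst (E := E) (G := G)
  have h2 := contMDiffAt_ofChart_snd (G := G) (origin E G)
  have h := ((h1.mul h2).mul h1.inv).mul h2.inv
  refine ContMDiffAt.comp (I' := 𝓘(ℝ, E)) (f := fun p : E × E ↦ ⁅ofChart G p.1, ofChart G p.2⁆) _ ?_ h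
  simp only [ofChart_origin, commutatorElement_self]
  exact contMDiffAt_toChart

lemma ofChart_mulChart : ∀ᶠ p : E × E in 𝓝 (origin E G, origin E G),
    ofChart G (mulChart G p) = ofChart G p.1 * ofChart G p.2 := by
  have h : ContinuousAt (fun p : E × E ↦ ofChart G p.1 * ofChart G p.2) (origin E G, origin E G) :=
    ((contMDiffAt_ofChart_fst (E := E) (G := G)).mul
      (contMDiffAt_ofChart_snd (origin E G))).continuousAt
  have h' : Filter.Tendsto (fun p : E × E ↦ ofChart G p.1 * ofChart G p.2)
      (𝓝 (origin E G, origin E G)) (𝓝 1) := by simpa [ContinuousAt, ofChart_origin] using h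
  exact h'.eventually (ofChart_toChart (E := E))

lemma ofChart_commChart : ∀ᶠ p : E × E in 𝓝 (origin E G, origin E G),
    ofChart G (commChart G p) = ⁅ofChart G p.1, ofChart G p.2⁆ := by
  have h1 := contMDiffAt_ofChart_fst (E := E) (G := G)
  have h2 := contMDiffAt_ofChart_snd (G := G) (origin E G)
  have h : ContinuousAt (fun p : E × E ↦ ⁅ofChart G p.1, ofChart G p.2⁆)
      (origin E G, origin E G) := (((h1.mul h2).mul h1.inv).mul h2.inv).continuousAt
  have h' : Filter.Tendsto (fun p : E × E ↦ ⁅ofChart G p.1, ofChart G p.2⁆)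
      (𝓝 (origin E G, origin E G)) (𝓝 1) := by simpa [ContinuousAt, ofChart_origin] using h
  exact h'.eventually (ofChart_toChart (E := E))

/-- The group identity [a,b]·ba = ab. It characterizes the commutator by products alone, so its
derivatives can be found without differentiating inverses. -/
lemma mulChart_commChart : ∀ᶠ p : E × E in 𝓝 (origin E G, origin E G),
    mulChart G (commChart G p, mulChart G (p.2, p.1)) = mulChart G p := by
  have hs : Filter.Tendsto Prod.swap (𝓝 (origin E G, origin E G)) (𝓝 (origin E G, origin E G)) :=
    continuous_swap.tendsto _
  filter_upwards [ofChart_commChart (E := E) (G := G),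
    hs.eventually (ofChart_mulChart (E := E) (G := G))] with p h1 h2
  have h2' : ofChart G (mulChart G (p.2, p.1)) = ofChart G p.2 * ofChart G p.1 := h2
  rw [mulChart, h1, h2', mulChart, commutatorElement_def]
  congr 1
  group

/-- The Lie bracket, in the chart at the neutral element. -/
def lieBr (E G : Type*) [NormedAddCommGroup E] [NormedSpace ℝ E] [Group G] [TopologicalSpace G]
    [ChartedSpace E G] : E →L[ℝ] E →L[ℝ] E := bracket (mulChart G) (origin E G)

end Group

section Action

variable {G : Type*} [Group G] {M : Type*}

/-- The right action of `G` on the space of left cosets. -/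
def act (π : G → M) (x : M) (g : G) : M := π (Function.invFun π x * g)

variable [TopologicalSpace G] [ChartedSpace E G] [TopologicalSpace M] [ChartedSpace E M]
  {Γ : Subgroup G} {π : G → M}

/-- Two preimages of a point differ by a left factor in Γ, which commutes with right multiplication;
hence the choice made by `Function.invFun` is immaterial. -/
lemma IsQuotient.act_apply (hπ : IsQuotient (E := E) Γ π) (a g : G) : act π (π a) g = π (a * g) := by
  obtain ⟨γ, hγ, h⟩ := (hπ.eq_iff _ _).1 (Function.invFun_eq (f := π) ⟨a, rfl⟩)
  refine (hπ.eq_iff _ _).2 ⟨γ, hγ, ?_⟩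
  rw [← mul_assoc, h]

lemma IsQuotient.act_one (hπ : IsQuotient (E := E) Γ π) (x : M) : act π x 1 = x := by
  obtain ⟨a, rfl⟩ := hπ.surjective x
  rw [hπ.act_apply, mul_one]

lemma IsQuotient.act_act (hπ : IsQuotient (E := E) Γ π) (x : M) (g g' : G) :
    act π (act π x g) g' = act π x (g * g') := by
  obtain ⟨a, rfl⟩ := hπ.surjective x
  rw [hπ.act_apply, hπ.act_apply, hπ.act_apply, mul_assoc]

/-- The right action, in the chart of `M` at `x₀` and the chart of `G` at the neutral element. -/
def actChart (π : G → M) (x₀ : M) (p : E × E) : E :=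
  extChartAt 𝓘(ℝ, E) x₀ (act π ((extChartAt 𝓘(ℝ, E) x₀).symm p.1) (ofChart G p.2))

/-- The invariant frame in the chart at `x₀`. -/
def frameMap (π : G → M) (x₀ : M) : E → E →L[ℝ] E := dRight (actChart π x₀) (origin E G)

/-- The dual of the invariant frame in the chart at `x₀`. -/
def frameInv (π : G → M) (x₀ : M) (y : E) : E →L[ℝ] E := (frameMap π x₀ y).inverse

variable [LieGroup 𝓘(ℝ, E) ∞ G] [IsManifold 𝓘(ℝ, E) ∞ M]

namespace IsQuotient

variable (hπ : IsQuotient (E := E) Γ π) {x₀ : M} {y : E}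

include hπ

/-- The chosen preimage need not be continuous, but the action can be computed from any preimage, so
it is replaced near the point by a smooth local inverse of π. -/
lemma contMDiffAt_act (hy : y ∈ (extChartAt 𝓘(ℝ, E) x₀).target) :
    ContMDiffAt 𝓘(ℝ, E × E) 𝓘(ℝ, E) ∞
      (fun p : E × E ↦ act π ((extChartAt 𝓘(ℝ, E) x₀).symm p.1) (ofChart G p.2))
      (y, origin E G) := by
  obtain ⟨a, ha⟩ := hπ.surjective ((extChartAt 𝓘(ℝ, E) x₀).symm y)
  have hloc := hπ.isLocalDiffeomorph a
  have h1 : ContMDiffAt 𝓘(ℝ, E × E) 𝓘(ℝ, E) ∞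
      (fun p : E × E ↦ (extChartAt 𝓘(ℝ, E) x₀).symm p.1) (y, origin E G) :=
    ContMDiffAt.comp (g := (extChartAt 𝓘(ℝ, E) x₀).symm) (f := Prod.fst) (I' := 𝓘(ℝ, E)) _
      (contMDiffAt_chart_symm hy) contDiff_fst.contMDiff.contMDiffAt
  have h2 : ContMDiffAt 𝓘(ℝ, E × E) 𝓘(ℝ, E) ∞
      (fun p : E × E ↦ hloc.localInverse ((extChartAt 𝓘(ℝ, E) x₀).symm p.1)) (y, origin E G) := by
    refine ContMDiffAt.comp (g := hloc.localInverse) (I' := 𝓘(ℝ, E)) _ ?_ h1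
    rw [← ha]
    exact hloc.localInverse_contMDiffAt
  have h3 : ContMDiffAt 𝓘(ℝ, E × E) 𝓘(ℝ, E) ∞ (fun p : E × E ↦
      π (hloc.localInverse ((extChartAt 𝓘(ℝ, E) x₀).symm p.1) * ofChart G p.2)) (y, origin E G) :=
    ContMDiffAt.comp (g := π) (I' := 𝓘(ℝ, E)) _ (hπ.isLocalDiffeomorph.contMDiff _)
      (h2.mul (contMDiffAt_ofChart_snd y))
  refine h3.congr_of_eventuallyEq ?_
  have h4 : ∀ᶠ p : E × E in 𝓝 (y, origin E G),
      π (hloc.localInverse ((extChartAt 𝓘(ℝ, E) x₀).symm p.1)) =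
        (extChartAt 𝓘(ℝ, E) x₀).symm p.1 := by
    have h5 := hloc.localInverse_eventuallyEq_right
    rw [ha] at h5
    exact h1.continuousAt.eventually h5
  filter_upwards [h4] with p hp
  rw [← hπ.act_apply, hp]

lemma act_ofChart_mem (hy : y ∈ (extChartAt 𝓘(ℝ, E) x₀).target) :
    ∀ᶠ p : E × E in 𝓝 (y, origin E G),
      act π ((extChartAt 𝓘(ℝ, E) x₀).symm p.1) (ofChart G p.2) ∈
        (extChartAt 𝓘(ℝ, E) x₀).source := by
  refine (hπ.contMDiffAt_act hy).continuousAt.eventually (chart_source_mem_nhds ?_)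
  dsimp only
  rw [ofChart_origin, hπ.act_one]
  exact (extChartAt 𝓘(ℝ, E) x₀).map_target hy

lemma contDiffAt_actChart (hy : y ∈ (extChartAt 𝓘(ℝ, E) x₀).target) :
    ContDiffAt ℝ ∞ (actChart π x₀) (y, origin E G) := by
  rw [← contMDiffAt_iff_contDiffAt]
  refine ContMDiffAt.comp (g := extChartAt 𝓘(ℝ, E) x₀) (I' := 𝓘(ℝ, E)) _
    (contMDiffAt_chart ?_) (hπ.contMDiffAt_act hy)
  exact (hπ.act_ofChart_mem hy).self_of_nhds

omit [LieGroup 𝓘(ℝ, E) ∞ G] [IsManifold 𝓘(ℝ, E) ∞ M] in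
lemma actChart_origin (hy : y ∈ (extChartAt 𝓘(ℝ, E) x₀).target) :
    actChart π x₀ (y, origin E G) = y := by
  rw [actChart, ofChart_origin, hπ.act_one]
  exact (extChartAt 𝓘(ℝ, E) x₀).right_inv hy

lemma symm_actChart (hy : y ∈ (extChartAt 𝓘(ℝ, E) x₀).target) :
    ∀ᶠ z in 𝓝 (origin E G), (extChartAt 𝓘(ℝ, E) x₀).symm (actChart π x₀ (y, z)) =
      act π ((extChartAt 𝓘(ℝ, E) x₀).symm y) (ofChart G z) := by
  have h : Filter.Tendsto (fun z : E ↦ (y, z)) (𝓝 (origin E G)) (𝓝 (y, origin E G)) :=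
    (continuous_const.prodMk continuous_id).tendsto _
  filter_upwards [h.eventually (hπ.act_ofChart_mem hy)] with z hz
  exact (extChartAt 𝓘(ℝ, E) x₀).left_inv hz

lemma actChart_actChart (hy : y ∈ (extChartAt 𝓘(ℝ, E) x₀).target) :
    ∀ᶠ p : E × E in 𝓝 (origin E G, origin E G),
      actChart π x₀ (actChart π x₀ (y, p.1), p.2) = actChart π x₀ (y, mulChart G p) := by
  have h : Filter.Tendsto (Prod.fst : E × E → E) (𝓝 (origin E G, origin E G)) (𝓝 (origin E G)) :=
    continuous_fst.tendsto _
  filter_upwards [h.eventually (hπ.symm_actChart hy), ofChart_mulChart (E := E) (G := G)] with p h1 h2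
  have h3 : actChart π x₀ (actChart π x₀ (y, p.1), p.2) = extChartAt 𝓘(ℝ, E) x₀
    (act π ((extChartAt 𝓘(ℝ, E) x₀).symm (actChart π x₀ (y, p.1))) (ofChart G p.2)) := rfl
  rw [h3, h1, hπ.act_act, ← h2]
  rfl

/-- The orbit map z ↦ x·z has a differentiable local left inverse: lift to G by a local inverse of π
and multiply by a⁻¹. Its derivative is therefore injective, hence bijective in finite dimension. -/
lemma frameMap_isInvertible [FiniteDimensional ℝ E] (hy : y ∈ (extChartAt 𝓘(ℝ, E) x₀).target) :
    (frameMap π x₀ y).IsInvertible := by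
  obtain ⟨a, ha⟩ := hπ.surjective ((extChartAt 𝓘(ℝ, E) x₀).symm y)
  have hloc := hπ.isLocalDiffeomorph a
  let K : E → E := fun y' ↦ toChart (a⁻¹ * hloc.localInverse ((extChartAt 𝓘(ℝ, E) x₀).symm y'))
  have hinva : hloc.localInverse ((extChartAt 𝓘(ℝ, E) x₀).symm y) = a := by
    rw [← ha]; exact hloc.localInverse_eventuallyEq_left.self_of_nhds
  have hK : DifferentiableAt ℝ K y := by
    have h1 : ContMDiffAt 𝓘(ℝ, E) 𝓘(ℝ, E) ∞
        (fun y' ↦ hloc.localInverse ((extChartAt 𝓘(ℝ, E) x₀).symm y')) y := by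
      refine ContMDiffAt.comp (g := hloc.localInverse) (I' := 𝓘(ℝ, E)) _ ?_
        (contMDiffAt_chart_symm hy)
      rw [← ha]
      exact hloc.localInverse_contMDiffAt
    have h2 : ContMDiffAt 𝓘(ℝ, E) 𝓘(ℝ, E) ∞ K y := by
      refine ContMDiffAt.comp (g := toChart (E := E) (G := G)) (I' := 𝓘(ℝ, E)) _ ?_
        ((contMDiffAt_const (c := a⁻¹)).mul h1)
      simp only [hinva, inv_mul_cancel]
      exact contMDiffAt_toChart
    exact (contMDiffAt_iff_contDiffAt.1 h2).differentiableAt (by simp)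
  have hcomp : (fun z ↦ K (actChart π x₀ (y, z))) =ᶠ[𝓝 (origin E G)] fun z ↦ z := by
    have h1 : Filter.Tendsto (fun z ↦ a * ofChart G z) (𝓝 (origin E G)) (𝓝 a) := by
      have : ContinuousAt (fun z ↦ a * ofChart G z) (origin E G) :=
        ((contMDiffAt_const (I := 𝓘(ℝ, E)) (I' := 𝓘(ℝ, E)) (n := ∞) (c := a)).mul
          contMDiffAt_ofChart).continuousAt
      simpa [ContinuousAt, ofChart_origin] using this
    filter_upwards [hπ.symm_actChart hy, h1.eventually hloc.localInverse_eventuallyEq_left,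
      toChart_ofChart (E := E) (G := G)] with z h2 h3 h4
    simp only [K]
    have h3' : hloc.localInverse (π (a * ofChart G z)) = a * ofChart G z := h3
    rw [h2, ← ha, hπ.act_apply, h3', inv_mul_cancel_left, h4]
  have hinj : Function.Injective (frameMap π x₀ y) := by
    have h1 := (hπ.contDiffAt_actChart hy).differentiableAt (by simp)
    have h2 : HasFDerivAt K (fderiv ℝ K y) (actChart π x₀ (y, origin E G)) := by
      rw [hπ.actChart_origin hy]; exact hK.hasFDerivAt
    have h3 := (HasFDerivAt.comp (g := K) (f := fun z ↦ actChart π x₀ (y, z)) (origin E G) h2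
      (hasFDerivAt_right h1)).unique
      ((hasFDerivAt_id (origin E G)).congr_of_eventuallyEq hcomp)
    exact Function.LeftInverse.injective fun v ↦ congrArg (fun L : E →L[ℝ] E ↦ L v) h3
  refine ⟨(LinearEquiv.ofInjectiveEndo (frameMap π x₀ y).toLinearMap hinj).toContinuousLinearEquiv,
    ?_⟩
  ext v
  rfl

theorem movingFrame [FiniteDimensional ℝ E] (x₀ : M) :
    MovingFrame (lieBr E G) (extChartAt 𝓘(ℝ, E) x₀).target (frameMap π x₀) (frameInv π x₀) where
  isOpen := isOpen_extChartAt_target x₀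
  smooth := fun _ hy ↦ (contDiffAt_dRight (hπ.contDiffAt_actChart hy)).contDiffWithinAt
  smooth_inv := fun _ hy ↦
    (((hπ.frameMap_isInvertible hy).contDiffAt_map_inverse).comp _
      (contDiffAt_dRight (hπ.contDiffAt_actChart hy))).contDiffWithinAt
  left_inv := fun _ hy ↦ (hπ.frameMap_isInvertible hy).inverse_apply_self
  right_inv := fun _ hy ↦ (hπ.frameMap_isInvertible hy).self_apply_inverse
  bracket := fun _ hy ↦ bracket_of_action contDiffAt_mulChart mulChart_left mulChart_right
    (hπ.contDiffAt_actChart hy) (hπ.actChart_origin hy) (hπ.actChart_actChart hy)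

end IsQuotient

end Action

end GRF

/-! ## The derived series of a solvable Lie group -/

namespace GRF

open LocalGroup
open scoped commutatorElement

variable {E : Type*} [NormedAddCommGroup E] [NormedSpace ℝ E]
  {G : Type*} [Group G] [TopologicalSpace G] [ChartedSpace E G] [LieGroup 𝓘(ℝ, E) ∞ G]

lemma fderiv_mulChart (v w : E) :
    fderiv ℝ (mulChart (E := E) G) (origin E G, origin E G) (v, w) = v + w := by
  have hd := (contDiffAt_mulChart (E := E) (G := G)).differentiableAt (by simp)
  have h1 := (hasFDerivAt_left hd).congr_of_eventuallyEq (f₁ := fun z ↦ z)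
    (mulChart_right.mono fun z hz ↦ hz.symm)
  have h2 := (hasFDerivAt_right hd).congr_of_eventuallyEq (f₁ := fun z ↦ z)
    (mulChart_left.mono fun z hz ↦ hz.symm)
  have e1 := congrArg (fun L : E →L[ℝ] E ↦ L v) (h1.unique (hasFDerivAt_id _))
  have e2 := congrArg (fun L : E →L[ℝ] E ↦ L w) (h2.unique (hasFDerivAt_id _))
  have e3 : (v, w) = (v, (0 : E)) + ((0 : E), w) := by simp
  rw [e3, map_add]
  exact congrArg₂ (· + ·) e1 e2

/-- The differential of the multiplication at (1,1) is addition. Continuity at 0 keeps the curves in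
the domain of the chart, where `toChart` is faithful. -/
lemma hasDerivAt_mul {g₁ g₂ : ℝ → G} {v w : E} (h₁ : g₁ 0 = 1) (h₂ : g₂ 0 = 1)
    (hc₁ : ContinuousAt g₁ 0) (hc₂ : ContinuousAt g₂ 0)
    (hd₁ : HasDerivAt (fun t ↦ toChart (E := E) (g₁ t)) v 0)
    (hd₂ : HasDerivAt (fun t ↦ toChart (E := E) (g₂ t)) w 0) :
    HasDerivAt (fun t ↦ toChart (E := E) (g₁ t * g₂ t)) (v + w) 0 := by
  have h : HasFDerivAt (mulChart (E := E) G) (fderiv ℝ (mulChart (E := E) G)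
      (origin E G, origin E G)) (toChart (g₁ 0), toChart (g₂ 0)) := by
    rw [h₁, h₂]; exact (contDiffAt_mulChart.differentiableAt (by simp)).hasFDerivAt
  have h3 := h.comp_hasDerivAt (0 : ℝ) (hd₁.prodMk hd₂)
  rw [fderiv_mulChart] at h3
  refine h3.congr_of_eventuallyEq ?_
  rw [ContinuousAt, h₁] at hc₁
  rw [ContinuousAt, h₂] at hc₂
  filter_upwards [hc₁.eventually (ofChart_toChart (E := E)),
    hc₂.eventually (ofChart_toChart (E := E))] with t e1 e2
  simp only [Function.comp_apply, mulChart]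
  rw [e1, e2]

variable (E) in
/-- The velocities at the neutral element of the curves in a subgroup. -/
def velocities (A : Subgroup G) : Submodule ℝ E where
  -- Regularity is asked only at time 0. Derived subgroups need not be closed, so no Lie subgroup or
  -- exponential map is involved. Continuity is listed separately because `toChart` carries no
  -- information off the chart domain.
  carrier := {v | ∃ g : ℝ → G, (∀ t, g t ∈ A) ∧ g 0 = 1 ∧ ContinuousAt g 0 ∧
    HasDerivAt (fun t ↦ toChart (E := E) (g t)) v 0}
  add_mem' := by
    rintro v w ⟨g₁, hA₁, h₁, hc₁, hd₁⟩ ⟨g₂, hA₂, h₂, hc₂, hd₂⟩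
    have : IsTopologicalGroup G := topologicalGroup_of_lieGroup 𝓘(ℝ, E) ∞
    exact ⟨fun t ↦ g₁ t * g₂ t, fun t ↦ A.mul_mem (hA₁ t) (hA₂ t), by simp [h₁, h₂],
      hc₁.mul hc₂, hasDerivAt_mul h₁ h₂ hc₁ hc₂ hd₁ hd₂⟩
  zero_mem' := ⟨fun _ ↦ 1, fun _ ↦ A.one_mem, rfl, continuousAt_const, hasDerivAt_const _ _⟩
  smul_mem' := by
    rintro a v ⟨g, hA, h, hc, hd⟩
    have hl : HasDerivAt (fun t : ℝ ↦ a * t) a 0 := by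
      simpa using (hasDerivAt_id (0 : ℝ)).const_mul a
    refine ⟨fun t ↦ g (a * t), fun t ↦ hA _, by simpa using h, ?_, ?_⟩
    · refine ContinuousAt.comp (g := g) (f := fun t : ℝ ↦ a * t) ?_ hl.continuousAt
      simpa using hc
    · have hd' : HasDerivAt (fun t ↦ toChart (E := E) (g t)) v (a * 0) := by simpa using hd
      exact hd'.scomp (0 : ℝ) hl

lemma velocities_mono {A B : Subgroup G} (h : A ≤ B) : velocities E A ≤ velocities E B :=
  fun _ ⟨g, hA, hg⟩ ↦ ⟨g, fun t ↦ h (hA t), hg⟩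

lemma velocities_top : velocities E (⊤ : Subgroup G) = ⊤ := by
  rw [eq_top_iff]
  intro v _
  have hl : HasDerivAt (fun t : ℝ ↦ origin E G + t • v) v 0 := by
    simpa using ((hasDerivAt_id (0 : ℝ)).smul_const v).const_add (origin E G)
  have h0 : Filter.Tendsto (fun t : ℝ ↦ origin E G + t • v) (𝓝 0) (𝓝 (origin E G)) := by
    simpa [ContinuousAt] using hl.continuousAt
  refine ⟨fun t ↦ ofChart G (origin E G + t • v), fun _ ↦ Subgroup.mem_top _, by
    simp [ofChart_origin], ?_, ?_⟩
  · refine ContinuousAt.comp (g := ofChart G) (f := fun t : ℝ ↦ origin E G + t • v) ?_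
      hl.continuousAt
    simpa using (contMDiffAt_ofChart (E := E) (G := G)).continuousAt
  · exact hl.congr_of_eventuallyEq (h0.eventually (toChart_ofChart (E := E) (G := G)))

lemma velocities_bot : velocities E (⊥ : Subgroup G) = ⊥ := by
  rw [Submodule.eq_bot_iff]
  rintro v ⟨g, hA, _, _, hd⟩
  have : (fun t ↦ toChart (E := E) (g t)) = fun _ ↦ toChart (1 : G) := by
    funext t; rw [Subgroup.mem_bot.1 (hA t)]
  rw [this] at hd
  exact hd.unique (hasDerivAt_const _ _)

lemma hasDerivAt_comp_apply {D : E → E →L[ℝ] E} {D' : E →L[ℝ] E →L[ℝ] E} {x : ℝ → E} {t : ℝ}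
    {v : E} (hD : HasFDerivAt D D' (x t)) (hx : HasDerivAt x v t) (w : E) :
    HasDerivAt (fun s ↦ D (x s) w) (D' v w) t :=
  ((hD.comp_hasDerivAt t hx).clm_apply (hasDerivAt_const t w)).congr_deriv (by simp)

/-- For fixed t the curve s ↦ [g₁(t), g₂(s)] lies in C and has a velocity u(t). The curve u starts
at 0 with derivative [v,w], the mixed derivative of the commutator map. So [v,w] is a limit of the
velocities u(t)/t, and a subspace of a finite-dimensional space is closed. -/
lemma lieBr_mem_velocities [FiniteDimensional ℝ E] {A B C : Subgroup G} (h : ⁅A, B⁆ ≤ C) {v w : E}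
    (hv : v ∈ velocities E A) (hw : w ∈ velocities E B) : lieBr E G v w ∈ velocities E C := by
  obtain ⟨g₁, hA, h₁, hc₁, hd₁⟩ := hv
  obtain ⟨g₂, hB, h₂, hc₂, hd₂⟩ := hw
  have : IsTopologicalGroup G := topologicalGroup_of_lieGroup 𝓘(ℝ, E) ∞
  have hcm := contDiffAt_commChart (E := E) (G := G)
  obtain ⟨hz, hbr⟩ := fderiv_commutator (c := commChart (E := E) G) contDiffAt_mulChart
    mulChart_left mulChart_right hcm (Filter.Eventually.of_forall commChart_right)
    mulChart_commChart v w
  let u : ℝ → E := fun t ↦ dRight (commChart G) (origin E G) (toChart (g₁ t)) w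
  have hu0 : u 0 = 0 := by simp only [u, h₁]; exact hz
  have ht1 : Filter.Tendsto g₁ (𝓝 0) (𝓝 1) := by rw [ContinuousAt, h₁] at hc₁; exact hc₁
  have ht2 : Filter.Tendsto g₂ (𝓝 0) (𝓝 1) := by rw [ContinuousAt, h₂] at hc₂; exact hc₂
  have hcu : Filter.Tendsto (fun t ↦ (toChart (E := E) (g₁ t), origin E G)) (𝓝 0)
      (𝓝 (origin E G, origin E G)) := by
    have h3 := hd₁.continuousAt
    rw [ContinuousAt, h₁] at h3
    exact h3.prodMk_nhds tendsto_const_nhds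
  have hmem : ∀ᶠ t in 𝓝 (0 : ℝ), u t ∈ velocities E C := by
    filter_upwards [hcu.eventually (eventually_differentiableAt hcm),
      ht1.eventually (ofChart_toChart (E := E))] with t hdt hgt
    refine ⟨fun s ↦ ⁅g₁ t, g₂ s⁆, fun s ↦ h (Subgroup.commutator_mem_commutator (hA t) (hB s)), by
      simp [h₂], ?_, ?_⟩
    · exact ((continuousAt_const.mul hc₂).mul continuousAt_const).mul hc₂.inv
    · have h3 : HasFDerivAt (fun z ↦ commChart G (toChart (g₁ t), z))
          (dRight (commChart G) (origin E G) (toChart (g₁ t))) (toChart (g₂ 0)) := by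
        rw [h₂]; exact hasFDerivAt_right hdt
      refine (h3.comp_hasDerivAt (0 : ℝ) hd₂).congr_of_eventuallyEq ?_
      filter_upwards [ht2.eventually (ofChart_toChart (E := E))] with s hs
      simp only [Function.comp_apply, commChart]
      rw [hgt, hs]
  have hdu : HasDerivAt u (lieBr E G v w) 0 := by
    have h3 : HasFDerivAt (dRight (commChart G) (origin E G))
        (fderiv ℝ (dRight (commChart (E := E) G) (origin E G)) (origin E G)) (toChart (g₁ 0)) := by
      rw [h₁]; exact ((contDiffAt_dRight hcm).differentiableAt (by simp)).hasFDerivAt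
    exact (hasDerivAt_comp_apply h3 hd₁ w).congr_deriv hbr
  have hcl : IsClosed (velocities E C : Set E) := Submodule.closed_of_finiteDimensional _
  refine hcl.mem_of_tendsto (hasDerivAt_iff_tendsto_slope.1 hdu) ?_
  filter_upwards [hmem.filter_mono nhdsWithin_le_nhds] with t ht
  rw [slope_def_module, hu0, sub_zero]
  exact Submodule.smul_mem _ _ (by rwa [sub_zero])

/-- The derived subgroups Dₖ satisfy [G,Dₖ] ≤ Dₖ by normality and [Dₖ,Dₖ] = Dₖ₊₁; both relations
pass to velocities. -/
theorem exists_isSolvableFlag [FiniteDimensional ℝ E] [Group.IsSolvable G] :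
    ∃ V N, Frame.IsSolvableFlag (lieBr E G) V N := by
  obtain ⟨N, hN⟩ := Group.IsSolvable.solvable (G := G)
  refine ⟨fun k ↦ velocities E (derivedSeries G k), N, fun k l hkl ↦
    velocities_mono (derivedSeries_antitone G hkl), ?_, ?_, fun k u v hv ↦ ?_, fun k u hu v hv ↦ ?_⟩
  · simp only [derivedSeries_zero, velocities_top]
  · simp only [hN, velocities_bot]
  · have := derivedSeries_normal G k
    exact lieBr_mem_velocities (Subgroup.commutator_le_right _ _)
      (by rw [velocities_top]; trivial : u ∈ velocities E (⊤ : Subgroup G)) hv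
  · exact lieBr_mem_velocities (derivedSeries_succ G k).ge hu hv

end GRF

/-! ## Left-invariant tensors on a quotient of a Lie group -/

namespace GRF

open LocalGroup

variable {E : Type*} [NormedAddCommGroup E] [NormedSpace ℝ E]

section Charts

variable {M : Type*} [TopologicalSpace M] [ChartedSpace E M] [IsManifold 𝓘(ℝ, E) ∞ M]

lemma mdifferentiableAt_chart_symm {x₀ : M} {y : E} (hy : y ∈ (extChartAt 𝓘(ℝ, E) x₀).target) :
    MDifferentiableAt 𝓘(ℝ, E) 𝓘(ℝ, E) (extChartAt 𝓘(ℝ, E) x₀).symm y :=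
  (contMDiffAt_chart_symm hy).mdifferentiableAt (by simp)

lemma mdifferentiableAt_chart {x₀ x : M} (hx : x ∈ (extChartAt 𝓘(ℝ, E) x₀).source) :
    MDifferentiableAt 𝓘(ℝ, E) 𝓘(ℝ, E) (extChartAt 𝓘(ℝ, E) x₀) x :=
  (contMDiffAt_chart hx).mdifferentiableAt (by simp)

lemma mfderiv_chart_symm_dChart (x : M) (u : TangentSpace 𝓘(ℝ, E) x) :
    mfderiv 𝓘(ℝ, E) 𝓘(ℝ, E) (extChartAt 𝓘(ℝ, E) x).symm (extChartAt 𝓘(ℝ, E) x x)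
      (dChart (E := E) x u) = u := by
  have hx := mem_extChartAt_source (I := 𝓘(ℝ, E)) x
  have hy := mem_extChartAt_target (I := 𝓘(ℝ, E)) x
  have h := mfderiv_comp (I' := 𝓘(ℝ, E)) x (mdifferentiableAt_chart_symm hy) (mdifferentiableAt_chart hx)
  have h2 : (extChartAt 𝓘(ℝ, E) x).symm ∘ extChartAt 𝓘(ℝ, E) x =ᶠ[𝓝 x] id :=
    Filter.eventually_of_mem (chart_source_mem_nhds hx) fun z hz ↦ PartialEquiv.left_inv _ hz
  rw [h2.mfderiv_eq, mfderiv_id] at h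
  exact (congrArg (fun L : E →L[ℝ] E ↦ L u) h).symm

end Charts

variable {G : Type*} [Group G] [TopologicalSpace G] [ChartedSpace E G]
  {M : Type*} [TopologicalSpace M] [ChartedSpace E M] {Γ : Subgroup G} {π : G → M}

/-- The left-invariant vector fields, as an isomorphism with the tangent spaces. -/
def lift (π : G → M) (x : M) : E →L[ℝ] TangentSpace 𝓘(ℝ, E) x :=
  (mfderiv 𝓘(ℝ, E) 𝓘(ℝ, E) (fun z : E ↦ act π x (ofChart G z)) (origin E G) : E →L[ℝ] E)

/-- The inverse of `lift`. -/
def unlift (π : G → M) (x : M) : TangentSpace 𝓘(ℝ, E) x →L[ℝ] E :=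
  (frameInv π x (extChartAt 𝓘(ℝ, E) x x)).comp (dChart x)

variable [LieGroup 𝓘(ℝ, E) ∞ G] [IsManifold 𝓘(ℝ, E) ∞ M]

namespace IsQuotient

variable (hπ : IsQuotient (E := E) Γ π) {x₀ x : M} {y : E}

include hπ

lemma mdifferentiableAt_act (x : M) :
    MDifferentiableAt 𝓘(ℝ, E) 𝓘(ℝ, E) (fun z : E ↦ act π x (ofChart G z)) (origin E G) := by
  have h := (hπ.contMDiffAt_act (mem_extChartAt_target (I := 𝓘(ℝ, E)) x)).mdifferentiableAt (by simp)
  have h2 : MDifferentiableAt 𝓘(ℝ, E) 𝓘(ℝ, E × E) (fun z : E ↦ (extChartAt 𝓘(ℝ, E) x x, z))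
      (origin E G) :=
    ((differentiableAt_const _).prodMk differentiableAt_id).mdifferentiableAt
  have h3 := MDifferentiableAt.comp (I' := 𝓘(ℝ, E × E)) _ h h2
  refine h3.congr_of_eventuallyEq (Filter.Eventually.of_forall fun z ↦ ?_)
  simp only [Function.comp_apply, extChartAt_to_inv]

lemma hasMFDerivAt_actChart (hy : y ∈ (extChartAt 𝓘(ℝ, E) x₀).target) :
    HasMFDerivAt 𝓘(ℝ, E) 𝓘(ℝ, E) (fun z : E ↦ actChart π x₀ (y, z)) (origin E G)
      (frameMap (E := E) π x₀ y) :=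
  (hasFDerivAt_right ((hπ.contDiffAt_actChart hy).differentiableAt (by simp))).hasMFDerivAt

/-- The frame in each chart represents one global frame of M, the velocities of the right action. -/
lemma mfderiv_symm_frameMap (hy : y ∈ (extChartAt 𝓘(ℝ, E) x₀).target) (v : E) :
    mfderiv 𝓘(ℝ, E) 𝓘(ℝ, E) (extChartAt 𝓘(ℝ, E) x₀).symm y (frameMap (E := E) π x₀ y v) =
      lift π ((extChartAt 𝓘(ℝ, E) x₀).symm y) v := by
  have h1 := (mdifferentiableAt_chart_symm hy).hasMFDerivAt
  rw [← hπ.actChart_origin hy] at h1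
  have h2 := HasMFDerivAt.comp (I' := 𝓘(ℝ, E)) (origin E G) h1 (hπ.hasMFDerivAt_actChart hy)
  have h3 : (extChartAt 𝓘(ℝ, E) x₀).symm ∘ (fun z : E ↦ actChart π x₀ (y, z)) =ᶠ[𝓝 (origin E G)]
    fun z ↦ act π ((extChartAt 𝓘(ℝ, E) x₀).symm y) (ofChart G z) := hπ.symm_actChart hy
  have h4 := h3.mfderiv_eq (I := 𝓘(ℝ, E)) (I' := 𝓘(ℝ, E))
  rw [h2.mfderiv] at h4
  have h5 := congrArg (fun L : E →L[ℝ] E ↦ L v) h4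
  have h6 : mfderiv 𝓘(ℝ, E) 𝓘(ℝ, E) (extChartAt 𝓘(ℝ, E) x₀).symm
      (actChart π x₀ (y, origin E G)) (frameMap π x₀ y v) =
        lift π ((extChartAt 𝓘(ℝ, E) x₀).symm y) v := h5
  rw [hπ.actChart_origin hy] at h6
  exact h6

lemma dChart_lift (x : M) (v : E) :
    dChart x (lift π x v) = frameMap π x (extChartAt 𝓘(ℝ, E) x x) v := by
  have hx := mem_extChartAt_source (I := 𝓘(ℝ, E)) x
  have hy := mem_extChartAt_target (I := 𝓘(ℝ, E)) x
  have h1 := (mdifferentiableAt_chart hx).hasMFDerivAt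
  have e : act π x (ofChart G (origin E G)) = x := by rw [ofChart_origin, hπ.act_one]
  have h0 := (hπ.mdifferentiableAt_act x).hasMFDerivAt
  have h1' : HasMFDerivAt 𝓘(ℝ, E) 𝓘(ℝ, E) (extChartAt 𝓘(ℝ, E) x) (act π x (ofChart G (origin E G)))
      (dChart x : E →L[ℝ] E) := by rw [e]; exact h1
  have h2 := HasMFDerivAt.comp (I' := 𝓘(ℝ, E)) (origin E G) h1' h0
  have h3 : (extChartAt 𝓘(ℝ, E) x) ∘ (fun z : E ↦ act π x (ofChart G z)) =
      fun z ↦ actChart π x (extChartAt 𝓘(ℝ, E) x x, z) := by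
    funext z; simp only [Function.comp_apply, actChart, extChartAt_to_inv]
  rw [h3] at h2
  have h4 := hasMFDerivAt_unique h2 (hπ.hasMFDerivAt_actChart hy)
  exact congrArg (fun L : E →L[ℝ] E ↦ L v) h4

lemma formInChart_frameMap {k : ℕ} {θ : FormField E M k} {p : E [⋀^Fin k]→L[ℝ] ℝ}
    (hp : ∀ x, ∀ v : Fin k → E, θ x (fun i ↦ lift π x (v i)) = p v)
    (hy : y ∈ (extChartAt 𝓘(ℝ, E) x₀).target) (v : Fin k → E) :
    formInChart θ x₀ y (fun i ↦ frameMap π x₀ y (v i)) = p v := by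
  rw [← hp ((extChartAt 𝓘(ℝ, E) x₀).symm y)]
  have : (fun i ↦ lift π ((extChartAt 𝓘(ℝ, E) x₀).symm y) (v i)) = fun i ↦
    mfderiv 𝓘(ℝ, E) 𝓘(ℝ, E) (extChartAt 𝓘(ℝ, E) x₀).symm y (frameMap (E := E) π x₀ y (v i)) := by
    funext i; rw [hπ.mfderiv_symm_frameMap hy]
  rw [this]
  rfl

lemma bilinInChart_frameMap {h : BilinField E M} {q : E →L[ℝ] E →L[ℝ] ℝ}
    (hq : ∀ x, ∀ v w, h x (lift π x v) (lift π x w) = q v w)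
    (hy : y ∈ (extChartAt 𝓘(ℝ, E) x₀).target) (v w : E) :
    bilinInChart h x₀ y (frameMap π x₀ y v) (frameMap π x₀ y w) = q v w := by
  rw [← hq ((extChartAt 𝓘(ℝ, E) x₀).symm y), ← hπ.mfderiv_symm_frameMap hy,
    ← hπ.mfderiv_symm_frameMap hy]
  rfl

variable [FiniteDimensional ℝ E]

lemma unlift_lift (x : M) (v : E) : unlift π x (lift π x v) = v := by
  have h := (hπ.movingFrame x).left_inv _ (mem_extChartAt_target x) v
  rw [← hπ.dChart_lift] at h
  exact h

lemma lift_unlift (x : M) (u : TangentSpace 𝓘(ℝ, E) x) : lift π x (unlift π x u) = u := by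
  have hy := mem_extChartAt_target (I := 𝓘(ℝ, E)) x
  have h := (hπ.movingFrame x).right_inv _ hy (dChart x u)
  have h1 := hπ.mfderiv_symm_frameMap hy (unlift π x u)
  have h2 : frameMap π x (extChartAt 𝓘(ℝ, E) x x) (unlift π x u) = dChart x u := h
  rw [h2, mfderiv_chart_symm_dChart] at h1
  rw [extChartAt_to_inv] at h1
  exact h1.symm

end IsQuotient

end GRF

/-! ## Smooth families of forms -/

namespace GRF

section Smooth

variable {E : Type*} [NormedAddCommGroup E] [NormedSpace ℝ E] [FiniteDimensional ℝ E] {k : ℕ}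
  {D : Type*} [NormedAddCommGroup D] [NormedSpace ℝ D] {s : Set D} {n : WithTop ℕ∞}

lemma alternating_apply_eq_sum (p : E [⋀^Fin k]→L[ℝ] ℝ) (v : Fin k → E) :
    p v = ∑ r : Fin k → Fin (Module.finrank ℝ E), (∏ i, (Module.finBasis ℝ E).repr (v i) (r i)) *
      p (fun i ↦ Module.finBasis ℝ E (r i)) := by
  have h : v = fun i ↦ ∑ j, (Module.finBasis ℝ E).repr (v i) j • Module.finBasis ℝ E j := by
    funext i; rw [(Module.finBasis ℝ E).sum_repr]
  conv_lhs => rw [h]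
  have h2 := p.toMultilinearMap.map_sum
    (fun i j ↦ (Module.finBasis ℝ E).repr (v i) j • Module.finBasis ℝ E j)
  refine h2.trans (Finset.sum_congr rfl fun r _ ↦ ?_)
  exact p.toMultilinearMap.map_smul_univ (fun i ↦ (Module.finBasis ℝ E).repr (v i) (r i))
    (fun i ↦ Module.finBasis ℝ E (r i))

/-- A form depends linearly on its finitely many values on tuples of basis vectors, so smoothness
can be tested on fixed arguments. -/
lemma contDiffOn_alternating {f : D → E [⋀^Fin k]→L[ℝ] ℝ}
    (hf : ∀ v, ContDiffOn ℝ n (fun d ↦ f d v) s) : ContDiffOn ℝ n f s := by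
  let ev : (E [⋀^Fin k]→L[ℝ] ℝ) →ₗ[ℝ] (Fin k → Fin (Module.finrank ℝ E)) → ℝ :=
    { toFun := fun p r ↦ p (fun i ↦ Module.finBasis ℝ E (r i))
      map_add' := fun _ _ ↦ rfl
      map_smul' := fun _ _ ↦ rfl }
  have hinj : Function.Injective ev := fun p p' h ↦ by
    ext v
    rw [alternating_apply_eq_sum p, alternating_apply_eq_sum p']
    exact Finset.sum_congr rfl fun r _ ↦ congrArg _ (congrFun h r)
  obtain ⟨l, hl⟩ := ev.exists_leftInverse_of_injective (LinearMap.ker_eq_bot.2 hinj)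
  have h : f = fun d ↦ LinearMap.toContinuousLinearMap l (ev (f d)) := by
    funext d; exact (congrArg (fun L ↦ L (f d)) hl).symm
  rw [h]
  exact (LinearMap.toContinuousLinearMap l).contDiff.comp_contDiffOn
    (contDiffOn_pi.2 fun r ↦ hf _)

lemma contDiffWithinAt_alternating_apply {p : D → E [⋀^Fin k]→L[ℝ] ℝ} {v : D → Fin k → E}
    {d₀ : D} (hp : ContDiffWithinAt ℝ n p s d₀)
    (hv : ∀ i, ContDiffWithinAt ℝ n (fun d ↦ v d i) s d₀) :
    ContDiffWithinAt ℝ n (fun d ↦ p d (v d)) s d₀ := by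
  simp only [fun d ↦ alternating_apply_eq_sum (p d) (v d)]
  refine ContDiffWithinAt.sum fun r _ ↦ ContDiffWithinAt.mul (contDiffWithinAt_prod fun i _ ↦ ?_) ?_
  · exact (LinearMap.toContinuousLinearMap
      ((Module.finBasis ℝ E).coord (r i))).contDiff.contDiffAt.comp_contDiffWithinAt d₀ (hv i)
  · exact (ContinuousAlternatingMap.apply ℝ E ℝ
      (fun i ↦ Module.finBasis ℝ E (r i))).contDiff.contDiffAt.comp_contDiffWithinAt d₀ hp

lemma contDiffAt_alternating_apply {p : D → E [⋀^Fin k]→L[ℝ] ℝ} {v : D → Fin k → E} {d₀ : D}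
    (hp : ContDiffAt ℝ n p d₀) (hv : ∀ i, ContDiffAt ℝ n (fun d ↦ v d i) d₀) :
    ContDiffAt ℝ n (fun d ↦ p d (v d)) d₀ :=
  contDiffWithinAt_alternating_apply hp hv

lemma contDiffOn_pullback_form {p : D → E [⋀^Fin k]→L[ℝ] ℝ} {L : D → E →L[ℝ] E}
    (hp : ContDiffOn ℝ n p s) (hL : ContDiffOn ℝ n L s) :
    ContDiffOn ℝ n (fun d ↦ (p d).compContinuousLinearMap (L d)) s :=
  contDiffOn_alternating fun v d hd ↦ contDiffWithinAt_alternating_apply (v := fun d i ↦ L d (v i)) (hp d hd)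
      fun _ ↦ (hL d hd).clm_apply contDiffWithinAt_const

lemma contDiffOn_bilin {γ : D → E →L[ℝ] E →L[ℝ] ℝ}
    (h : ∀ v w, ContDiffOn ℝ n (fun d ↦ γ d v w) s) : ContDiffOn ℝ n γ s :=
  contDiffOn_clm_apply.2 fun v ↦ contDiffOn_clm_apply.2 fun w ↦ h v w

end Smooth

variable {E : Type*} [NormedAddCommGroup E] [NormedSpace ℝ E] {ι : Type*} [Fintype ι]

/-- The `2`-form with components `B` in the coframe `κ`. -/
def twoForm (κ : ι → E →L[ℝ] ℝ) (B : ι → ι → ℝ) : E [⋀^Fin 2]→L[ℝ] ℝ :=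
  ∑ i, ∑ j, (1 / 2 * B i j) • ContinuousAlternatingMap.alternatizeUncurryFin
    ((κ i).smulRight (ContinuousAlternatingMap.ofSubsingleton ℝ E ℝ (0 : Fin 1) (κ j)))

/-- Alternatization turns κᵢ ⊗ κⱼ into κᵢ ∧ κⱼ. The sum over ordered pairs counts each wedge twice,
hence the factor ½ in `twoForm`. -/
lemma twoForm_apply {κ : ι → E →L[ℝ] ℝ} {B : ι → ι → ℝ} (hB : ∀ i j, B i j = -B j i)
    (v : Fin 2 → E) : twoForm κ B v = Frame.bil κ B (v 0) (v 1) := by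
  have h : twoForm κ B v = 1 / 2 * (Frame.bil κ B (v 0) (v 1) - Frame.bil κ B (v 1) (v 0)) := by
    simp only [Frame.bil_apply, twoForm, ← Finset.sum_sub_distrib, Finset.mul_sum,
      ContinuousAlternatingMap.sum_apply]
    refine Finset.sum_congr rfl fun i _ ↦ Finset.sum_congr rfl fun j _ ↦ ?_
    simp [ContinuousAlternatingMap.alternatizeUncurryFin_apply, Fin.sum_univ_two, Fin.removeNth]
    ring
  rw [h, Frame.bil_anti hB (v 1) (v 0)]
  ring

lemma exists_isONFrame [FiniteDimensional ℝ E] {q : E →L[ℝ] E →L[ℝ] ℝ}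
    (hsymm : ∀ v w, q v w = q w v) (hpos : ∀ v, v ≠ 0 → 0 < q v v) :
    ∃ (e : Fin (Module.finrank ℝ E) → E) (ε : Fin (Module.finrank ℝ E) → E →L[ℝ] ℝ),
      IsONFrame q e ε := by
  let Q : LinearMap.BilinForm ℝ E :=
    LinearMap.mk₂ ℝ (fun v w ↦ q v w) (by simp) (by simp) (by simp) (by simp)
  obtain ⟨b, hb⟩ := LinearMap.BilinForm.exists_orthogonal_basis (B := Q) ⟨fun v w ↦ hsymm v w⟩
  obtain ⟨r, hr, ho⟩ : ∃ r : Fin (Module.finrank ℝ E) → ℝ, (∀ i, r i ≠ 0) ∧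
      ∀ i j, q (b i) (b j) = if i = j then r i * r i else 0 := by
    have hp : ∀ i, 0 < q (b i) (b i) := fun i ↦ hpos _ (b.ne_zero i)
    refine ⟨fun i ↦ √(q (b i) (b i)), fun i ↦ (Real.sqrt_pos.2 (hp i)).ne', fun i j ↦ ?_⟩
    split_ifs with h
    · rw [h, Real.mul_self_sqrt (hp j).le]
    · exact hb h
  refine ⟨fun i ↦ (r i)⁻¹ • b i, fun i ↦ r i • LinearMap.toContinuousLinearMap (b.coord i),
    fun v ↦ ?_, fun i j ↦ ?_, fun v w ↦ ?_⟩
  · conv_rhs => rw [← b.sum_repr v]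
    refine Finset.sum_congr rfl fun i _ ↦ ?_
    simp only [smul_apply, smul_smul, smul_eq_mul]
    congr 1
    have := hr i
    simp only [LinearMap.coe_toContinuousLinearMap', Module.Basis.coord_apply]
    field_simp
  · have := hr i
    rcases eq_or_ne i j with h | h
    · subst h; simp [this]
    · simp [h]
  · conv_lhs => rw [← b.sum_repr v, ← b.sum_repr w]
    simp only [map_sum, map_smul, sum_apply, smul_apply, smul_eq_mul, ho, mul_ite, mul_zero,
      Finset.sum_ite_eq',
      Finset.mem_univ, if_true]
    refine Finset.sum_congr rfl fun i _ ↦ ?_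
    simp only [LinearMap.coe_toContinuousLinearMap', Module.Basis.coord_apply]
    ring

end GRF

/-! ## Invariance -/

namespace GRF

variable {E : Type*} [NormedAddCommGroup E] [NormedSpace ℝ E]
  {G : Type*} [Group G] [TopologicalSpace G] [ChartedSpace E G]
  {M : Type*} [TopologicalSpace M] [ChartedSpace E M]
  {Γ : Subgroup G} {π : G → M}

/-- G itself is the case of the trivial subgroup, so `lift id` is the frame of left-invariant fields
on G and all results on quotients apply to it. -/
lemma isQuotient_id : IsQuotient (E := E) (⊥ : Subgroup G) (id : G → G) where
  isLocalDiffeomorph := (Diffeomorph.refl 𝓘(ℝ, E) G ∞).isLocalDiffeomorph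
  surjective := Function.surjective_id
  eq_iff := fun x y ↦ by simp

variable [LieGroup 𝓘(ℝ, E) ∞ G]

namespace IsQuotient

variable (hπ : IsQuotient (E := E) Γ π)

include hπ

section Lift

variable [IsManifold 𝓘(ℝ, E) ∞ M]

/-- A map that commutes with the right actions carries orbit curves to orbit curves. It is used for
left translations and for π. -/
lemma mfderiv_lift {N : Type*} [TopologicalSpace N] [ChartedSpace E N] {ρ : G → N} {F : M → N}
    (hF : ∀ x g, F (act π x g) = act ρ (F x) g) {x : M}
    (hd : MDifferentiableAt 𝓘(ℝ, E) 𝓘(ℝ, E) F x) (v : E) :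
    mfderiv 𝓘(ℝ, E) 𝓘(ℝ, E) F x (lift π x v) = lift ρ (F x) v := by
  have e : act π x (ofChart G (origin E G)) = x := by rw [ofChart_origin, hπ.act_one]
  have h1 : HasMFDerivAt 𝓘(ℝ, E) 𝓘(ℝ, E) F (act π x (ofChart G (origin E G)))
      (mfderiv 𝓘(ℝ, E) 𝓘(ℝ, E) F x : E →L[ℝ] E) := by rw [e]; exact hd.hasMFDerivAt
  have h2 := HasMFDerivAt.comp (I' := 𝓘(ℝ, E)) (origin E G) h1 (hπ.mdifferentiableAt_act x).hasMFDerivAt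
  have h3 : F ∘ (fun z : E ↦ act π x (ofChart G z)) = fun z ↦ act ρ (F x) (ofChart G z) := by
    funext z; exact hF _ _
  rw [h3] at h2
  exact (congrArg (fun L : E →L[ℝ] E ↦ L v) h2.mfderiv).symm

end Lift

omit hπ in
lemma mfderiv_mul_lift (a g : G) (v : E) :
    mfderiv 𝓘(ℝ, E) 𝓘(ℝ, E) (fun x : G ↦ a * x) g (lift (E := E) id g v) =
      lift (E := E) id (a * g) v := by
  refine (isQuotient_id (E := E) (G := G)).mfderiv_lift (F := fun x : G ↦ a * x) (fun x z ↦ ?_)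
    ((contMDiff_mul_left (I := 𝓘(ℝ, E)) (n := ∞) (a := a)).mdifferentiableAt (by simp)) v
  have h := isQuotient_id (E := E) (G := G)
  have h1 : act id x z = x * z := h.act_apply x z
  have h2 : act id (a * x) z = a * x * z := h.act_apply (a * x) z
  rw [h1, h2, mul_assoc]

lemma mfderiv_proj_lift (g : G) (v : E) :
    mfderiv 𝓘(ℝ, E) 𝓘(ℝ, E) π g (lift (E := E) id g v) = lift (E := E) π (π g) v := by
  refine (isQuotient_id (E := E) (G := G)).mfderiv_lift (F := π) (fun x z ↦ ?_)
    ((hπ.isLocalDiffeomorph.contMDiff g).mdifferentiableAt (by simp)) v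
  have h1 : act id x z = x * z := (isQuotient_id (E := E) (G := G)).act_apply x z
  rw [h1, hπ.act_apply]

lemma pullForm_eq_iff {k : ℕ} {θ : FormField E M k} {p : E [⋀^Fin k]→L[ℝ] ℝ} :
    (∀ x, ∀ v : Fin k → E, θ x (fun i ↦ lift π x (v i)) = p v) ↔
      ∀ g, ∀ v : Fin k → E, pullForm π θ g (fun i ↦ lift (E := E) id g (v i)) = p v := by
  have h : ∀ g, ∀ v : Fin k → E, pullForm π θ g (fun i ↦ lift (E := E) id g (v i)) =
      θ (π g) (fun i ↦ lift π (π g) (v i)) := fun g v ↦ by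
    simp only [← hπ.mfderiv_proj_lift]; rfl
  refine ⟨fun h' g v ↦ by rw [h, h'], fun h' x v ↦ ?_⟩
  obtain ⟨g, rfl⟩ := hπ.surjective x
  rw [← h, h']

variable [FiniteDimensional ℝ E]

/-- Left translations preserve the left-invariant frame and act transitively, so invariance means
constant components; their common value is the one at 1. -/
theorem invariantForm_iff {k : ℕ} {θ : FormField E M k} : InvariantForm π θ ↔
    ∃ p : E [⋀^Fin k]→L[ℝ] ℝ, ∀ x, ∀ v : Fin k → E, θ x (fun i ↦ lift π x (v i)) = p v := by
  have h : ∀ a g, ∀ v : Fin k → E, pullForm (fun x : G ↦ a * x) (pullForm π θ) g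
      (fun i ↦ lift (E := E) id g (v i)) =
        pullForm π θ (a * g) (fun i ↦ lift (E := E) id (a * g) (v i)) := fun a g v ↦ by
    simp only [← mfderiv_mul_lift]; rfl
  simp only [hπ.pullForm_eq_iff]
  constructor
  · intro hθ
    refine ⟨(pullForm π θ 1).compContinuousLinearMap (lift (E := E) id (1 : G)), fun g v ↦ ?_⟩
    have h1 := h g 1 v
    rw [hθ g, mul_one] at h1
    exact h1.symm
  · rintro ⟨p, hp⟩ a
    funext g
    ext u
    have hu : u = fun i ↦ lift (E := E) id g (unlift (E := E) id g (u i)) := by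
      funext i; rw [isQuotient_id.lift_unlift]
    rw [hu, h, hp, hp]

theorem invariantMetric_iff {g : Metric E M} : InvariantMetric π g ↔
    ∃ q : E →L[ℝ] E →L[ℝ] ℝ, ∀ x, ∀ v w : E, g.inner x (lift π x v) (lift π x w) = q v w := by
  have h0 : ∀ z, ∀ v w : E, pullBilin π g.inner z (lift (E := E) id z v) (lift (E := E) id z w) =
      g.inner (π z) (lift π (π z) v) (lift π (π z) w) := fun z v w ↦ by
    simp only [← hπ.mfderiv_proj_lift]; rfl
  have h : ∀ a z, ∀ v w : E, pullBilin (fun x : G ↦ a * x) (pullBilin π g.inner) z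
      (lift (E := E) id z v) (lift (E := E) id z w) =
        pullBilin π g.inner (a * z) (lift (E := E) id (a * z) v) (lift (E := E) id (a * z) w) :=
    fun a z v w ↦ by
      simp only [← mfderiv_mul_lift]; rfl
  constructor
  · intro hg
    let D : E →L[ℝ] E := lift (E := E) id (1 : G)
    let q : E →L[ℝ] E →L[ℝ] ℝ := pullBilin π g.inner (1 : G)
    refine ⟨(D.precomp ℝ).comp (q.comp D), fun x v w ↦ ?_⟩
    obtain ⟨a, rfl⟩ := hπ.surjective x
    have h1 := h a 1 v w
    rw [hg a, mul_one, h0 a] at h1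
    exact h1.symm
  · rintro ⟨q, hq⟩ a
    funext z
    ext u u'
    rw [← isQuotient_id.lift_unlift z u, ← isQuotient_id.lift_unlift z u', h, h0, hq, h0, hq]

end IsQuotient

end GRF

/-! ## The local geometry depends smoothly on parameters -/

namespace GRF

variable {E : Type*} [NormedAddCommGroup E] [NormedSpace ℝ E] [FiniteDimensional ℝ E]
  {D : Type*} [NormedAddCommGroup D] [NormedSpace ℝ D]
  {F : Type*} [NormedAddCommGroup F] [NormedSpace ℝ F]

lemma contDiffAt_clm {f : D → E →L[ℝ] F} {d₀ : D} {n : WithTop ℕ∞}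
    (hf : ∀ v, ContDiffAt ℝ n (fun d ↦ f d v) d₀) : ContDiffAt ℝ n f d₀ := by
  have h : f = fun d ↦ ∑ i, ContinuousLinearMap.smulRightL ℝ E F
      (LinearMap.toContinuousLinearMap ((Module.finBasis ℝ E).coord i))
      (f d (Module.finBasis ℝ E i)) := by
    funext d
    ext v
    conv_lhs => rw [← (Module.finBasis ℝ E).sum_repr v, map_sum]
    simp
  rw [h]
  exact ContDiffAt.sum fun i _ ↦ (ContinuousLinearMap.contDiff _).contDiffAt.comp d₀ (hf _)

omit [FiniteDimensional ℝ E] in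
lemma contDiffAt_fderiv_apply {f : D → E → F} {y u : D → E} {d₀ : D}
    (hf : ContDiffAt ℝ ∞ (fun p : D × E ↦ f p.1 p.2) (d₀, y d₀)) (hy : ContDiffAt ℝ ∞ y d₀)
    (hu : ContDiffAt ℝ ∞ u d₀) : ContDiffAt ℝ ∞ (fun d ↦ fderiv ℝ (f d) (y d) (u d)) d₀ :=
  (ContDiffAt.fderiv (m := ∞) hf hy (by simp)).clm_apply hu

omit [FiniteDimensional ℝ E] in
lemma contDiffAt_comp_fst {f : D → E → F} {d₀ : D} {y₀ y₁ : E}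
    (hf : ContDiffAt ℝ ∞ (fun p : D × E ↦ f p.1 p.2) (d₀, y₀)) :
    ContDiffAt ℝ ∞ (fun p : (D × E) × E ↦ f p.1.1 p.2) ((d₀, y₁), y₀) :=
  ContDiffAt.comp (g := fun p : D × E ↦ f p.1 p.2) (f := fun p : (D × E) × E ↦ (p.1.1, p.2)) _ hf
    (by fun_prop)

section Metric

variable {γ : D → E → E →L[ℝ] E →L[ℝ] ℝ} {d₀ : D}

/-- The point y is allowed to depend on the parameter, so that the Christoffel symbols can be
differentiated once more in y for the curvature, with D × E as new parameter space. -/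
lemma contDiffAt_christoffel {y u v : D → E}
    (hγ : ContDiffAt ℝ ∞ (fun p : D × E ↦ γ p.1 p.2) (d₀, y d₀))
    (hinv : (γ d₀ (y d₀)).IsInvertible) (hy : ContDiffAt ℝ ∞ y d₀)
    (hu : ContDiffAt ℝ ∞ u d₀) (hv : ContDiffAt ℝ ∞ v d₀) :
    ContDiffAt ℝ ∞ (fun d ↦ LocalGeom.christoffel (γ d) (y d) (u d) (v d)) d₀ := by
  have h1 : ContDiffAt ℝ ∞ (fun d ↦ γ d (y d)) d₀ :=
    ContDiffAt.comp (g := fun p : D × E ↦ γ p.1 p.2) (f := fun d ↦ (d, y d)) d₀ hγ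
      (contDiffAt_id.prodMk hy)
  have h2 : ContDiffAt ℝ ∞ (fun d ↦ (γ d (y d)).inverse) d₀ :=
    ContDiffAt.comp (g := ContinuousLinearMap.inverse) (f := fun d ↦ γ d (y d)) d₀
      hinv.contDiffAt_map_inverse h1
  have h3 : ∀ {a b : D → E}, ContDiffAt ℝ ∞ a d₀ → ContDiffAt ℝ ∞ b d₀ →
      ContDiffAt ℝ ∞ (fun d ↦ fderiv ℝ (γ d) (y d) (a d) (b d)) d₀ := fun ha hb ↦
    (contDiffAt_fderiv_apply hγ hy ha).clm_apply hb
  refine h2.clm_apply (ContDiffAt.const_smul _ (((h3 hu hv).add (h3 hv hu)).sub ?_))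
  exact contDiffAt_clm fun w ↦ ((h3 contDiffAt_const hu).clm_apply hv :
    ContDiffAt ℝ ∞ (fun d ↦ fderiv ℝ (γ d) (y d) w (u d) (v d)) d₀)

variable {y₀ : E} (hγ : ContDiffAt ℝ ∞ (fun p : D × E ↦ γ p.1 p.2) (d₀, y₀))
  (hinv : (γ d₀ y₀).IsInvertible)

include hγ hinv

lemma contDiffAt_riemann (u v w : E) :
    ContDiffAt ℝ ∞ (fun d ↦ LocalGeom.riemann (γ d) y₀ u v w) d₀ := by
  have h1 : ∀ {a b : D → E}, ContDiffAt ℝ ∞ a d₀ → ContDiffAt ℝ ∞ b d₀ →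
      ContDiffAt ℝ ∞ (fun d ↦ LocalGeom.christoffel (γ d) y₀ (a d) (b d)) d₀ := fun ha hb ↦
    contDiffAt_christoffel (y := fun _ ↦ y₀) hγ hinv contDiffAt_const ha hb
  have h2 : ∀ a b c : E, ContDiffAt ℝ ∞
      (fun d ↦ fderiv ℝ (fun z ↦ LocalGeom.christoffel (γ d) z a b) y₀ c) d₀ := fun a b c ↦
    contDiffAt_fderiv_apply (f := fun d z ↦ LocalGeom.christoffel (γ d) z a b) (y := fun _ ↦ y₀)
      (contDiffAt_christoffel (D := D × E) (γ := fun p ↦ γ p.1) (y := Prod.snd)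
        (contDiffAt_comp_fst hγ) hinv contDiffAt_snd contDiffAt_const contDiffAt_const)
      contDiffAt_const contDiffAt_const
  exact (((h2 _ _ _).sub (h2 _ _ _)).add (h1 contDiffAt_const (h1 contDiffAt_const
    contDiffAt_const))).sub (h1 contDiffAt_const (h1 contDiffAt_const contDiffAt_const))

lemma contDiffAt_ricci (v w : E) : ContDiffAt ℝ ∞ (fun d ↦ LocalGeom.ricci (γ d) y₀ v w) d₀ :=
  ContDiffAt.sum fun i _ ↦ (LinearMap.toContinuousLinearMap
    ((Module.finBasis ℝ E).coord i)).contDiff.contDiffAt.comp d₀ (contDiffAt_riemann hγ hinv _ v w)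

lemma contDiffAt_sharpDual (i : Fin (Module.finrank ℝ E)) :
    ContDiffAt ℝ ∞ (fun d ↦ LocalGeom.sharpDual (γ d y₀) i) d₀ := by
  have h1 : ContDiffAt ℝ ∞ (fun d ↦ γ d y₀) d₀ :=
    ContDiffAt.comp (g := fun p : D × E ↦ γ p.1 p.2) (f := fun d ↦ (d, y₀)) d₀ hγ
      (contDiffAt_id.prodMk contDiffAt_const)
  exact (ContDiffAt.comp (g := ContinuousLinearMap.inverse) (f := fun d ↦ γ d y₀) d₀
      hinv.contDiffAt_map_inverse h1).clm_apply contDiffAt_const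

variable {η : D → E → E [⋀^Fin 3]→L[ℝ] ℝ}
  (hη : ContDiffAt ℝ ∞ (fun p : D × E ↦ η p.1 p.2) (d₀, y₀))

include hη

omit hγ hinv in
lemma contDiffAt_form_apply {u v w : D → E} (hu : ContDiffAt ℝ ∞ u d₀) (hv : ContDiffAt ℝ ∞ v d₀)
    (hw : ContDiffAt ℝ ∞ w d₀) : ContDiffAt ℝ ∞ (fun d ↦ η d y₀ ![u d, v d, w d]) d₀ := by
  have h1 : ContDiffAt ℝ ∞ (fun d ↦ η d y₀) d₀ :=
    ContDiffAt.comp (g := fun p : D × E ↦ η p.1 p.2) (f := fun d ↦ (d, y₀)) d₀ hη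
      (contDiffAt_id.prodMk contDiffAt_const)
  exact contDiffAt_alternating_apply h1 fun i ↦ by fin_cases i <;> assumption

lemma contDiffAt_formSq (v w : E) :
    ContDiffAt ℝ ∞ (fun d ↦ LocalGeom.formSq (γ d y₀) (η d y₀) v w) d₀ :=
  ContDiffAt.sum fun i _ ↦ ContDiffAt.sum fun j _ ↦
    (contDiffAt_form_apply hη contDiffAt_const contDiffAt_const contDiffAt_const).mul
      (contDiffAt_form_apply hη contDiffAt_const (contDiffAt_sharpDual hγ hinv i)
        (contDiffAt_sharpDual hγ hinv j))

lemma contDiffAt_codiff (v w : E) :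
    ContDiffAt ℝ ∞ (fun d ↦ LocalGeom.codiff (γ d) (η d) y₀ v w) d₀ := by
  have h1 : ∀ {a b : D → E}, ContDiffAt ℝ ∞ a d₀ → ContDiffAt ℝ ∞ b d₀ →
      ContDiffAt ℝ ∞ (fun d ↦ LocalGeom.christoffel (γ d) y₀ (a d) (b d)) d₀ := fun ha hb ↦
    contDiffAt_christoffel (y := fun _ ↦ y₀) hγ hinv contDiffAt_const ha hb
  refine (ContDiffAt.sum fun i _ ↦ ?_).neg
  have hs := contDiffAt_sharpDual hγ hinv i
  have h2 : ContDiffAt ℝ ∞ (fun d ↦ fderiv ℝ (η d) y₀ (Module.finBasis ℝ E i)) d₀ :=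
    contDiffAt_fderiv_apply (y := fun _ ↦ y₀) hη contDiffAt_const contDiffAt_const
  have h3 : ContDiffAt ℝ ∞ (fun d ↦ fderiv ℝ (η d) y₀ (Module.finBasis ℝ E i)
      ![LocalGeom.sharpDual (γ d y₀) i, v, w]) d₀ :=
    contDiffAt_alternating_apply h2 fun j ↦ by
      fin_cases j
      · exact hs
      · exact contDiffAt_const
      · exact contDiffAt_const
  exact ((h3.sub (contDiffAt_form_apply hη (h1 contDiffAt_const hs) contDiffAt_const
    contDiffAt_const)).sub (contDiffAt_form_apply hη hs (h1 contDiffAt_const contDiffAt_const)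
      contDiffAt_const)).sub (contDiffAt_form_apply hη hs contDiffAt_const
        (h1 contDiffAt_const contDiffAt_const))

end Metric

section Congr

variable {γ γ' : E → E →L[ℝ] E →L[ℝ] ℝ} {y : E}

omit [FiniteDimensional ℝ E] in
lemma christoffel_congr (h : γ =ᶠ[𝓝 y] γ') :
    LocalGeom.christoffel γ y = LocalGeom.christoffel γ' y := by
  funext u v
  rw [LocalGeom.christoffel, LocalGeom.christoffel, h.fderiv_eq, h.self_of_nhds]

/-- The Ricci tensor at a point depends only on the germ of the metric there. -/
lemma ricci_congr (h : γ =ᶠ[𝓝 y] γ') (v w : E) :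
    LocalGeom.ricci γ y v w = LocalGeom.ricci γ' y v w := by
  have h1 : ∀ a b, (fun z ↦ LocalGeom.christoffel γ z a b) =ᶠ[𝓝 y]
      fun z ↦ LocalGeom.christoffel γ' z a b := fun a b ↦
    h.eventually_nhds.mono fun z hz ↦ by
      simp only [christoffel_congr hz]
  simp only [LocalGeom.ricci, LocalGeom.riemann, christoffel_congr h, (h1 _ _).fderiv_eq]

lemma codiff_congr {η η' : E → E [⋀^Fin 3]→L[ℝ] ℝ} (h : γ =ᶠ[𝓝 y] γ') (hη : η =ᶠ[𝓝 y] η')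
    (v w : E) : LocalGeom.codiff γ η y v w = LocalGeom.codiff γ' η' y v w := by
  simp only [LocalGeom.codiff, LocalGeom.covDeriv, christoffel_congr h, hη.fderiv_eq,
    hη.self_of_nhds, h.self_of_nhds]

end Congr

end GRF

/-! ## The geometry of invariant tensors -/

namespace GRF

variable {E : Type*} [NormedAddCommGroup E] [NormedSpace ℝ E]

section Pullback

variable {L M N : Type*} [TopologicalSpace L] [ChartedSpace E L] [TopologicalSpace M]
  [ChartedSpace E M] [TopologicalSpace N] [ChartedSpace E N] {k : ℕ}

lemma pullForm_congr {f f' : N → M} {x : N} (h : f =ᶠ[𝓝 x] f') (θ : FormField E M k) :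
    pullForm f θ x = pullForm f' θ x := by
  let Θ : M → E [⋀^Fin k]→L[ℝ] ℝ := θ
  let A : (N → M) → E →L[ℝ] E := fun f ↦ mfderiv 𝓘(ℝ, E) 𝓘(ℝ, E) f x
  have hA : A f = A f' := h.mfderiv_eq
  change (Θ (f x)).compContinuousLinearMap (A f) = (Θ (f' x)).compContinuousLinearMap (A f')
  rw [hA, h.self_of_nhds]

lemma pullForm_pullForm {f : N → M} {h : L → N} {x : L}
    (hf : MDifferentiableAt 𝓘(ℝ, E) 𝓘(ℝ, E) f (h x))
    (hh : MDifferentiableAt 𝓘(ℝ, E) 𝓘(ℝ, E) h x) (θ : FormField E M k) :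
    pullForm h (pullForm f θ) x = pullForm (f ∘ h) θ x := by
  have hc : mfderiv 𝓘(ℝ, E) 𝓘(ℝ, E) (f ∘ h) x =
    (mfderiv 𝓘(ℝ, E) 𝓘(ℝ, E) f (h x)).comp (mfderiv 𝓘(ℝ, E) 𝓘(ℝ, E) h x) :=
      mfderiv_comp (I' := 𝓘(ℝ, E)) x hf hh
  simp only [pullForm, hc]
  rfl

end Pullback

section Manifold

variable {M : Type*} [TopologicalSpace M] [ChartedSpace E M] {k : ℕ}

lemma formInChart_add (θ θ' : FormField E M k) (x₀ : M) :
    formInChart (θ + θ') x₀ = formInChart θ x₀ + formInChart θ' x₀ := rfl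

lemma SmoothForm.contDiffAt {θ : FormField E M k} (h : SmoothForm θ) {x₀ : M} {y : E}
    (hy : y ∈ (extChartAt 𝓘(ℝ, E) x₀).target) : ContDiffAt ℝ ∞ (formInChart θ x₀) y :=
  (h x₀).contDiffAt (chart_target_mem_nhds hy)

lemma SmoothForm.differentiableAt {θ : FormField E M k} (h : SmoothForm θ) {x₀ : M} {y : E}
    (hy : y ∈ (extChartAt 𝓘(ℝ, E) x₀).target) : DifferentiableAt ℝ (formInChart θ x₀) y :=
  (h.contDiffAt hy).differentiableAt (by simp)

lemma extD_add {θ θ' : FormField E M k} (h : SmoothForm θ) (h' : SmoothForm θ') :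
    extD (θ + θ') = extD θ + extD θ' := by
  funext x
  have hy := mem_extChartAt_target (I := 𝓘(ℝ, E)) x
  simp only [extD, formInChart_add, Pi.add_apply,
    extDeriv_add (h.differentiableAt hy) (h'.differentiableAt hy)]
  rfl

variable [IsManifold 𝓘(ℝ, E) ∞ M]

/-- The exterior derivative does not depend on the chart. -/
theorem formInChart_extD {θ : FormField E M k} (hθ : SmoothForm θ) {x₀ : M} {y : E}
    (hy : y ∈ (extChartAt 𝓘(ℝ, E) x₀).target) :
    formInChart (extD θ) x₀ y = extDeriv (formInChart θ x₀) y := by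
  obtain ⟨x, hx⟩ : ∃ x, x = (extChartAt 𝓘(ℝ, E) x₀).symm y := ⟨_, rfl⟩
  have hxs := mem_extChartAt_source (I := 𝓘(ℝ, E)) x
  let T : E → E := extChartAt 𝓘(ℝ, E) x ∘ (extChartAt 𝓘(ℝ, E) x₀).symm
  have hTy : T y = extChartAt 𝓘(ℝ, E) x x := by simp only [T, Function.comp_apply, ← hx]
  have hT : ContDiffAt ℝ ∞ T y := by
    rw [← contMDiffAt_iff_contDiffAt]
    exact ContMDiffAt.comp (g := extChartAt 𝓘(ℝ, E) x) (I' := 𝓘(ℝ, E)) _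
      (contMDiffAt_chart (by rwa [← hx])) (contMDiffAt_chart_symm hy)
  have hev : ∀ᶠ z in 𝓝 y, z ∈ (extChartAt 𝓘(ℝ, E) x₀).target ∧
      (extChartAt 𝓘(ℝ, E) x₀).symm z ∈ (extChartAt 𝓘(ℝ, E) x).source := by
    refine (Filter.eventually_of_mem (chart_target_mem_nhds hy) fun z hz ↦ hz).and ?_
    refine (contMDiffAt_chart_symm hy).continuousAt.eventually (chart_source_mem_nhds ?_)
    rwa [← hx]
  have hpull : formInChart θ x₀ =ᶠ[𝓝 y]
      fun z ↦ (formInChart θ x (T z)).compContinuousLinearMap (fderiv ℝ T z) := by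
    filter_upwards [hev.eventually_nhds] with z hz
    have hz0 := hz.self_of_nhds
    have hTz : MDifferentiableAt 𝓘(ℝ, E) 𝓘(ℝ, E) T z :=
      MDifferentiableAt.comp (g := extChartAt 𝓘(ℝ, E) x) (I' := 𝓘(ℝ, E)) z
        (mdifferentiableAt_chart hz0.2) (mdifferentiableAt_chart_symm hz0.1)
    have h1 := pullForm_pullForm (f := (extChartAt 𝓘(ℝ, E) x).symm) (h := T) (x := z)
      (mdifferentiableAt_chart_symm ((extChartAt 𝓘(ℝ, E) x).map_source hz0.2))
      hTz θ
    have h2 : (extChartAt 𝓘(ℝ, E) x).symm ∘ T =ᶠ[𝓝 z] (extChartAt 𝓘(ℝ, E) x₀).symm :=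
      hz.mono fun w hw ↦ (extChartAt 𝓘(ℝ, E) x).left_inv hw.2
    rw [pullForm_congr h2] at h1
    rw [← mfderiv_eq_fderiv]
    exact h1.symm
  -- Near y the two chart expressions differ by the pullback along the transition map T, and the
  -- exterior derivative commutes with pullbacks.
  rw [hpull.extDeriv_eq, extDeriv_pullback (r := ∞) (hθ.differentiableAt ?_) hT
    (by simpa using ENat.LEInfty.out), hTy]
  · let A : M → E →L[ℝ] E := fun x' ↦ mfderiv 𝓘(ℝ, E) 𝓘(ℝ, E) (extChartAt 𝓘(ℝ, E) x) x'
    have h3 : fderiv ℝ T y = (A ((extChartAt 𝓘(ℝ, E) x₀).symm y)).comp (mfderiv 𝓘(ℝ, E) 𝓘(ℝ, E)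
        (extChartAt 𝓘(ℝ, E) x₀).symm y : E →L[ℝ] E) := by
      rw [← mfderiv_eq_fderiv]
      exact mfderiv_comp (I' := 𝓘(ℝ, E)) (g := extChartAt 𝓘(ℝ, E) x) y
        (mdifferentiableAt_chart (by rwa [← hx])) (mdifferentiableAt_chart_symm hy)
    rw [h3]
    have h5 : formInChart (extD θ) x₀ y = (extD θ ((extChartAt 𝓘(ℝ, E) x₀).symm y) :
      E [⋀^Fin (k + 1)]→L[ℝ] ℝ).compContinuousLinearMap
        (mfderiv 𝓘(ℝ, E) 𝓘(ℝ, E) (extChartAt 𝓘(ℝ, E) x₀).symm y : E →L[ℝ] E) := rfl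
    rw [h5, ← hx]
    rfl
  · rw [hTy]; exact mem_extChartAt_target x

lemma contDiffAt_extDeriv {α : E → E [⋀^Fin k]→L[ℝ] ℝ} {y : E} (h : ContDiffAt ℝ ∞ α y) :
    ContDiffAt ℝ ∞ (extDeriv α) y :=
  ContDiffAt.comp (g := ContinuousAlternatingMap.alternatizeUncurryFinCLM (n := k) ℝ E ℝ) y
    (ContinuousLinearMap.contDiff _).contDiffAt (h.fderiv_right (m := ∞) (by simp))

end Manifold

lemma IsONFrame.isLie {ι : Type*} [Fintype ι] [DecidableEq ι] {q : E →L[ℝ] E →L[ℝ] ℝ} {e : ι → E}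
    {ε : ι → E →L[ℝ] ℝ} (he : IsONFrame q e ε) {br : E →L[ℝ] E →L[ℝ] E}
    (hbr : Frame.IsLieBracket br) : Frame.IsLie (fun i j k ↦ ε k (br (e i) (e j))) :=
  Frame.State.IsDual.isLie (x := (e, ε, fun _ _ ↦ 0)) ⟨he.complete, by simp⟩ hbr

section Invariant

variable [FiniteDimensional ℝ E]
  {G : Type*} [Group G] [TopologicalSpace G] [ChartedSpace E G] [LieGroup 𝓘(ℝ, E) ∞ G]
  {M : Type*} [TopologicalSpace M] [ChartedSpace E M] [IsManifold 𝓘(ℝ, E) ∞ M]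
  {Γ : Subgroup G} {π : G → M}

/-- The form `θ` lifts to the left-invariant form that is `p` on the Lie algebra. -/
def LiftsTo {k : ℕ} (π : G → M) (θ : FormField E M k) (p : E [⋀^Fin k]→L[ℝ] ℝ) : Prop :=
  ∀ x, ∀ v : Fin k → E, θ x (fun i ↦ lift π x (v i)) = p v

/-- The metric `g` lifts to the left-invariant metric that is `q` on the Lie algebra. -/
def MetricLiftsTo (π : G → M) (g : Metric E M) (q : E →L[ℝ] E →L[ℝ] ℝ) : Prop :=
  ∀ x, ∀ v w : E, g.inner x (lift π x v) (lift π x w) = q v w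

omit [FiniteDimensional ℝ E] [LieGroup 𝓘(ℝ, E) ∞ G] [IsManifold 𝓘(ℝ, E) ∞ M] in
lemma LiftsTo.add {k : ℕ} {θ θ' : FormField E M k} {p p' : E [⋀^Fin k]→L[ℝ] ℝ}
    (h : LiftsTo π θ p) (h' : LiftsTo π θ' p') : LiftsTo π (θ + θ') (p + p') := fun x v ↦
  congrArg₂ (· + ·) (h x v) (h' x v)

namespace IsQuotient

variable (hπ : IsQuotient (E := E) Γ π) {k : ℕ} {θ : FormField E M k} {p : E [⋀^Fin k]→L[ℝ] ℝ}
  {g : Metric E M} {q : E →L[ℝ] E →L[ℝ] ℝ} {x₀ x : M} {y : E}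

include hπ

lemma formInChart_eq (hp : LiftsTo π θ p) (hy : y ∈ (extChartAt 𝓘(ℝ, E) x₀).target) :
    formInChart θ x₀ y = p.compContinuousLinearMap (frameInv π x₀ y) := by
  ext v
  have h := hπ.formInChart_frameMap hp hy (fun i ↦ frameInv π x₀ y (v i))
  simp only [(hπ.movingFrame x₀).right_inv y hy] at h
  exact h

lemma bilinInChart_eq (hq : MetricLiftsTo π g q) (hy : y ∈ (extChartAt 𝓘(ℝ, E) x₀).target)
    (v w : E) : bilinInChart g.inner x₀ y v w = q (frameInv π x₀ y v) (frameInv π x₀ y w) := by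
  have h := hπ.bilinInChart_frameMap hq hy (frameInv π x₀ y v) (frameInv π x₀ y w)
  rwa [(hπ.movingFrame x₀).right_inv y hy, (hπ.movingFrame x₀).right_inv y hy] at h

section Smooth

variable {D : Type*} [NormedAddCommGroup D] [NormedSpace ℝ D] {s : Set D}

lemma contDiffOn_frameInv_snd : ContDiffOn ℝ ∞ (fun z : D × E ↦ frameInv π x₀ z.2)
    (s ×ˢ (extChartAt 𝓘(ℝ, E) x₀).target) :=
  ContDiffOn.comp (g := frameInv π x₀) (f := Prod.snd) (hπ.movingFrame x₀).smooth_inv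
    contDiffOn_snd fun _ hz ↦ hz.2

lemma contDiffOn_formInChart {θ : D → FormField E M k} {p : D → E [⋀^Fin k]→L[ℝ] ℝ}
    (hp : ∀ d ∈ s, LiftsTo π (θ d) (p d)) (hs : ContDiffOn ℝ ∞ p s) :
    ContDiffOn ℝ ∞ (fun z : D × E ↦ formInChart (θ z.1) x₀ z.2)
      (s ×ˢ (extChartAt 𝓘(ℝ, E) x₀).target) :=
  ContDiffOn.congr (contDiffOn_pullback_form
    (hs.comp contDiffOn_fst fun _ hz ↦ hz.1) hπ.contDiffOn_frameInv_snd)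
    fun z hz ↦ hπ.formInChart_eq (hp z.1 hz.1) hz.2

lemma contDiffOn_bilinInChart {g : D → Metric E M} {q : D → E →L[ℝ] E →L[ℝ] ℝ}
    (hq : ∀ d ∈ s, MetricLiftsTo π (g d) (q d))
    (hs : ContDiffOn ℝ ∞ (fun d ↦ q d) s) :
    ContDiffOn ℝ ∞ (fun z : D × E ↦ bilinInChart (g z.1).inner x₀ z.2)
      (s ×ˢ (extChartAt 𝓘(ℝ, E) x₀).target) := by
  refine contDiffOn_bilin fun v w ↦ ?_
  have h := hπ.contDiffOn_frameInv_snd (x₀ := x₀) (s := s)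
  exact (((hs.comp contDiffOn_fst fun _ hz ↦ hz.1).clm_apply (h.clm_apply contDiffOn_const)).clm_apply
    (h.clm_apply contDiffOn_const)).congr fun z hz ↦ hπ.bilinInChart_eq (hq z.1 hz.1) hz.2 v w

end Smooth

lemma smoothForm (hp : LiftsTo π θ p) : SmoothForm θ := fun x₀ ↦
  (contDiffOn_pullback_form contDiffOn_const (hπ.movingFrame x₀).smooth_inv).congr
    fun _ hz ↦ hπ.formInChart_eq hp hz

lemma smoothMetric (hq : MetricLiftsTo π g q) : SmoothMetric g := fun x₀ ↦
  contDiffOn_bilin fun v w ↦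
    ((contDiffOn_const.clm_apply ((hπ.movingFrame x₀).smooth_inv.clm_apply contDiffOn_const)).clm_apply
      ((hπ.movingFrame x₀).smooth_inv.clm_apply contDiffOn_const)).congr
        fun _ hz ↦ hπ.bilinInChart_eq hq hz v w

lemma isLieBracket : Frame.IsLieBracket (lieBr E G) :=
  have := FiniteDimensional.complete ℝ E
  (hπ.movingFrame (π 1)).isLieBracket (mem_extChartAt_target (π 1))

section Curvature

variable {ι : Type*} [Fintype ι] [DecidableEq ι] {e : ι → E} {ε : ι → E →L[ℝ] ℝ}
  (he : IsONFrame q e ε) (hq : MetricLiftsTo π g q)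

include he

include hq

theorem ricci_lift (x : M) (v w : E) : ricci g x (lift π x v) (lift π x w) =
    ∑ i, ∑ j, (Frame.ricStar (fun i j k ↦ ε k (lieBr E G (e i) (e j))) i j
      - Frame.symAd (fun i j k ↦ ε k (lieBr E G (e i) (e j))) i j) * (ε i v * ε j w) := by
  rw [ricci, hπ.dChart_lift, hπ.dChart_lift]
  exact (hπ.movingFrame x).ricci_frame (mem_extChartAt_target x) he (hπ.smoothMetric hq x)
    (fun z hz ↦ hπ.bilinInChart_frameMap hq hz) hπ.isLieBracket.anti
    (he.isLie hπ.isLieBracket) v w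

variable {η : FormField E M 3} {p : E [⋀^Fin 3]→L[ℝ] ℝ} (hη : LiftsTo π η p)

include hη

theorem formSq_lift (x : M) (v w : E) : formSq g η x (lift π x v) (lift π x w) =
    ∑ i, ∑ j, Frame.hSq (fun i j k ↦ triLin p (e i) (e j) (e k)) i j * (ε i v * ε j w) := by
  rw [formSq, hπ.dChart_lift, hπ.dChart_lift]
  exact (hπ.movingFrame x).formSq_frame (mem_extChartAt_target x) he
    (fun z hz ↦ hπ.bilinInChart_frameMap hq hz) (fun z hz ↦ hπ.formInChart_frameMap hη hz) v w

theorem codiff_lift (x : M) (v w : E) : codiff g η x (lift π x v) (lift π x w) =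
    ∑ i, ∑ j, Frame.codiff (fun i j k ↦ ε k (lieBr E G (e i) (e j)))
      (fun i j k ↦ triLin p (e i) (e j) (e k)) i j * (ε i v * ε j w) := by
  rw [codiff, hπ.dChart_lift, hπ.dChart_lift]
  exact (hπ.movingFrame x).codiff_frame (mem_extChartAt_target x) he (hπ.smoothMetric hq x)
    (fun z hz ↦ hπ.bilinInChart_frameMap hq hz) hπ.isLieBracket.anti
    (he.isLie hπ.isLieBracket) (hπ.smoothForm hη x)
    (fun z hz ↦ hπ.formInChart_frameMap hη hz) v w

end Curvature

/-- The exterior derivative of an invariant `2`-form. -/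
theorem exists_liftsTo_extD {β : FormField E M 2} {p : E [⋀^Fin 2]→L[ℝ] ℝ} (hβ : LiftsTo π β p) :
    ∃ P : E [⋀^Fin 3]→L[ℝ] ℝ, LiftsTo π (extD β) P ∧ ∀ u v w, triLin P u v w =
      -p ![lieBr E G u v, w] + p ![lieBr E G u w, v] - p ![lieBr E G v w, u] := by
  have h : ∀ x u v w, extD β x (fun i ↦ lift π x (![u, v, w] i)) =
      -p ![lieBr E G u v, w] + p ![lieBr E G u w, v] - p ![lieBr E G v w, u] := fun x u v w ↦ by
    have h1 := (hπ.movingFrame x).extDeriv_two_frame (mem_extChartAt_target x)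
      (hπ.smoothForm hβ x) (fun z hz ↦ hπ.formInChart_frameMap hβ hz) u v w
    rw [← h1]
    change extDeriv (formInChart β x) _ (fun i ↦ dChart x (lift π x (![u, v, w] i))) = _
    congr 1
    funext i
    rw [hπ.dChart_lift]
    fin_cases i <;> rfl
  have h' : ∀ v : Fin 3 → E, v = ![v 0, v 1, v 2] := fun v ↦ by
    ext i; fin_cases i <;> rfl
  -- The right side of `h` does not involve the point, so the value at one point determines the form
  -- everywhere.
  refine ⟨(extD β (π 1)).compContinuousLinearMap (lift π (π 1)), fun x v ↦ ?_, fun u v w ↦ h _ u v w⟩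
  rw [h' v, h]
  exact (h (π 1) _ _ _).symm

/-- An invariant closed `3`-form is closed on the Lie algebra. -/
theorem isClosedThree {H : FormField E M 3} {b₀ : FormField E M 2} (hH : SmoothForm H)
    (hdH : extD H = 0) (hb : SmoothForm b₀) {p : E [⋀^Fin 3]→L[ℝ] ℝ}
    (hp : LiftsTo π (H + extD b₀) p) :
    Frame.IsClosedThree (lieBr E G) (fun u v w ↦ triLin p u v w) := by
  refine ⟨triLin_anti₁ p, triLin_anti₂ p, fun u v w z ↦ ?_⟩
  set x : M := π 1
  have hy := mem_extChartAt_target (I := 𝓘(ℝ, E)) x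
  have h1 := (hπ.movingFrame x).extDeriv_three_frame hy
    (hπ.smoothForm hp x) (fun z hz ↦ hπ.formInChart_frameMap hp hz) u v w z
  -- Only the sum H + db₀ is invariant. Its closedness is seen in the chart, from dH = 0 and d² = 0,
  -- and then read off in the frame.
  have h2 : formInChart (H + extD b₀) x =ᶠ[𝓝 (extChartAt 𝓘(ℝ, E) x x)]
      formInChart H x + extDeriv (formInChart b₀ x) :=
    Filter.eventually_of_mem (chart_target_mem_nhds hy) fun z hz ↦ by
      rw [formInChart_add, Pi.add_apply, formInChart_extD hb hz]; rfl
  have h3 : extDeriv (formInChart H x) (extChartAt 𝓘(ℝ, E) x x) = 0 := by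
    ext v
    have h4 := congrFun hdH x
    have h5 : ∀ v : E, dChart x (lift π x (frameInv π x (extChartAt 𝓘(ℝ, E) x x) v)) = v :=
      fun v ↦ by rw [hπ.dChart_lift, (hπ.movingFrame x).right_inv _ hy]
    have h6 := congrArg (fun L : E [⋀^Fin 4]→L[ℝ] ℝ ↦
      L (fun i ↦ lift π x (frameInv π x (extChartAt 𝓘(ℝ, E) x x) (v i)))) h4
    change extDeriv (formInChart H x) _ (fun i ↦ dChart x _) = 0 at h6
    simp only [h5] at h6
    exact h6
  rw [h2.extDeriv_eq, extDeriv_add (hH.differentiableAt hy)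
    ((contDiffAt_extDeriv (hb.contDiffAt hy)).differentiableAt (by simp)), h3,
    extDeriv_extDeriv_apply (hb.contDiffAt hy) (by simpa using ENat.LEInfty.out)] at h1
  rw [add_zero] at h1
  change (0 : ℝ) = _ at h1
  linarith

end IsQuotient

end Invariant

end GRF

/-! ## Existence of invariant solutions -/

namespace GRF

variable {E : Type*} [NormedAddCommGroup E] [NormedSpace ℝ E] {ι : Type*} [Fintype ι]
  [DecidableEq ι]

omit [DecidableEq ι] in
-- The velocity of the metric Σ εᵢ ⊗ εᵢ is −2P, which is −2Ric + ½H²; the symmetry of P merges the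
-- two product-rule terms.
lemma Frame.sum_speed (c h : ι → ι → ι → ℝ) (a b : ι → ℝ) :
    ∑ i, (1 * (-∑ j, Frame.speed c h i j * a j) * b i
      + a i * (1 * -∑ j, Frame.speed c h i j * b j)) =
    -2 * (∑ i, ∑ j, (Frame.ricStar c i j - Frame.symAd c i j) * (a i * b j))
      + 1 / 2 * ∑ i, ∑ j, Frame.hSq h i j * (a i * b j) := by
  have h1 : ∑ i, ∑ j, Frame.speed c h i j * (a j * b i) =
      ∑ i, ∑ j, Frame.speed c h i j * (a i * b j) := by
    rw [Finset.sum_comm]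
    exact Finset.sum_congr rfl fun i _ ↦ Finset.sum_congr rfl fun j _ ↦ by rw [Frame.speed_symm]
  have h2 : ∑ i, (1 * (-∑ j, Frame.speed c h i j * a j) * b i
      + a i * (1 * -∑ j, Frame.speed c h i j * b j)) =
      -(∑ i, ∑ j, Frame.speed c h i j * (a j * b i)) - ∑ i, ∑ j, Frame.speed c h i j * (a i * b j) := by
    rw [← Finset.sum_neg_distrib, ← Finset.sum_sub_distrib]
    refine Finset.sum_congr rfl fun i _ ↦ ?_
    simp only [one_mul, neg_mul, mul_neg, Finset.sum_mul, Finset.mul_sum, ← sub_eq_add_neg]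
    exact congrArg₂ (fun a b ↦ -a - b) (Finset.sum_congr rfl fun j _ ↦ by ring)
      (Finset.sum_congr rfl fun j _ ↦ by ring)
  rw [h2, h1]
  simp only [Finset.mul_sum, ← Finset.sum_neg_distrib, ← Finset.sum_sub_distrib,
    ← Finset.sum_add_distrib]
  refine Finset.sum_congr rfl fun i _ ↦ Finset.sum_congr rfl fun j _ ↦ ?_
  rw [Frame.speed, Frame.speedStar]
  ring

namespace IsONFrame

variable {q : E →L[ℝ] E →L[ℝ] ℝ} {e : ι → E} {ε : ι → E →L[ℝ] ℝ} (he : IsONFrame q e ε)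

include he

lemma tri_eq (p : E [⋀^Fin 3]→L[ℝ] ℝ) :
    Frame.tri ε (fun i j k ↦ triLin p (e i) (e j) (e k)) = fun u v w ↦ triLin p u v w := by
  funext u v w
  rw [he.expand (triLin p u v) w, Frame.tri]
  refine Finset.sum_congr rfl fun k _ ↦ ?_
  have h := he.expand₂ ((triLin p).compr₂ (LinearMap.applyₗ (e k))) u v
  simp only [LinearMap.compr₂_apply, LinearMap.applyₗ_apply_apply] at h
  rw [h, Frame.bil_apply, mul_comm]

/-- This is the compatibility of the unit balls with the topology demanded by
`Bundle.RiemannianMetric`. -/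
lemma isVonNBounded : Bornology.IsVonNBounded ℝ {v : E | q v v < 1} := by
  rw [NormedSpace.isVonNBounded_iff']
  refine ⟨∑ i, ‖e i‖, fun v hv ↦ ?_⟩
  have h1 : ∀ i, |ε i v| ≤ 1 := fun i ↦ by
    have h2 : ε i v * ε i v ≤ q v v := by
      rw [he.metric]
      exact Finset.single_le_sum (f := fun i ↦ ε i v * ε i v) (fun j _ ↦ mul_self_nonneg _)
        (Finset.mem_univ i)
    have h3 : q v v < 1 := hv
    rw [abs_le]
    constructor <;> nlinarith
  rw [← he.complete v]
  refine (norm_sum_le _ _).trans (Finset.sum_le_sum fun i _ ↦ ?_)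
  rw [norm_smul, Real.norm_eq_abs]
  exact mul_le_of_le_one_left (norm_nonneg _) (h1 i)

end IsONFrame

/-- The pullback of a bilinear form along a linear map. -/
def pullInner {V : Type*} [AddCommGroup V] [Module ℝ V] [TopologicalSpace V]
    (q : E →L[ℝ] E →L[ℝ] ℝ) (D : V →L[ℝ] E) : V →L[ℝ] V →L[ℝ] ℝ := (D.precomp ℝ).comp (q.comp D)

omit [Fintype ι] [DecidableEq ι] in
lemma pullInner_apply {V : Type*} [AddCommGroup V] [Module ℝ V] [TopologicalSpace V]
    (q : E →L[ℝ] E →L[ℝ] ℝ) (D : V →L[ℝ] E) (v w : V) : pullInner q D v w = q (D v) (D w) := rfl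

/-- The metric of an orthonormal frame. -/
def frameMetric (ε : ι → E →L[ℝ] ℝ) : E →L[ℝ] E →L[ℝ] ℝ := ∑ i, (ε i).smulRight (ε i)

omit [DecidableEq ι] in
lemma frameMetric_apply (ε : ι → E →L[ℝ] ℝ) (v w : E) :
    frameMetric ε v w = ∑ i, ε i v * ε i w := by
  simp [frameMetric]

lemma Frame.State.IsDual.isONFrame {x : Frame.State ι E} (hx : x.IsDual)
    (hcard : Fintype.card ι = Module.finrank ℝ E) : IsONFrame (frameMetric x.2.1) x.1 x.2.1 where
  complete := hx.complete
  dual := hx.apply hcard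
  metric := frameMetric_apply _

variable [FiniteDimensional ℝ E]
  {G : Type*} [Group G] [TopologicalSpace G] [ChartedSpace E G] [LieGroup 𝓘(ℝ, E) ∞ G]
  {M : Type*} [TopologicalSpace M] [ChartedSpace E M] [IsManifold 𝓘(ℝ, E) ∞ M]
  {Γ : Subgroup G} {π : G → M}

omit [FiniteDimensional ℝ E] [IsManifold 𝓘(ℝ, E) ∞ M] in
lemma metric_ext {g g' : Metric E M} (h : ∀ x u v, g.inner x u v = g'.inner x u v) : g = g' := by
  have h' : g.inner = g'.inner := by
    funext x; ext u v; exact h x u v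
  cases g; cases g'; cases h'; rfl

namespace IsQuotient

variable (hπ : IsQuotient (E := E) Γ π)

include hπ

/-- The invariant metric of an orthonormal frame of the Lie algebra. -/
def metricOf {q : E →L[ℝ] E →L[ℝ] ℝ} {e : ι → E} {ε : ι → E →L[ℝ] ℝ} (he : IsONFrame q e ε) :
    Metric E M where
  inner x := pullInner q (unlift π x)
  symm x v w := by rw [pullInner_apply, pullInner_apply, he.symm]
  pos x v hv := by
    rw [pullInner_apply]
    exact he.pos _ fun h ↦ hv (by rw [← hπ.lift_unlift x v, h, map_zero])
  continuousAt x := by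
    simp only [pullInner_apply]
    have h : Continuous fun v : E ↦ q v v := by fun_prop
    exact (h.comp (unlift π x).continuous).continuousAt
  isVonNBounded x := by
    have h : Bornology.IsVonNBounded ℝ (lift π x '' {v : E | q v v < 1}) :=
      he.isVonNBounded.image (lift π x)
    have h2 : {v : TangentSpace 𝓘(ℝ, E) x | pullInner q (unlift π x) v v < 1} ⊆
        lift π x '' {v : E | q v v < 1} := fun v hv ↦ ⟨unlift π x v, hv, hπ.lift_unlift x v⟩
    exact h.subset h2

lemma metricLiftsTo_metricOf {q : E →L[ℝ] E →L[ℝ] ℝ} {e : ι → E} {ε : ι → E →L[ℝ] ℝ}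
    (he : IsONFrame q e ε) : MetricLiftsTo π (hπ.metricOf he) q := fun x v w ↦ by
  rw [metricOf, pullInner_apply, hπ.unlift_lift, hπ.unlift_lift]

omit hπ in
/-- The invariant form that is `p` on the Lie algebra. -/
def formOf {k : ℕ} (π : G → M) (p : E [⋀^Fin k]→L[ℝ] ℝ) : FormField E M k :=
  fun x ↦ p.compContinuousLinearMap (unlift π x)

lemma liftsTo_formOf {k : ℕ} (p : E [⋀^Fin k]→L[ℝ] ℝ) : LiftsTo π (formOf π p) p := fun x v ↦ by
  change p (fun i ↦ unlift π x (lift π x (v i))) = _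
  simp only [hπ.unlift_lift]

lemma exists_isONFrame_of_lift {g : Metric E M} {q : E →L[ℝ] E →L[ℝ] ℝ}
    (hq : MetricLiftsTo π g q) : ∃ (e : Fin (Module.finrank ℝ E) → E)
      (ε : Fin (Module.finrank ℝ E) → E →L[ℝ] ℝ), IsONFrame q e ε := by
  refine exists_isONFrame (fun v w ↦ ?_) fun v hv ↦ ?_
  · rw [← hq (π 1), ← hq (π 1), g.symm]
  · rw [← hq (π 1)]
    refine g.pos _ _ fun h ↦ hv ?_
    rw [← hπ.unlift_lift (π 1) v, h, map_zero]

/-- The torsion of an invariant `2`-form. -/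
lemma exists_torsion {H : FormField E M 3} {b₀ : FormField E M 2} (hb₀ : SmoothForm b₀)
    {p₀ : E [⋀^Fin 3]→L[ℝ] ℝ} (hp₀ : LiftsTo π (H + extD b₀) p₀) {κ : ι → E →L[ℝ] ℝ}
    {f : ι → E} {q₀ : E →L[ℝ] E →L[ℝ] ℝ} (hκ : IsONFrame q₀ f κ) {x : Frame.State ι E}
    (hx : ∀ i j, x.2.2 i j = -x.2.2 j i) :
    ∃ P : E [⋀^Fin 3]→L[ℝ] ℝ,
      LiftsTo π (H + extD (b₀ + formOf π (twoForm κ x.2.2))) P ∧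
      (fun i j k ↦ triLin P (x.1 i) (x.1 j) (x.1 k)) =
        Frame.hst (lieBr E G) (fun i j k ↦ triLin p₀ (f i) (f j) (f k)) κ x := by
  have h1 := hπ.liftsTo_formOf (twoForm κ x.2.2)
  obtain ⟨P, hP, hP'⟩ := hπ.exists_liftsTo_extD h1
  refine ⟨p₀ + P, ?_, ?_⟩
  · rw [extD_add hb₀ (hπ.smoothForm h1), ← add_assoc]
    exact hp₀.add hP
  · funext i j k
    have h2 : triLin (p₀ + P) (x.1 i) (x.1 j) (x.1 k) =
      triLin p₀ (x.1 i) (x.1 j) (x.1 k) + triLin P (x.1 i) (x.1 j) (x.1 k) := rfl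
    rw [h2, hP', Frame.hst, Frame.torsion, hκ.tri_eq, Frame.dTwoForm, twoForm_apply hx,
      twoForm_apply hx, twoForm_apply hx]
    rfl

theorem exists_solution [Group.IsSolvable G] {H : FormField E M 3} (hH : SmoothForm H)
    (hdH : extD H = 0) {g₀ : Metric E M} {b₀ : FormField E M 2} (hb₀ : SmoothForm b₀)
    (hg₀ : InvariantMetric π g₀) (hp₀ : InvariantForm π (H + extD b₀)) :
    ∃ (g : ℝ → Metric E M) (b : ℝ → FormField E M 2), IsSolution H (Ici 0) g b ∧
      IsInvariant π H (Ici 0) g b ∧ g 0 = g₀ ∧ b 0 = b₀ := by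
  obtain ⟨q₀, hq₀⟩ := hπ.invariantMetric_iff.1 hg₀
  obtain ⟨p₀, hp₀⟩ := hπ.invariantForm_iff.1 hp₀
  obtain ⟨f, κ, hκ⟩ := hπ.exists_isONFrame_of_lift hq₀
  have hcard : Fintype.card (Fin (Module.finrank ℝ E)) = Module.finrank ℝ E := Fintype.card_fin _
  have hdata : Frame.FlowData (lieBr E G) (fun i j k ↦ triLin p₀ (f i) (f j) (f k)) κ f :=
    { bracket := hπ.isLieBracket
      solvable := exists_isSolvableFlag
      closed := by rw [hκ.tri_eq]; exact hπ.isClosedThree hH hdH hb₀ hp₀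
      frame := hκ.complete
      card := hcard }
  -- The flow starts at the chosen orthonormal frame with zero 2-form: the state follows b − b₀, and
  -- b₀ enters only through the initial torsion p₀.
  obtain ⟨x, hx0, hx, hxs, hxd⟩ := Frame.exists_flow hdata (f, κ, fun _ _ ↦ 0)
    ⟨hκ.complete, by simp⟩
  -- The frame is known to be a frame only for t ≥ 0, while a family of metrics must be given at all
  -- real times; negative times are sent to 0.
  have hm : ∀ t : ℝ, max t 0 ∈ Ici (0 : ℝ) := fun t ↦ le_max_right t 0
  have hmt : ∀ t ∈ Ici (0 : ℝ), max t 0 = t := fun t ht ↦ max_eq_left ht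
  have hON := fun t ↦ (hxd _ (hm t)).isONFrame hcard
  let g : ℝ → Metric E M := fun t ↦ hπ.metricOf (hON t)
  let b : ℝ → FormField E M 2 := fun t ↦ b₀ + formOf π (twoForm κ (x (max t 0)).2.2)
  have hg : ∀ t, MetricLiftsTo π (g t) (frameMetric (x (max t 0)).2.1) := fun t ↦
    hπ.metricLiftsTo_metricOf (hON t)
  have hgt : ∀ t ∈ Ici (0 : ℝ), MetricLiftsTo π (g t) (frameMetric (x t).2.1) := fun t ht ↦ by
    have := hg t; rwa [hmt t ht] at this
  have hON' : ∀ t ∈ Ici (0 : ℝ), IsONFrame (frameMetric (x t).2.1) (x t).1 (x t).2.1 :=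
    fun t ht ↦ (hxd t ht).isONFrame hcard
  have hbt : ∀ t ∈ Ici (0 : ℝ), b t = b₀ + formOf π (twoForm κ (x t).2.2) := fun t ht ↦ by
    simp only [b, hmt t ht]
  have hb0 : b 0 = b₀ := by
    rw [hbt 0 self_mem_Ici, hx0]
    have : twoForm κ (fun _ _ ↦ 0) = 0 := by simp [twoForm]
    simp only [this]
    funext x
    ext v
    exact add_zero _
  refine ⟨g, b, ⟨fun x₀ ↦ ?_, fun x₀ ↦ ?_, fun t ht z u v ↦ ?_, fun t ht z u v ↦ ?_⟩,
    ⟨?_, fun t ht ↦ hπ.invariantMetric_iff.2 ⟨_, hg t⟩, fun t ht ↦ hπ.invariantForm_iff.2 ?_⟩,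
    ?_, hb0⟩
  · refine hπ.contDiffOn_bilinInChart (D := ℝ) hgt (contDiffOn_bilin fun v w ↦ ?_)
    simp only [frameMetric_apply]
    have h1 : ∀ i (v : E), ContDiffOn ℝ ∞ (fun t ↦ (x t).2.1 i v) (Ici 0) := fun i v ↦
      (contDiffOn_pi.1 hxs.snd.fst i).clm_apply contDiffOn_const
    exact ContDiffOn.sum fun i _ ↦ (h1 i v).mul (h1 i w)
  · have h1 : ContDiffOn ℝ ∞ (fun t ↦ twoForm κ (x t).2.2) (Ici 0) := by
      have h2 : ∀ i j, ContDiffOn ℝ ∞ (fun t ↦ (x t).2.2 i j) (Ici 0) := fun i j ↦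
        contDiffOn_pi.1 (contDiffOn_pi.1 hxs.snd.snd i) j
      unfold twoForm
      exact ContDiffOn.sum fun i _ ↦ ContDiffOn.sum fun j _ ↦
        (contDiffOn_const.mul (h2 i j)).smul contDiffOn_const
    have h3 := hπ.contDiffOn_formInChart (D := ℝ) (x₀ := x₀) (s := Ici 0)
      (θ := fun t ↦ formOf π (twoForm κ (x t).2.2)) (fun t _ ↦ hπ.liftsTo_formOf _) h1
    have h4 : ContDiffOn ℝ ∞ (fun p : ℝ × E ↦ formInChart b₀ x₀ p.2)
        (Ici 0 ×ˢ (extChartAt 𝓘(ℝ, E) x₀).target) :=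
      (hb₀ x₀).comp contDiffOn_snd fun _ hz ↦ hz.2
    refine (h4.add h3).congr fun p hp ↦ ?_
    rw [hbt p.1 hp.1]
    rfl
  · obtain ⟨P, hP, hP'⟩ := hπ.exists_torsion hb₀ hp₀ hκ (hxd t ht).anti
    rw [← hbt t ht] at hP
    rw [← hπ.lift_unlift z u, ← hπ.lift_unlift z v, hπ.ricci_lift (hON' t ht) (hgt t ht),
      hπ.formSq_lift (hON' t ht) (hgt t ht) hP, hP']
    have hxt : HasDerivWithinAt x ((1 : ℝ) • Frame.field (lieBr E G)
        (fun i j k ↦ triLin p₀ (f i) (f j) (f k)) κ f (x t)) (Ici 0) t := by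
      rw [one_smul]; exact hx t ht
    have h1 := fun i w ↦ Frame.hasDeriv_coframe_apply hxt i w
    refine HasDerivWithinAt.congr_deriv (f' := _) (HasDerivWithinAt.congr
      (HasDerivWithinAt.fun_sum fun i (_ : i ∈ Finset.univ) ↦ (h1 i (unlift π z u)).fun_mul
        (h1 i (unlift π z v))) (fun s hs ↦ ?_) ?_) ?_
    · rw [hgt s hs, frameMetric_apply]
    · rw [hgt t ht, frameMetric_apply]
    · have e1 : Frame.cst (lieBr E G) (x t) = fun i j k ↦ (x t).2.1 k (lieBr E G ((x t).1 i) ((x t).1 j)) :=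
        rfl
      rw [← e1]
      generalize Frame.cst (lieBr E G) (x t) = c
      generalize Frame.hst (lieBr E G) (fun i j k ↦ triLin p₀ (f i) (f j) (f k)) κ (x t) = h
      exact Frame.sum_speed c h (fun i ↦ (x t).2.1 i (unlift π z u))
        (fun i ↦ (x t).2.1 i (unlift π z v))
  · obtain ⟨P, hP, hP'⟩ := hπ.exists_torsion hb₀ hp₀ hκ (hxd t ht).anti
    rw [← hbt t ht] at hP
    rw [← hπ.lift_unlift z u, ← hπ.lift_unlift z v, hπ.codiff_lift (hON' t ht) (hgt t ht) hP, hP']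
    have hxt : HasDerivWithinAt x ((1 : ℝ) • Frame.field (lieBr E G)
        (fun i j k ↦ triLin p₀ (f i) (f j) (f k)) κ f (x t)) (Ici 0) t := by
      rw [one_smul]; exact hx t ht
    have h1 := (Frame.hasDeriv_form_apply hκ.complete hxt (unlift π z u) (unlift π z v)).const_add
      (b₀ z ![lift π z (unlift π z u), lift π z (unlift π z v)])
    have h2 : ∀ s ∈ Ici (0 : ℝ), b s z ![lift π z (unlift π z u), lift π z (unlift π z v)] =
        b₀ z ![lift π z (unlift π z u), lift π z (unlift π z v)] +
          Frame.bil κ (x s).2.2 (unlift π z u) (unlift π z v) := fun s hs ↦ by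
      have h3 := hπ.liftsTo_formOf (twoForm κ (x s).2.2) z ![unlift π z u, unlift π z v]
      rw [twoForm_apply (hxd s hs).anti] at h3
      rw [hbt s hs]
      have e : ![lift π z (unlift π z u), lift π z (unlift π z v)] =
          fun i ↦ lift π z (![unlift π z u, unlift π z v] i) := by
        funext i; fin_cases i <;> rfl
      exact congrArg₂ (· + ·) rfl ((congrArg (formOf π (twoForm κ (x s).2.2) z) e).trans h3)
    refine (h1.congr h2 (h2 t ht)).congr_deriv ?_
    -- The velocity of the 2-form is an antisymmetrized codifferential, which is the codifferential
    -- itself because the torsion is alternating.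
    have hcod := ((hxd t ht).isClosedForm hdata.bracket hdata.closed).codiff_anti
    rw [one_mul]
    congr 1
    refine Finset.sum_congr rfl fun i _ ↦ Finset.sum_congr rfl fun j _ ↦ ?_
    rw [hcod j i]
    change _ = Frame.codiff (Frame.cst (lieBr E G) (x t)) _ i j * _
    ring
  · rw [hb0]; exact hπ.invariantForm_iff.2 ⟨p₀, hp₀⟩
  · refine ⟨twoForm κ (x t).2.2, ?_⟩
    have : b t - b 0 = formOf π (twoForm κ (x t).2.2) := by
      rw [hb0, hbt t ht]
      funext z
      ext v
      exact add_sub_cancel_left _ _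
    rw [this]
    exact hπ.liftsTo_formOf _
  · refine metric_ext fun z u v ↦ ?_
    rw [← hπ.lift_unlift z u, ← hπ.lift_unlift z v, hgt 0 self_mem_Ici, hq₀, hx0, hκ.metric,
      frameMetric_apply]

end IsQuotient

end GRF

/-! ## Uniqueness of invariant solutions -/

namespace GRF

variable {E : Type*} [NormedAddCommGroup E] [NormedSpace ℝ E] {ι : Type*} [Fintype ι]

namespace IsONFrame

variable [DecidableEq ι] {q₀ : E →L[ℝ] E →L[ℝ] ℝ} {f : ι → E} {κ : ι → E →L[ℝ] ℝ} (hκ : IsONFrame q₀ f κ)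

include hκ

lemma bil_eq (q : E →L[ℝ] E →L[ℝ] ℝ) : Frame.bil κ (fun i j ↦ q (f i) (f j)) = q := by
  ext u v
  rw [Frame.bil_apply]
  exact (hκ.expand₂ (LinearMap.mk₂ ℝ (fun v w ↦ q v w) (by simp) (by simp) (by simp) (by simp))
    u v).symm

lemma twoForm_eq (β : E [⋀^Fin 2]→L[ℝ] ℝ) : twoForm κ (fun i j ↦ β ![f i, f j]) = β := by
  have hanti : ∀ u v, β ![u, v] = -β ![v, u] := fun u v ↦ by
    have h := β.toAlternatingMap.map_swap ![v, u] (show (0 : Fin 2) ≠ 1 by decide)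
    have e : ![v, u] ∘ Equiv.swap (0 : Fin 2) 1 = ![u, v] := by
      ext i; fin_cases i <;> rfl
    rw [e] at h
    exact h
  have e0 : ∀ u v z : E, Function.update ![u, v] 0 z = ![z, v] := fun u v z ↦ by
    ext i; fin_cases i <;> rfl
  have hadd : ∀ u u' v, β ![u + u', v] = β ![u, v] + β ![u', v] := fun u u' v ↦ by
    have h := β.toMultilinearMap.map_update_add ![u, v] 0 u u'
    simp only [e0] at h
    exact h
  have hsmul : ∀ (a : ℝ) u v, β ![a • u, v] = a • β ![u, v] := fun a u v ↦ by
    have h := β.toMultilinearMap.map_update_smul ![u, v] 0 a u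
    simp only [e0] at h
    exact h
  ext v
  rw [twoForm_apply fun i j ↦ hanti _ _, Frame.bil_apply]
  have hv : v = ![v 0, v 1] := by ext i; fin_cases i <;> rfl
  conv_rhs => rw [hv]
  exact (hκ.expand₂ (LinearMap.mk₂ ℝ (fun v w ↦ β ![v, w]) hadd hsmul
    (fun u v w ↦ by rw [hanti, hadd, hanti v, hanti w]; ring)
    (fun a u v ↦ by rw [hanti, hsmul, hanti v, smul_neg, neg_neg])) (v 0) (v 1)).symm

end IsONFrame

variable [FiniteDimensional ℝ E]
  {G : Type*} [Group G] [TopologicalSpace G] [ChartedSpace E G] [LieGroup 𝓘(ℝ, E) ∞ G]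
  {M : Type*} [TopologicalSpace M] [ChartedSpace E M] [IsManifold 𝓘(ℝ, E) ∞ M]
  {Γ : Subgroup G} {π : G → M}

/-- The components of a metric and a `2`-form. -/
abbrev Components (ι : Type*) : Type _ := (ι → ι → ℝ) × (ι → ι → ℝ)

/-- The invariant metric with given components, in the chart at `x`. -/
def metricInChart (π : G → M) (x : M) (κ : ι → E →L[ℝ] ℝ) (d : Components ι) (z : E) :
    E →L[ℝ] E →L[ℝ] ℝ := pullInner (Frame.bil κ d.1) (frameInv π x z)

/-- The invariant `2`-form with given components, in the chart at `x`. -/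
def twoFormInChart (π : G → M) (x : M) (κ : ι → E →L[ℝ] ℝ) (d : Components ι) (z : E) :
    E [⋀^Fin 2]→L[ℝ] ℝ := (twoForm κ d.2).compContinuousLinearMap (frameInv π x z)

/-- The torsion of the invariant `2`-form with given components, in the chart at `x`. -/
def torsionInChart (π : G → M) (x : M) (κ : ι → E →L[ℝ] ℝ) (p₀ : E [⋀^Fin 3]→L[ℝ] ℝ)
    (d : Components ι) (z : E) : E [⋀^Fin 3]→L[ℝ] ℝ :=
  p₀.compContinuousLinearMap (frameInv π x z) + extDeriv (twoFormInChart π x κ d) z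

/-- The generalized Ricci flow in terms of the components of the metric and the `2`-form. -/
def componentField (π : G → M) (x : M) (f : ι → E) (κ : ι → E →L[ℝ] ℝ)
    (p₀ : E [⋀^Fin 3]→L[ℝ] ℝ) (d : Components ι) : Components ι :=
  let y := extChartAt 𝓘(ℝ, E) x x
  let F : ι → E := fun i ↦ frameMap π x y (f i)
  (fun i j ↦ -2 * LocalGeom.ricci (metricInChart π x κ d) y (F i) (F j)
      + 1 / 2 * LocalGeom.formSq (metricInChart π x κ d y) (torsionInChart π x κ p₀ d y)
        (F i) (F j),
    fun i j ↦ -LocalGeom.codiff (metricInChart π x κ d) (torsionInChart π x κ p₀ d) y (F i) (F j))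

namespace IsQuotient

variable (hπ : IsQuotient (E := E) Γ π) {x : M} {κ : ι → E →L[ℝ] ℝ} {f : ι → E}
  {p₀ : E [⋀^Fin 3]→L[ℝ] ℝ}

include hπ

lemma contDiffAt_metricInChart (d₀ : Components ι) {y : E}
    (hy : y ∈ (extChartAt 𝓘(ℝ, E) x).target) :
    ContDiffAt ℝ ∞ (fun p : Components ι × E ↦ metricInChart π x κ p.1 p.2) (d₀, y) := by
  refine ContDiffOn.contDiffAt (s := univ ×ˢ (extChartAt 𝓘(ℝ, E) x).target)
    (contDiffOn_bilin fun v w ↦ ?_) (prod_mem_nhds Filter.univ_mem (chart_target_mem_nhds hy))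
  have h := hπ.contDiffOn_frameInv_snd (x₀ := x) (s := (univ : Set (Components ι)))
  have h1 : ∀ i v, ContDiffOn ℝ ∞ (fun p : Components ι × E ↦ κ i (frameInv π x p.2 v))
      (univ ×ˢ (extChartAt 𝓘(ℝ, E) x).target) := fun i v ↦
    (κ i).contDiff.comp_contDiffOn (h.clm_apply contDiffOn_const)
  simp only [metricInChart, pullInner_apply, Frame.bil_apply]
  refine ContDiffOn.sum fun i _ ↦ ContDiffOn.sum fun j _ ↦ ContDiffOn.mul ?_ ((h1 i v).mul (h1 j w))
  exact ContDiff.contDiffOn (by fun_prop)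

lemma contDiffAt_twoFormInChart (d₀ : Components ι) {y : E}
    (hy : y ∈ (extChartAt 𝓘(ℝ, E) x).target) :
    ContDiffAt ℝ ∞ (fun p : Components ι × E ↦ twoFormInChart π x κ p.1 p.2) (d₀, y) := by
  refine ContDiffOn.contDiffAt (s := univ ×ˢ (extChartAt 𝓘(ℝ, E) x).target)
    (contDiffOn_pullback_form ?_ hπ.contDiffOn_frameInv_snd)
    (prod_mem_nhds Filter.univ_mem (chart_target_mem_nhds hy))
  unfold twoForm
  have h : ∀ i j, ContDiffOn ℝ ∞ (fun p : Components ι × E ↦ 1 / 2 * p.1.2 i j)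
      (univ ×ˢ (extChartAt 𝓘(ℝ, E) x).target) := fun i j ↦ ContDiff.contDiffOn (by fun_prop)
  exact ContDiffOn.sum fun i _ ↦ ContDiffOn.sum fun j _ ↦ (h i j).smul contDiffOn_const

lemma contDiffAt_torsionInChart (d₀ : Components ι) {y : E}
    (hy : y ∈ (extChartAt 𝓘(ℝ, E) x).target) :
    ContDiffAt ℝ ∞ (fun p : Components ι × E ↦ torsionInChart π x κ p₀ p.1 p.2) (d₀, y) := by
  have h1 : ContDiffAt ℝ ∞ (fun p : Components ι × E ↦
      p₀.compContinuousLinearMap (frameInv π x p.2)) (d₀, y) :=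
    ContDiffOn.contDiffAt (s := univ ×ˢ (extChartAt 𝓘(ℝ, E) x).target)
      (contDiffOn_pullback_form contDiffOn_const hπ.contDiffOn_frameInv_snd)
      (prod_mem_nhds Filter.univ_mem (chart_target_mem_nhds hy))
  have h2 : ContDiffAt ℝ ∞ (fun p : Components ι × E ↦
      fderiv ℝ (twoFormInChart π x κ p.1) p.2) (d₀, y) :=
    ContDiffAt.fderiv (m := ∞) (f := fun p : Components ι × E ↦ twoFormInChart π x κ p.1)
      (g := Prod.snd) (contDiffAt_comp_fst (hπ.contDiffAt_twoFormInChart d₀ hy))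
      contDiffAt_snd (by simp)
  exact h1.add (ContDiffAt.comp
    (g := ContinuousAlternatingMap.alternatizeUncurryFinCLM (n := 2) ℝ E ℝ) (d₀, y)
    (ContinuousLinearMap.contDiff _).contDiffAt h2)

/-- The formulas of local geometry are smooth in the components as long as the metric can be
inverted. Uniqueness is proved for components instead of frames because a metric does not determine
its orthonormal frame. -/
lemma contDiffOn_componentField : ContDiffOn ℝ 1 (componentField π x f κ p₀)
    {d | (metricInChart π x κ d (extChartAt 𝓘(ℝ, E) x x)).IsInvertible} := by
  intro d hd
  have hy := mem_extChartAt_target (I := 𝓘(ℝ, E)) x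
  have h1 := hπ.contDiffAt_metricInChart (κ := κ) d hy
  have h2 := hπ.contDiffAt_torsionInChart (κ := κ) (p₀ := p₀) d hy
  refine (ContDiffAt.prodMk (contDiffAt_pi.2 fun i ↦ contDiffAt_pi.2 fun j ↦ ?_)
    (contDiffAt_pi.2 fun i ↦ contDiffAt_pi.2 fun j ↦ ?_) :
      ContDiffAt ℝ ∞ (componentField π x f κ p₀) d).contDiffWithinAt.of_le (by simp)
  · exact (contDiffAt_const.mul (contDiffAt_ricci h1 hd _ _)).add
      (contDiffAt_const.mul (contDiffAt_formSq h1 hd h2 _ _))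
  · exact (contDiffAt_codiff h1 hd h2 _ _).neg

lemma isOpen_invertible : IsOpen
    {d : Components ι | (metricInChart π x κ d (extChartAt 𝓘(ℝ, E) x x)).IsInvertible} := by
  have := FiniteDimensional.complete ℝ E
  have h : Continuous fun d : Components ι ↦ metricInChart π x κ d (extChartAt 𝓘(ℝ, E) x x) :=
    continuous_iff_continuousAt.2 fun d ↦ ContinuousAt.comp
      (g := fun p : Components ι × E ↦ metricInChart π x κ p.1 p.2)
      (f := fun d ↦ (d, extChartAt 𝓘(ℝ, E) x x))
      (hπ.contDiffAt_metricInChart d (mem_extChartAt_target x)).continuousAt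
      (continuous_id.prodMk continuous_const).continuousAt
  exact (ContinuousLinearEquiv.isOpen (𝕜 := ℝ) (E := E) (F := E →L[ℝ] ℝ)).preimage h

variable [DecidableEq ι] {q₀ : E →L[ℝ] E →L[ℝ] ℝ} (hκ : IsONFrame q₀ f κ) {S : Set ℝ} {H : FormField E M 3}
  {g : ℝ → Metric E M} {b : ℝ → FormField E M 2}

omit hπ in
/-- The components of a metric and a `2`-form at a point. -/
def componentsAt (π : G → M) (x : M) (f : ι → E) (g : Metric E M) (β : FormField E M 2) :
    Components ι :=
  (fun i j ↦ g.inner x (lift π x (f i)) (lift π x (f j)),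
    fun i j ↦ β x ![lift π x (f i), lift π x (f j)])

omit hπ [FiniteDimensional ℝ E] [LieGroup 𝓘(ℝ, E) ∞ G] [IsManifold 𝓘(ℝ, E) ∞ M] in
include hκ in
lemma bil_componentsAt {g : Metric E M} {q : E →L[ℝ] E →L[ℝ] ℝ} (hq : MetricLiftsTo π g q)
    (β : FormField E M 2) : Frame.bil κ (componentsAt π x f g β).1 = q := by
  simp only [componentsAt, hq x]
  exact hκ.bil_eq q

omit hπ [FiniteDimensional ℝ E] [LieGroup 𝓘(ℝ, E) ∞ G] [IsManifold 𝓘(ℝ, E) ∞ M] in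
include hκ in
lemma twoForm_componentsAt {β : FormField E M 2} {p : E [⋀^Fin 2]→L[ℝ] ℝ} (hβ : LiftsTo π β p)
    (g : Metric E M) : twoForm κ (componentsAt π x f g β).2 = p := by
  have h : ∀ i j, β x ![lift π x (f i), lift π x (f j)] = p ![f i, f j] := fun i j ↦ by
    rw [← hβ x]
    congr 1
    funext k; fin_cases k <;> rfl
  simp only [componentsAt, h]
  exact hκ.twoForm_eq p

include hκ

lemma isInvertible_componentsAt {g : Metric E M} {q : E →L[ℝ] E →L[ℝ] ℝ}
    (hq : MetricLiftsTo π g q) (β : FormField E M 2) :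
    (metricInChart π x κ (componentsAt π x f g β) (extChartAt 𝓘(ℝ, E) x x)).IsInvertible := by
  obtain ⟨e, ε, he⟩ := hπ.exists_isONFrame_of_lift hq
  refine (hπ.movingFrame x).metric_isInvertible (mem_extChartAt_target x) (fun z hz v w ↦ ?_) he.pos
  rw [metricInChart, bil_componentsAt hκ hq, pullInner_apply, (hπ.movingFrame x).left_inv z hz,
    (hπ.movingFrame x).left_inv z hz]

/-- By invariance, the components at the single point x determine the metric and the torsion in the
whole chart, so the flow equation at x closes up to an ordinary differential equation. -/
lemma hasDerivWithinAt_componentsAt (hs : IsSolution H S g b) (hi : IsInvariant π H S g b)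
    (hb : SmoothForm (b 0)) (hp₀ : LiftsTo π (H + extD (b 0)) p₀) {t : ℝ} (ht : t ∈ S) :
    HasDerivWithinAt (fun s ↦ componentsAt π x f (g s) (b s - b 0))
      (componentField π x f κ p₀ (componentsAt π x f (g t) (b t - b 0))) S t := by
  obtain ⟨q, hq⟩ := hπ.invariantMetric_iff.1 (hi.metric t ht)
  obtain ⟨p, hp⟩ := hπ.invariantForm_iff.1 (hi.form t ht)
  have hy := mem_extChartAt_target (I := 𝓘(ℝ, E)) x
  set d := componentsAt π x f (g t) (b t - b 0) with hd
  have hγ : ∀ z ∈ (extChartAt 𝓘(ℝ, E) x).target,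
      bilinInChart (g t).inner x z = metricInChart π x κ d z := fun z hz ↦ by
    ext v w
    rw [hπ.bilinInChart_eq hq hz, metricInChart, hd, bil_componentsAt hκ hq, pullInner_apply]
  have hβ : ∀ z ∈ (extChartAt 𝓘(ℝ, E) x).target,
      formInChart (b t - b 0) x z = twoFormInChart π x κ d z := fun z hz ↦ by
    rw [hπ.formInChart_eq hp hz, twoFormInChart, hd, twoForm_componentsAt hκ hp]
  have hη : ∀ z ∈ (extChartAt 𝓘(ℝ, E) x).target,
      formInChart (H + extD (b t)) x z = torsionInChart π x κ p₀ d z := fun z hz ↦ by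
    have h1 : H + extD (b t) = H + extD (b 0) + extD (b t - b 0) := by
      rw [add_assoc, ← extD_add hb (hπ.smoothForm hp), add_sub_cancel]
    rw [h1, formInChart_add, Pi.add_apply, hπ.formInChart_eq hp₀ hz,
      formInChart_extD (hπ.smoothForm hp) hz, torsionInChart]
    congr 1
    have h2 : formInChart (b t - b 0) x =ᶠ[𝓝 z] twoFormInChart π x κ d :=
      Filter.eventually_of_mem (chart_target_mem_nhds hz) hβ
    exact h2.extDeriv_eq
  -- Agreement near the point is needed, since the Ricci tensor and the codifferential involve
  -- derivatives.
  have hγ' : bilinInChart (g t).inner x =ᶠ[𝓝 (extChartAt 𝓘(ℝ, E) x x)] metricInChart π x κ d :=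
    Filter.eventually_of_mem (chart_target_mem_nhds hy) hγ
  have hη' : formInChart (H + extD (b t)) x =ᶠ[𝓝 (extChartAt 𝓘(ℝ, E) x x)]
      torsionInChart π x κ p₀ d := Filter.eventually_of_mem (chart_target_mem_nhds hy) hη
  refine HasDerivWithinAt.prodMk (hasDerivWithinAt_pi.2 fun i ↦ hasDerivWithinAt_pi.2 fun j ↦ ?_)
    (hasDerivWithinAt_pi.2 fun i ↦ hasDerivWithinAt_pi.2 fun j ↦ ?_)
  · have h := hs.metric_eq t ht x (lift π x (f i)) (lift π x (f j))
    rw [ricci, formSq, hπ.dChart_lift, hπ.dChart_lift, ricci_congr hγ', hγ _ hy, hη _ hy] at h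
    exact h
  · have h := (hs.form_eq t ht x (lift π x (f i)) (lift π x (f j))).sub_const
      (b 0 x ![lift π x (f i), lift π x (f j)])
    rw [codiff, hπ.dChart_lift, hπ.dChart_lift, codiff_congr hγ' hη'] at h
    exact h

omit hκ in
-- The components of both solutions at π 1 solve the same equation in the open set of invertible
-- metrics. Equality at this point spreads to M by invariance, and b is recovered from b − b₀.
theorem solution_unique {T : ℝ} (hT : 0 < T) {g' : ℝ → Metric E M} {b' : ℝ → FormField E M 2}
    (hb : SmoothForm (b 0))
    (hs : IsSolution H (Ico 0 T) g b) (hi : IsInvariant π H (Ico 0 T) g b)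
    (hs' : IsSolution H (Ico 0 T) g' b') (hi' : IsInvariant π H (Ico 0 T) g' b')
    (hg0 : g 0 = g' 0) (hb0 : b 0 = b' 0) {t : ℝ} (ht : t ∈ Ico 0 T) : g t = g' t ∧ b t = b' t := by
  obtain ⟨q₀, hq₀⟩ := hπ.invariantMetric_iff.1 (hi.metric 0 ⟨le_rfl, hT⟩)
  obtain ⟨p₀, hp₀⟩ := hπ.invariantForm_iff.1 hi.torsion
  obtain ⟨f, κ, hκ⟩ := hπ.exists_isONFrame_of_lift hq₀
  have hinv : ∀ {g : ℝ → Metric E M} {b : ℝ → FormField E M 2}, IsInvariant π H (Ico 0 T) g b →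
      ∀ t ∈ Ico 0 T, componentsAt π (π 1) f (g t) (b t - b 0) ∈ {d | (metricInChart π (π 1) κ d
        (extChartAt 𝓘(ℝ, E) (π 1) (π 1))).IsInvertible} := fun hi t ht ↦ by
    obtain ⟨q, hq⟩ := hπ.invariantMetric_iff.1 (hi.metric t ht)
    exact hπ.isInvertible_componentsAt hκ hq _
  have h := ODE.uniqueness hπ.isOpen_invertible (hπ.contDiffOn_componentField (x := π 1) (f := f)
    (κ := κ) (p₀ := p₀)) (fun t ht ↦ hπ.hasDerivWithinAt_componentsAt hκ hs hi hb hp₀ ht)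
    (fun t ht ↦ hπ.hasDerivWithinAt_componentsAt hκ hs' hi' (hb0 ▸ hb) (hb0 ▸ hp₀) ht)
    (hinv hi) (hinv hi') (by rw [hg0, hb0]) ht
  dsimp only at h
  obtain ⟨q, hq⟩ := hπ.invariantMetric_iff.1 (hi.metric t ht)
  obtain ⟨q', hq'⟩ := hπ.invariantMetric_iff.1 (hi'.metric t ht)
  obtain ⟨p, hp⟩ := hπ.invariantForm_iff.1 (hi.form t ht)
  obtain ⟨p', hp'⟩ := hπ.invariantForm_iff.1 (hi'.form t ht)
  have hqq : q = q' := by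
    rw [← bil_componentsAt (x := π 1) hκ hq (b t - b 0), h, bil_componentsAt hκ hq']
  have hpp : p = p' := by
    rw [← twoForm_componentsAt (x := π 1) hκ hp (g t), h, twoForm_componentsAt hκ hp']
  refine ⟨metric_ext fun z u v ↦ ?_, ?_⟩
  · rw [← hπ.lift_unlift z u, ← hπ.lift_unlift z v, hq, hq', hqq]
  · have h1 : b t - b 0 = b' t - b' 0 := by
      funext z
      ext u
      have hu : u = fun i ↦ lift π z (unlift π z (u i)) := by
        funext i; rw [hπ.lift_unlift]
      rw [hu, hp, hp', hpp]
    rw [hb0] at h1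
    exact sub_left_injective h1

end IsQuotient

end GRF

/-! ### Restriction of solutions to smaller sets of times -/

namespace GRF

lemma IsSolution.smoothForm {E : Type*} [NormedAddCommGroup E] [NormedSpace ℝ E]
    [FiniteDimensional ℝ E] {M : Type*} [TopologicalSpace M] [ChartedSpace E M]
    {H : FormField E M 3} {S : Set ℝ} {g : ℝ → Metric E M} {b : ℝ → FormField E M 2}
    (hs : IsSolution H S g b) {t : ℝ} (ht : t ∈ S) : SmoothForm (b t) := fun x₀ ↦
  ContDiffOn.comp (g := fun p : ℝ × E ↦ formInChart (b p.1) x₀ p.2) (f := fun y : E ↦ (t, y))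
    (hs.smooth_form x₀) (contDiffOn_const.prodMk contDiffOn_id) fun _ hy ↦ ⟨ht, hy⟩

lemma IsSolution.mono {E : Type*} [NormedAddCommGroup E] [NormedSpace ℝ E]
    [FiniteDimensional ℝ E] {M : Type*} [TopologicalSpace M] [ChartedSpace E M]
    {H : FormField E M 3} {S S' : Set ℝ} {g : ℝ → Metric E M} {b : ℝ → FormField E M 2}
    (hs : IsSolution H S g b) (h : S' ⊆ S) : IsSolution H S' g b where
  smooth_metric x₀ := (hs.smooth_metric x₀).mono (prod_mono h Subset.rfl)
  smooth_form x₀ := (hs.smooth_form x₀).mono (prod_mono h Subset.rfl)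
  metric_eq t ht x u v := (hs.metric_eq t (h ht) x u v).mono h
  form_eq t ht x u v := (hs.form_eq t (h ht) x u v).mono h

lemma IsInvariant.mono {E : Type*} [NormedAddCommGroup E] [NormedSpace ℝ E]
    {G : Type*} [Group G] [TopologicalSpace G] [ChartedSpace E G]
    {M : Type*} [TopologicalSpace M] [ChartedSpace E M] {π : G → M}
    {H : FormField E M 3} {S S' : Set ℝ} {g : ℝ → Metric E M} {b : ℝ → FormField E M 2}
    (hi : IsInvariant π H S g b) (h : S' ⊆ S) : IsInvariant π H S' g b where
  torsion := hi.torsion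
  metric t ht := hi.metric t (h ht)
  form t ht := hi.form t (h ht)

end GRF

end

/-! ### The theorem on long-time existence -/

theorem theoremA
    {E : Type*} [NormedAddCommGroup E] [NormedSpace ℝ E] [FiniteDimensional ℝ E]
    -- a solvable Lie group and a discrete subgroup
    {G : Type*} [Group G] [TopologicalSpace G] [ChartedSpace E G] [LieGroup 𝓘(ℝ, E) ∞ G]
    [Group.IsSolvable G] (Γ : Subgroup G) [DiscreteTopology Γ]
    -- the solvmanifold
    {M : Type*} [TopologicalSpace M] [ChartedSpace E M] [IsManifold 𝓘(ℝ, E) ∞ M]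
    (π : G → M) (hπ : GRF.IsQuotient (E := E) Γ π)
    -- a closed 3-form on it
    (H : GRF.FormField E M 3) (hH : GRF.SmoothForm H) (hdH : GRF.extD H = 0) :
    -- every invariant solution extends to all positive times
    (∀ (T : ℝ), 0 < T → ∀ (g : ℝ → GRF.Metric E M) (b : ℝ → GRF.FormField E M 2),
      GRF.IsSolution H (Ico 0 T) g b → GRF.IsInvariant π H (Ico 0 T) g b →
      ∃ (g' : ℝ → GRF.Metric E M) (b' : ℝ → GRF.FormField E M 2),
        GRF.IsSolution H (Ici 0) g' b' ∧ GRF.IsInvariant π H (Ici 0) g' b' ∧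
        ∀ t ∈ Ico 0 T, g' t = g t ∧ b' t = b t) ∧
    -- and there is an invariant solution for all invariant initial data
    (∀ (g₀ : GRF.Metric E M) (b₀ : GRF.FormField E M 2),
      GRF.SmoothMetric g₀ → GRF.SmoothForm b₀ →
      GRF.InvariantMetric π g₀ → GRF.InvariantForm π (H + GRF.extD b₀) →
      ∃ (g : ℝ → GRF.Metric E M) (b : ℝ → GRF.FormField E M 2),
        GRF.IsSolution H (Ici 0) g b ∧ GRF.IsInvariant π H (Ici 0) g b ∧
        g 0 = g₀ ∧ b 0 = b₀) := by
  refine ⟨fun T hT g b hs hi ↦ ?_, fun g₀ b₀ _ hb₀ hg₀ hp₀ ↦ hπ.exists_solution hH hdH hb₀ hg₀ hp₀⟩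
  have h0 : (0 : ℝ) ∈ Ico 0 T := ⟨le_rfl, hT⟩
  have hsub : Ico 0 T ⊆ Ici (0 : ℝ) := fun t ht ↦ ht.1
  -- The global solution with the initial value of the given one; its restriction to [0,T) is the
  -- given solution by uniqueness.
  obtain ⟨g', b', hs', hi', hg0, hb0⟩ := hπ.exists_solution hH hdH (hs.smoothForm h0)
    (hi.metric 0 h0) hi.torsion
  exact ⟨g', b', hs', hi', fun t ht ↦ hπ.solution_unique hT (hs'.smoothForm self_mem_Ici)
    (hs'.mono hsub) (hi'.mono hsub) hs hi hg0 hb0 ht⟩
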